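/- For $n\ge 0$ let $\mathscr{H}_n=\sum_{k=0}^{n}\frac{1}{2k+1}$, and continue $\mathscr{H}$ to negative indices by $\mathscr{H}_{-1}=0$ and $\mathscr{H}_{-(n+2)}=\mathscr{H}_n$ for $n\ge 0$. Let $\zeta$ be the Riemann zeta function, $\beta(4)=\sum_{n\ge 0}\frac{(-1)^n}{(2n+1)^4}$ and $\operatorname{Li}_4(x)=\sum_{n\ge 1}\frac{x^n}{n^4}$. Then all the series below converge (absolutely, except the two series with $\mathscr{H}_n^3$, which are limits of partial sums, the one over $\mathbb{Z}$ being taken over $-M\le n\le N$ with $M,N\to\infty$ independently), and $$\sum_{n\ge 0}\frac{1}{(2n+1)^3}\left[\frac{1}{4^n}\binom{2n}{n}\right]^2={}_5F_4\left(\tfrac12,\tfrac12,\tfrac12,\tfrac12,\tfrac12;1,\tfrac32,\tfrac32,\tfrac32;1\right)=\frac{16}{3\pi}\sum_{n\ge 0}\frac{(-1)^n\mathscr{H}_n^3}{2n+1}-\frac{\log^3 2}{6}-\frac{\pi^2}{12}\log 2+\frac{3}{16}\zeta(3)+\frac{4}{3\pi}\beta(4).$$ Moreover $$\sum_{n\in\mathbb{Z}}\frac{(-1)^n\mathscr{H}_n^3}{2n+1}=\frac{\pi}{16}\log^3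 2+\frac{\pi^3}{32}\log 2-\frac{9\pi}{128}\zeta(3),$$ $$\sum_{n\in\mathbb{Z}}\frac{\mathscr{H}_n^2}{(2n+1)^2}=\frac{\pi^2}{4}\log^2 2+\frac{\pi^4}{96},\qquad \sum_{n\in\mathbb{Z}}\frac{(-1)^n\mathscr{H}_n^2}{(2n+1)^2}=\frac{\pi^3}{16}\log 2-\frac{7\pi}{64}\zeta(3),$$ $$\sum_{n\ge 0}\frac{\mathscr{H}_n^2}{(2n+1)^2}=\frac{83\pi^4}{5760}+\frac{\pi^2}{6}\log^2 2-\frac{\log^4 2}{24}-\operatorname{Li}_4\left(\tfrac12\right).$$ -/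

import Mathlib

open Filter Topology

/-- The odd harmonic numbers `𝓗_n = ∑_{k=0}^{n} 1/(2k+1)`, `n ≥ 0`. -/
noncomputable def oddHarmonic (n : ℕ) : ℝ :=
  ∑ k ∈ Finset.range (n + 1), 1 / (2 * (k : ℝ) + 1)

/-- The odd harmonic numbers continued to all integer indices by `𝓗_{-1} = 0` and
`𝓗_{-(n+2)} = 𝓗_n` for `n ≥ 0`. -/
noncomputable def oddHarmonicInt : ℤ → ℝ
  | Int.ofNat n => oddHarmonic n
  | Int.negSucc 0 => 0
  | Int.negSucc (n + 1) => oddHarmonic n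

theorem oddHarmonicInt_natCast (n : ℕ) : oddHarmonicInt (n : ℤ) = oddHarmonic n := rfl

theorem oddHarmonicInt_neg_one : oddHarmonicInt (-1) = 0 := rfl

theorem oddHarmonicInt_neg_add_two (n : ℕ) :
    oddHarmonicInt (-((n : ℤ) + 2)) = oddHarmonic n := by
  have h : (-((n : ℤ) + 2)) = Int.negSucc (n + 1) := by
    rw [Int.negSucc_eq]; push_cast; ring
  rw [h, oddHarmonicInt]

/-- The generalized hypergeometric function
`pFq(a; b; z) = ∑_{n ≥ 0} (∏ (a_i)_n / ∏ (b_j)_n) z^n / n!`,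
obtained from Mathlib's regularized version, whose coefficients are divided by `∏ Γ(b_j)`. -/
noncomputable def hypergeometricPFQ (a b : Multiset ℂ) (z : ℂ) : ℂ :=
  (b.map Complex.Gamma).prod * Complex.regularizedHGFun a b z

/-- The Dirichlet beta function `β(s) = ∑_{n ≥ 0} (-1)^n / (2n+1)^s` at integers `s ≥ 2`
(where the series converges absolutely). -/
noncomputable def dirichletBetaNat (s : ℕ) : ℝ :=
  ∑' n : ℕ, (-1 : ℝ) ^ n / (2 * (n : ℝ) + 1) ^ s

/-- The polylogarithm `Li_s(x) = ∑_{n ≥ 1} x^n / n^s` for real `|x| < 1` and natural `s`. -/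
noncomputable def polylogNat (s : ℕ) (x : ℝ) : ℝ :=
  ∑' n : ℕ, x ^ (n + 1) / ((n : ℝ) + 1) ^ s

/-! Write a_n = 1/(2n+1), H_n for the odd harmonic number and M_n = H_n + H_{n-1} = 2H_n - a_n.
Expanding in shifted Legendre polynomials turns 1/(2m+1)^3 into a finite alternating sum over n ≤ m
with weights M_n^2 + a_n^2 (`sum_legendreCoeff_mul`). The squared central binomials are, up to a
factor, the Taylor coefficients of the complete elliptic integral, whose Legendre moments are 4
a_n^2 / π (`hasSum_wallisSq_mul_legendreCoeff`). Exchanging the sums gives S = (2/π) ∑ (-1)^n a_n^2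
(M_n^2 + a_n^2), which is (2/π)(4C₂ - 4A₁ + 2β(4)) with C₂ = ∑ (-1)^n H_n^2 a_n^2 and A₁ = ∑ (-1)^n
H_n a_n^3.

Folding the bilateral cubic sum onto n ≥ 0 gives V = 2C - 3C₂ + 3A₁ - β(4), where C is the
unilateral cubic sum. The same difference C₂ - A₁ occurs in both relations, so it can be eliminated
without evaluating C₂ or A₁, and only V is needed.

The bilateral sums come from Fourier analysis on (0, π). The coefficients of log sin and log² sin
against sin((2n+1)θ) are polynomials in M_n and a_n times a_n (`oddSinCoeff_log_sin_pow_one`,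
`oddSinCoeff_log_sin_pow_two`), so Parseval against log sin, against 1 and against a triangle
function gives the two quadratic sums. For V, which converges only conditionally, take F = log² sin
- 2 log 2 · log sin and its companion F · tan. Their coefficients c and e satisfy e_{n+1} + e_n =
c_{n+1} - c_n, and Abel summation turns ∑ (-1)^n M_n c_n into -∑ (-1)^n a_n e_n, which Parseval
against a sign function reduces to the integral of F · tan over (0, π/2)
(`tendsto_sum_alternating_oddHarmonicMid_mul_oddSinCoeff`).

The unilateral quadratic sum needs in addition the linear Euler sum ∑ H_n a_n^3
(`hasSum_oddHarmonic_mul_oddInv_pow_three`). It splits into ordinary Euler sums, evaluated partly by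
Euler's partial fractions and partly by a linear system of logarithmic integrals on (0, 1/2), which
is where Li_4(1/2) enters. -/

theorem HasSum.of_eq {ι : Type*} {f g : ι → ℝ} {a b : ℝ} (h : HasSum f a)
    (hfg : ∀ i, g i = f i) (hab : a = b) : HasSum g b := by
  rw [← hab, funext hfg]; exact h

/-! ### Odd harmonic numbers. -/

/-- The reciprocal `1 / (2n + 1)` of the `n`-th odd number. -/
noncomputable def oddInv (n : ℕ) : ℝ := 1 / (2 * (n : ℝ) + 1)

/-- The sum `𝓗_n + 𝓗_{n-1}` of two consecutive odd harmonic numbers. -/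
noncomputable def oddHarmonicMid (n : ℕ) : ℝ := 2 * oddHarmonic n - oddInv n

theorem oddInv_pos (n : ℕ) : 0 < oddInv n := by unfold oddInv; positivity

theorem oddInv_le_one (n : ℕ) : oddInv n ≤ 1 := by
  unfold oddInv
  rw [div_le_one (by positivity)]
  have : (0 : ℝ) ≤ n := n.cast_nonneg
  linarith

theorem oddInv_zero : oddInv 0 = 1 := by simp [oddInv]

theorem oddHarmonic_zero : oddHarmonic 0 = 1 := by simp [oddHarmonic]

theorem oddHarmonic_succ (n : ℕ) : oddHarmonic (n + 1) = oddHarmonic n + oddInv (n + 1) := by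
  simp [oddHarmonic, oddInv, Finset.sum_range_succ]

theorem oddHarmonicMid_zero : oddHarmonicMid 0 = 1 := by
  norm_num [oddHarmonicMid, oddHarmonic_zero, oddInv_zero]

theorem oddHarmonicMid_succ (n : ℕ) :
    oddHarmonicMid (n + 1) = oddHarmonicMid n + oddInv n + oddInv (n + 1) := by
  simp only [oddHarmonicMid, oddHarmonic_succ]; ring

theorem one_le_oddHarmonic (n : ℕ) : 1 ≤ oddHarmonic n := by
  induction n with
  | zero => rw [oddHarmonic_zero]
  | succ n ih => rw [oddHarmonic_succ]; linarith [oddInv_pos (n + 1)]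

theorem oddHarmonic_le_oddHarmonicMid (n : ℕ) : oddHarmonic n ≤ oddHarmonicMid n := by
  unfold oddHarmonicMid; linarith [one_le_oddHarmonic n, oddInv_le_one n]

theorem oddHarmonicMid_le (n : ℕ) : oddHarmonicMid n ≤ 2 * oddHarmonic n := by
  unfold oddHarmonicMid; linarith [oddInv_pos n]

theorem one_le_oddHarmonicMid (n : ℕ) : 1 ≤ oddHarmonicMid n :=
  (one_le_oddHarmonic n).trans (oddHarmonic_le_oddHarmonicMid n)

/-! ### Shifted Legendre expansion of 1/(2m+1)^3. -/

/-- The coefficients `m!² / ((m-n)! (m+n+1)!)` of the expansion of `x ^ m` in shifted Legendre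
polynomials. -/
noncomputable def legendreCoeff (m n : ℕ) : ℝ :=
  (∏ j ∈ Finset.range n, ((m : ℝ) - j) / (m + j + 2)) / (m + 1)

theorem legendreCoeff_zero (m : ℕ) : legendreCoeff m 0 = 1 / (m + 1) := by simp [legendreCoeff]

theorem legendreCoeff_succ (m n : ℕ) :
    legendreCoeff m (n + 1) = legendreCoeff m n * (((m : ℝ) - n) / (m + n + 2)) := by
  simp only [legendreCoeff, Finset.prod_range_succ]; ring

theorem legendreCoeff_eq_zero {m n : ℕ} (h : m < n) : legendreCoeff m n = 0 := by
  unfold legendreCoeff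
  rw [Finset.prod_eq_zero (Finset.mem_range.2 h) (by simp), zero_div]

theorem legendreCoeff_nonneg (m n : ℕ) : 0 ≤ legendreCoeff m n := by
  rcases lt_or_ge m n with h | h
  · rw [legendreCoeff_eq_zero h]
  · refine div_nonneg (Finset.prod_nonneg fun j hj => div_nonneg ?_ (by positivity))
      (by positivity)
    have : j ≤ m := (Finset.mem_range.1 hj).le.trans h
    exact sub_nonneg.2 (by exact_mod_cast this)

theorem legendreCoeff_le (m n : ℕ) : legendreCoeff m n ≤ 1 / (m + 1) := by
  induction n with
  | zero => rw [legendreCoeff_zero]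
  | succ n ih =>
    rw [legendreCoeff_succ]
    refine le_trans (mul_le_of_le_one_right (legendreCoeff_nonneg m n) ?_) ih
    rw [div_le_one (by positivity)]
    have : (0 : ℝ) ≤ n := n.cast_nonneg
    linarith

/-- A truncated expansion of `1 / (2m+1)^3`, the second order term in `u - 1/2` of the
telescoping expansion of `1 / (m + u)` in shifted Legendre moments. -/
theorem sum_legendreCoeff_mul_range (m N : ℕ) :
    ∑ n ∈ Finset.range N, (-1 : ℝ) ^ n * legendreCoeff m n *
        (oddHarmonicMid n ^ 2 + oddInv n ^ 2) =
      2 * oddInv m ^ 3 - (-1) ^ N * (m + N + 1) * legendreCoeff m N * (2 * oddInv m) *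
        (2 * (oddHarmonic N - oddInv N) ^ 2 + 2 * oddInv m * (oddHarmonic N - oddInv N)
          + oddInv m ^ 2) := by
  induction N with
  | zero =>
    rw [legendreCoeff_zero, oddHarmonic_zero, oddInv_zero]
    have : (m : ℝ) + 1 ≠ 0 := by positivity
    simp only [Finset.range_zero, Finset.sum_empty]
    push_cast
    field_simp
    ring
  | succ N ih =>
    rw [Finset.sum_range_succ, ih, legendreCoeff_succ, oddHarmonic_succ]
    simp only [oddHarmonicMid, oddInv]
    have h1 : (m : ℝ) + N + 2 ≠ 0 := by positivity
    have h2 : 2 * (m : ℝ) + 1 ≠ 0 := by positivity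
    have h3 : 2 * (N : ℝ) + 1 ≠ 0 := by positivity
    have h4 : (m : ℝ) + N + 1 + 1 ≠ 0 := by positivity
    push_cast
    field_simp
    ring

theorem sum_legendreCoeff_mul (m : ℕ) :
    ∑ n ∈ Finset.range (m + 1), (-1 : ℝ) ^ n * legendreCoeff m n *
        (oddHarmonicMid n ^ 2 + oddInv n ^ 2) = 2 * oddInv m ^ 3 := by
  -- At N = m + 1 the remainder carries `legendreCoeff m (m + 1)`, which vanishes because x^m has
  -- degree m.
  rw [sum_legendreCoeff_mul_range, legendreCoeff_eq_zero (Nat.lt_succ_self m)]; ring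

/-! ### Legendre moments of the series with squared central binomial coefficients. -/

/-- The square of the normalized central binomial coefficient `4^{-n} (2n choose n)`. -/
noncomputable def wallisSq (n : ℕ) : ℝ := ((Nat.centralBinom n : ℝ) / 4 ^ n) ^ 2

theorem wallisSq_nonneg (n : ℕ) : 0 ≤ wallisSq n := sq_nonneg _

theorem wallisSq_succ (n : ℕ) :
    wallisSq (n + 1) = wallisSq n * ((2 * (n : ℝ) + 1) / (2 * n + 2)) ^ 2 := by
  have h : ((n : ℝ) + 1) * Nat.centralBinom (n + 1) = 2 * (2 * n + 1) * Nat.centralBinom n := by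
    exact_mod_cast Nat.succ_mul_centralBinom_succ n
  have h1 : (n : ℝ) + 1 ≠ 0 := by positivity
  have h2 : (Nat.centralBinom (n + 1) : ℝ) = 2 * (2 * n + 1) * Nat.centralBinom n / (n + 1) := by
    field_simp; linarith
  unfold wallisSq
  rw [h2, ← mul_pow]
  congr 1
  field_simp
  ring

theorem wallisSq_mul_eq (n : ℕ) : wallisSq n * (2 * n + 1) = (Real.Wallis.W n)⁻¹ := by
  induction n with
  | zero => simp [wallisSq, Real.Wallis.W]
  | succ n ih =>
    rw [Real.Wallis.W_succ, mul_inv, ← ih, wallisSq_succ]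
    push_cast
    field_simp
    ring

theorem tendsto_mul_wallisSq : Tendsto (fun n : ℕ => 4 * (n : ℝ) * wallisSq n) atTop
    (𝓝 (4 / Real.pi)) := by
  have h1 : Tendsto (fun n : ℕ => (Real.Wallis.W n)⁻¹) atTop (𝓝 (Real.pi / 2)⁻¹) :=
    Real.Wallis.tendsto_W_nhds_pi_div_two.inv₀ (by positivity)
  have h2 : Tendsto (fun n : ℕ => (4 * (n : ℝ)) / (2 * n + 1)) atTop (𝓝 2) := by
    have h := (tendsto_natCast_div_add_atTop (1 / 2 : ℝ)).const_mul 2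
    simp only [mul_one] at h
    refine h.congr fun n => ?_
    have : (n : ℝ) + 1 / 2 ≠ 0 := by positivity
    field_simp
    ring
  have h3 := h2.mul h1
  have e : (2 : ℝ) * (Real.pi / 2)⁻¹ = 4 / Real.pi := by field_simp; norm_num
  rw [e] at h3
  refine h3.congr fun n => ?_
  rw [← wallisSq_mul_eq]
  field_simp

theorem tendsto_wallisSq : Tendsto wallisSq atTop (𝓝 0) := by
  have h := tendsto_mul_wallisSq.mul (tendsto_inv_atTop_nhds_zero_nat (𝕜 := ℝ))
  rw [mul_zero] at h
  have h' := h.div_const 4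
  rw [zero_div] at h'
  refine h'.congr' ?_
  filter_upwards [eventually_gt_atTop 0] with n hn
  have : (n : ℝ) ≠ 0 := by exact_mod_cast hn.ne'
  field_simp

/-- Induction on n by creative telescoping. For n = 0 the partial sums are exactly 4N `wallisSq N`,
whose limit is Wallis' product; each step in n multiplies the sum by (2n+1)²/(2n+3)², up to a
boundary term that tends to zero. -/
theorem hasSum_wallisSq_mul_legendreCoeff (n : ℕ) :
    HasSum (fun m => wallisSq m * legendreCoeff m n) (4 / Real.pi * oddInv n ^ 2) := by
  rw [hasSum_iff_tendsto_nat_of_nonneg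
    fun m => mul_nonneg (wallisSq_nonneg m) (legendreCoeff_nonneg m n)]
  induction n with
  | zero =>
    rw [oddInv_zero, one_pow, mul_one]
    refine tendsto_mul_wallisSq.congr fun N => ?_
    induction N with
    | zero => simp
    | succ N ih =>
      rw [Finset.sum_range_succ, ← ih, legendreCoeff_zero, wallisSq_succ]
      push_cast
      field_simp
      ring
  | succ n ih =>
    -- Telescoping certificate: the terms for n + 1 and the rescaled terms for n differ by the
    -- increment in M of the last expression.
    have hG : ∀ M : ℕ, ∑ m ∈ Finset.range M, wallisSq m * legendreCoeff m (n + 1) =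
        (∑ m ∈ Finset.range M, wallisSq m * legendreCoeff m n) *
          ((2 * (n : ℝ) + 1) ^ 2 / (2 * n + 3) ^ 2)
        - 8 * (n + 1) / (2 * n + 3) ^ 2 * (((M : ℝ) - n) * wallisSq M * legendreCoeff M n) := by
      intro M
      induction M with
      | zero =>
        rcases n.eq_zero_or_pos with rfl | hn
        · simp
        · simp [legendreCoeff_eq_zero hn]
      | succ M ihM =>
        -- The ratio of `legendreCoeff` in its first argument, cleared of denominators so that it
        -- also holds when M + 1 = n.
        have key : ((M : ℝ) + 1 - n) * (M + n + 2) * legendreCoeff (M + 1) n =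
            (M + 1) ^ 2 * legendreCoeff M n := by
          clear ih ihM
          induction n with
          | zero =>
            rw [legendreCoeff_zero, legendreCoeff_zero]
            push_cast
            field_simp
            ring
          | succ n ih =>
            rw [legendreCoeff_succ, legendreCoeff_succ]
            have h1 : (M : ℝ) + n + 2 ≠ 0 := by positivity
            have h2 : (M : ℝ) + 1 + n + 2 ≠ 0 := by positivity
            push_cast
            have e : ((M : ℝ) + 1 - (n + 1)) * (M + (n + 1) + 2) *
                (legendreCoeff (M + 1) n * ((M + 1 - n) / (M + 1 + n + 2))) =
                (((M : ℝ) + 1 - n) * (M + n + 2) * legendreCoeff (M + 1) n)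
                  * ((M - n) / (M + n + 2)) := by
              field_simp
              ring
            rw [e, ih]
            ring
        have h1 : (M : ℝ) + n + 2 ≠ 0 := by positivity
        have key' : ((M : ℝ) + 1 - n) * legendreCoeff (M + 1) n =
            (M + 1) ^ 2 * legendreCoeff M n / (M + n + 2) := by
          rw [← key]; field_simp
        have e : ((↑(M + 1) : ℝ) - n) * wallisSq (M + 1) * legendreCoeff (M + 1) n =
            wallisSq (M + 1) * ((M + 1) ^ 2 * legendreCoeff M n / (M + n + 2)) := by
          rw [← key']; push_cast; ring
        rw [Finset.sum_range_succ, Finset.sum_range_succ, ihM, e, wallisSq_succ,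
          legendreCoeff_succ]
        field_simp
        ring
    have hlim : Tendsto (fun M : ℕ => ((M : ℝ) - n) * wallisSq M * legendreCoeff M n) atTop
        (𝓝 0) := by
      refine squeeze_zero_norm' ?_ tendsto_wallisSq
      filter_upwards [eventually_ge_atTop n] with M hM
      have h0 : (n : ℝ) ≤ M := by exact_mod_cast hM
      have h1 : (0 : ℝ) ≤ n := n.cast_nonneg
      rw [Real.norm_of_nonneg (mul_nonneg (mul_nonneg (sub_nonneg.2 h0) (wallisSq_nonneg _))
        (legendreCoeff_nonneg _ _))]
      calc ((M : ℝ) - n) * wallisSq M * legendreCoeff M n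
          ≤ ((M : ℝ) + 1) * wallisSq M * (1 / (M + 1)) :=
            mul_le_mul (mul_le_mul_of_nonneg_right (by linarith) (wallisSq_nonneg _))
              (legendreCoeff_le _ _) (legendreCoeff_nonneg _ _)
              (mul_nonneg (by positivity) (wallisSq_nonneg _))
        _ = wallisSq M := by field_simp
    have h := (ih.mul_const ((2 * (n : ℝ) + 1) ^ 2 / (2 * n + 3) ^ 2)).sub
      (hlim.const_mul (8 * ((n : ℝ) + 1) / (2 * n + 3) ^ 2))
    simp only [← hG] at h
    convert h using 2
    simp only [oddInv]
    push_cast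
    field_simp
    ring

/-- The Legendre expansion of `∑ ((2n choose n) / 4^n)^2 / (2n+1)^3`. -/
theorem hasSum_wallisSq_mul_oddInv_pow_three {S : ℝ}
    (hs : Summable fun n => oddInv n ^ 2 * (oddHarmonicMid n ^ 2 + oddInv n ^ 2))
    (hS : HasSum (fun n => (-1 : ℝ) ^ n * (oddInv n ^ 2 *
      (oddHarmonicMid n ^ 2 + oddInv n ^ 2))) S) :
    HasSum (fun m => wallisSq m * oddInv m ^ 3) (2 / Real.pi * S) := by
  -- The double series is evaluated in both orders. Absolute convergence comes from summing over m
  -- first, where all factors but the sign are nonnegative, and then using `hs`.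
  set f : ℕ × ℕ → ℝ := fun p => wallisSq p.2 * legendreCoeff p.2 p.1 *
    ((-1 : ℝ) ^ p.1 * (oddHarmonicMid p.1 ^ 2 + oddInv p.1 ^ 2)) with hf
  have hfs : Summable f := by
    rw [← summable_norm_iff]
    have hn : ∀ p : ℕ × ℕ, ‖f p‖ = wallisSq p.2 * legendreCoeff p.2 p.1 *
        (oddHarmonicMid p.1 ^ 2 + oddInv p.1 ^ 2) := by
      intro p
      rw [hf, norm_mul, norm_mul, norm_mul, norm_pow, norm_neg, norm_one, one_pow, one_mul,
        Real.norm_of_nonneg (wallisSq_nonneg _), Real.norm_of_nonneg (legendreCoeff_nonneg _ _),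
        Real.norm_of_nonneg (by positivity)]
    rw [summable_prod_of_nonneg fun p => norm_nonneg _]
    simp_rw [hn]
    refine ⟨fun n => ((hasSum_wallisSq_mul_legendreCoeff n).mul_right _).summable, ?_⟩
    refine (hs.mul_left (4 / Real.pi)).congr fun n => ?_
    rw [((hasSum_wallisSq_mul_legendreCoeff n).mul_right _).tsum_eq]
    ring
  have h1 : HasSum (fun n => 4 / Real.pi * oddInv n ^ 2 *
      ((-1 : ℝ) ^ n * (oddHarmonicMid n ^ 2 + oddInv n ^ 2))) (∑' p, f p) :=
    hfs.hasSum.prod_fiberwise fun n => (hasSum_wallisSq_mul_legendreCoeff n).mul_right _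
  have h2 : ∑' p, f p = 4 / Real.pi * S := by
    refine h1.unique ((hS.mul_left (4 / Real.pi)).of_eq (fun n => ?_) rfl)
    ring
  have h3 : HasSum (fun m => wallisSq m * (2 * oddInv m ^ 3)) (∑' p, f p) := by
    have hsw : HasSum (fun p : ℕ × ℕ => f p.swap) (∑' p, f p) :=
      (Equiv.prodComm ℕ ℕ).hasSum_iff.2 hfs.hasSum
    refine hsw.prod_fiberwise fun m => ?_
    rw [← sum_legendreCoeff_mul m, Finset.mul_sum]
    have : ∀ n ∉ Finset.range (m + 1), f (m, n).swap = 0 := by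
      intro n hn
      have : m < n := by simpa using hn
      simp [hf, legendreCoeff_eq_zero this]
    refine (hasSum_sum_of_ne_finset_zero this).of_eq (fun n => rfl) ?_
    exact Finset.sum_congr rfl fun n _ => by simp only [hf, Prod.swap]; ring
  rw [h2] at h3
  exact (h3.mul_left (1 / 2)).of_eq (fun m => by ring) (by ring)

/-! ### Parseval's identity on (0, π) for odd and even frequencies. -/

open MeasureTheory in
theorem hasSum_sq_integral_mul_cos_add_sin {F : ℝ → ℝ}
    (hF : MemLp F 2 (volume.restrict (Set.Ioc 0 Real.pi))) (σ : ℝ) :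
    HasSum (fun k : ℤ => (∫ θ in (0 : ℝ)..Real.pi, F θ * Real.cos ((2 * k + σ) * θ)) ^ 2
      + (∫ θ in (0 : ℝ)..Real.pi, F θ * Real.sin ((2 * k + σ) * θ)) ^ 2)
      (Real.pi * ∫ θ in (0 : ℝ)..Real.pi, F θ ^ 2) := by
  have hpi : (0 : ℝ) < Real.pi := Real.pi_pos
  -- The twist by exp(-iσθ) shifts the frequencies 2k of the Fourier basis of an interval of length
  -- π to 2k + σ.
  set f : ℝ → ℂ := fun θ => (F θ : ℂ) * Complex.exp (-(σ * θ : ℝ) * Complex.I) with hf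
  have hnorm : ∀ θ, ‖f θ‖ = ‖F θ‖ := by
    intro θ
    rw [hf, norm_mul, ← Complex.ofReal_neg, Complex.norm_exp_ofReal_mul_I, mul_one,
      Complex.norm_real]
  have hfm : MemLp f 2 (volume.restrict (Set.Ioc 0 Real.pi)) := by
    refine hF.congr_norm ?_ (Eventually.of_forall fun θ => (hnorm θ).symm)
    refine AEStronglyMeasurable.mul ?_ (by fun_prop)
    exact Complex.continuous_ofReal.comp_aestronglyMeasurable hF.1
  have hint : IntervalIntegrable F volume 0 Real.pi := by
    rw [intervalIntegrable_iff_integrableOn_Ioc_of_le hpi.le]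
    exact hF.integrable (by norm_num)
  have h := hasSum_sq_fourierCoeffOn hpi hfm
  refine (h.mul_left (Real.pi ^ 2)).of_eq (fun k => ?_) ?_
  · rw [fourierCoeffOn_eq_integral]
    have e : ∀ θ : ℝ, fourier (-k) (θ : AddCircle (Real.pi - 0)) • f θ =
        ((F θ * Real.cos ((2 * k + σ) * θ) : ℝ) : ℂ)
          - ((F θ * Real.sin ((2 * k + σ) * θ) : ℝ) : ℂ) * Complex.I := by
      intro θ
      rw [fourier_coe_apply, hf, smul_eq_mul, mul_left_comm, ← Complex.exp_add]
      have : 2 * (Real.pi : ℂ) * Complex.I * ((-k : ℤ) : ℂ) * θ / ((Real.pi - 0 : ℝ) : ℂ)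
          + -((σ * θ : ℝ) : ℂ) * Complex.I =
          ((-((2 * k + σ) * θ) : ℝ) : ℂ) * Complex.I := by
        have : (Real.pi : ℂ) ≠ 0 := by exact_mod_cast hpi.ne'
        push_cast
        rw [sub_zero]
        field_simp
        ring
      rw [this, Complex.exp_mul_I, ← Complex.ofReal_cos, ← Complex.ofReal_sin, Real.cos_neg,
        Real.sin_neg]
      push_cast
      ring
    have hc : IntervalIntegrable (fun θ => F θ * Real.cos ((2 * k + σ) * θ)) volume 0 Real.pi :=
      hint.mul_continuousOn (by fun_prop)
    have hs : IntervalIntegrable (fun θ => F θ * Real.sin ((2 * k + σ) * θ)) volume 0 Real.pi :=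
      hint.mul_continuousOn (by fun_prop)
    simp only [e]
    have hc' : IntervalIntegrable (fun θ => ((F θ * Real.cos ((2 * k + σ) * θ) : ℝ) : ℂ))
        volume 0 Real.pi := ⟨hc.1.ofReal, hc.2.ofReal⟩
    have hs' : IntervalIntegrable (fun θ => ((F θ * Real.sin ((2 * k + σ) * θ) : ℝ) : ℂ))
        volume 0 Real.pi := ⟨hs.1.ofReal, hs.2.ofReal⟩
    rw [intervalIntegral.integral_sub hc' (hs'.mul_const _),
      intervalIntegral.integral_mul_const, intervalIntegral.integral_ofReal,
      intervalIntegral.integral_ofReal, norm_smul, mul_pow, ← Complex.normSq_eq_norm_sq,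
      Complex.normSq_apply]
    simp
    field_simp
  · simp only [hnorm, Real.norm_eq_abs, sq_abs, sub_zero, smul_eq_mul]
    field_simp

open MeasureTheory in
/-- **Parseval's identity** on `(0, π)` for the shifted system `exp (i (2k + σ) θ)`. -/
theorem hasSum_integral_mul_cos_add_sin {F G : ℝ → ℝ}
    (hF : MemLp F 2 (volume.restrict (Set.Ioc 0 Real.pi)))
    (hG : MemLp G 2 (volume.restrict (Set.Ioc 0 Real.pi))) (σ : ℝ) :
    HasSum (fun k : ℤ => (∫ θ in (0 : ℝ)..Real.pi, F θ * Real.cos ((2 * k + σ) * θ)) *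
        (∫ θ in (0 : ℝ)..Real.pi, G θ * Real.cos ((2 * k + σ) * θ))
      + (∫ θ in (0 : ℝ)..Real.pi, F θ * Real.sin ((2 * k + σ) * θ)) *
        (∫ θ in (0 : ℝ)..Real.pi, G θ * Real.sin ((2 * k + σ) * θ)))
      (Real.pi * ∫ θ in (0 : ℝ)..Real.pi, F θ * G θ) := by
  have hpi : (0 : ℝ) ≤ Real.pi := Real.pi_pos.le
  have hi : ∀ {H : ℝ → ℝ}, MemLp H 2 (volume.restrict (Set.Ioc 0 Real.pi)) →
      IntervalIntegrable H volume 0 Real.pi := fun h => by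
    rw [intervalIntegrable_iff_integrableOn_Ioc_of_le hpi]
    exact h.integrable (by norm_num)
  have hm : ∀ {H K : ℝ → ℝ}, MemLp H 2 (volume.restrict (Set.Ioc 0 Real.pi)) →
      MemLp K 2 (volume.restrict (Set.Ioc 0 Real.pi)) →
      IntervalIntegrable (fun θ => H θ * K θ) volume 0 Real.pi := fun h h' => by
    rw [intervalIntegrable_iff_integrableOn_Ioc_of_le hpi]
    exact h.integrable_mul h'
  -- Polarisation: 4FG = (F + G)² - (F - G)².
  have hadd := hasSum_sq_integral_mul_cos_add_sin (hF.add hG) σ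
  have hsub := hasSum_sq_integral_mul_cos_add_sin (hF.sub hG) σ
  refine ((hadd.sub hsub).mul_left (1 / 4)).of_eq (fun k => ?_) ?_
  · have hc : ∀ {H : ℝ → ℝ}, MemLp H 2 (volume.restrict (Set.Ioc 0 Real.pi)) →
        IntervalIntegrable (fun θ => H θ * Real.cos ((2 * k + σ) * θ)) volume 0 Real.pi :=
      fun h => (hi h).mul_continuousOn (by fun_prop)
    have hs : ∀ {H : ℝ → ℝ}, MemLp H 2 (volume.restrict (Set.Ioc 0 Real.pi)) →
        IntervalIntegrable (fun θ => H θ * Real.sin ((2 * k + σ) * θ)) volume 0 Real.pi :=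
      fun h => (hi h).mul_continuousOn (by fun_prop)
    simp only [Pi.add_apply, Pi.sub_apply, add_mul, sub_mul]
    rw [intervalIntegral.integral_add (by simpa only [add_mul] using hc hF)
        (by simpa only [add_mul] using hc hG),
      intervalIntegral.integral_add (by simpa only [add_mul] using hs hF)
        (by simpa only [add_mul] using hs hG),
      intervalIntegral.integral_sub (by simpa only [add_mul] using hc hF)
        (by simpa only [add_mul] using hc hG),
      intervalIntegral.integral_sub (by simpa only [add_mul] using hs hF)
        (by simpa only [add_mul] using hs hG)]
    ring
  · have e1 : ∫ θ in (0 : ℝ)..Real.pi, (F + G) θ ^ 2 =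
        (∫ θ in (0 : ℝ)..Real.pi, F θ * F θ) + 2 * (∫ θ in (0 : ℝ)..Real.pi, F θ * G θ)
          + ∫ θ in (0 : ℝ)..Real.pi, G θ * G θ := by
      rw [← intervalIntegral.integral_const_mul, ← intervalIntegral.integral_add (hm hF hF)
        ((hm hF hG).const_mul 2), ← intervalIntegral.integral_add
        ((hm hF hF).add ((hm hF hG).const_mul 2)) (hm hG hG)]
      congr 1; funext θ; simp only [Pi.add_apply]; ring
    have e2 : ∫ θ in (0 : ℝ)..Real.pi, (F - G) θ ^ 2 =
        (∫ θ in (0 : ℝ)..Real.pi, F θ * F θ) - 2 * (∫ θ in (0 : ℝ)..Real.pi, F θ * G θ)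
          + ∫ θ in (0 : ℝ)..Real.pi, G θ * G θ := by
      rw [← intervalIntegral.integral_const_mul, ← intervalIntegral.integral_sub (hm hF hF)
        ((hm hF hG).const_mul 2), ← intervalIntegral.integral_add
        ((hm hF hF).sub ((hm hF hG).const_mul 2)) (hm hG hG)]
      congr 1; funext θ; simp only [Pi.sub_apply]; ring
    rw [e1, e2]; ring

/-- The coefficient of `F` on `(0, π)` with respect to `sin ((2n+1) θ)`. -/
noncomputable def oddSinCoeff (F : ℝ → ℝ) (n : ℕ) : ℝ :=
  ∫ θ in (0 : ℝ)..Real.pi, F θ * Real.sin ((2 * n + 1) * θ)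

/-- The coefficient of `F` on `(0, π)` with respect to `cos ((2n+1) θ)`. -/
noncomputable def oddCosCoeff (F : ℝ → ℝ) (n : ℕ) : ℝ :=
  ∫ θ in (0 : ℝ)..Real.pi, F θ * Real.cos ((2 * n + 1) * θ)

/-- The coefficient of `F` on `(0, π)` with respect to `cos (2n θ)`. -/
noncomputable def evenCosCoeff (F : ℝ → ℝ) (n : ℕ) : ℝ :=
  ∫ θ in (0 : ℝ)..Real.pi, F θ * Real.cos (2 * n * θ)

theorem intervalIntegral_zero_pi_eq_zero {f : ℝ → ℝ} (hf : ∀ θ, f (Real.pi - θ) = -f θ) :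
    ∫ θ in (0 : ℝ)..Real.pi, f θ = 0 := by
  have h := intervalIntegral.integral_comp_sub_left (a := 0) (b := Real.pi) f Real.pi
  rw [sub_self, sub_zero] at h
  simp only [hf, intervalIntegral.integral_neg] at h
  linarith

theorem cos_odd_mul_pi_sub (n : ℕ) (θ : ℝ) :
    Real.cos ((2 * n + 1) * (Real.pi - θ)) = -Real.cos ((2 * n + 1) * θ) := by
  rw [show (2 * (n : ℝ) + 1) * (Real.pi - θ) = (Real.pi - (2 * n + 1) * θ) + n * (2 * Real.pi)
    by ring, Real.cos_add_nat_mul_two_pi, Real.cos_pi_sub]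

theorem sin_odd_mul_pi_sub (n : ℕ) (θ : ℝ) :
    Real.sin ((2 * n + 1) * (Real.pi - θ)) = Real.sin ((2 * n + 1) * θ) := by
  rw [show (2 * (n : ℝ) + 1) * (Real.pi - θ) = (Real.pi - (2 * n + 1) * θ) + n * (2 * Real.pi)
    by ring, Real.sin_add_nat_mul_two_pi, Real.sin_pi_sub]

theorem sin_even_mul_pi_sub (n : ℕ) (θ : ℝ) :
    Real.sin (2 * n * (Real.pi - θ)) = -Real.sin (2 * n * θ) := by
  rw [show 2 * (n : ℝ) * (Real.pi - θ) = -(2 * n * θ) + n * (2 * Real.pi)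
    by ring, Real.sin_add_nat_mul_two_pi, Real.sin_neg]

theorem oddCosCoeff_eq_zero {F : ℝ → ℝ} (hF : ∀ θ, F (Real.pi - θ) = F θ) (n : ℕ) :
    oddCosCoeff F n = 0 :=
  intervalIntegral_zero_pi_eq_zero fun θ => by rw [hF, cos_odd_mul_pi_sub]; ring

theorem oddSinCoeff_eq_zero {F : ℝ → ℝ} (hF : ∀ θ, F (Real.pi - θ) = -F θ) (n : ℕ) :
    oddSinCoeff F n = 0 :=
  intervalIntegral_zero_pi_eq_zero fun θ => by rw [hF, sin_odd_mul_pi_sub]; ring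

open MeasureTheory in
theorem hasSum_oddCosCoeff_mul_add {F G : ℝ → ℝ}
    (hF : MemLp F 2 (volume.restrict (Set.Ioc 0 Real.pi)))
    (hG : MemLp G 2 (volume.restrict (Set.Ioc 0 Real.pi))) :
    HasSum (fun n => oddCosCoeff F n * oddCosCoeff G n + oddSinCoeff F n * oddSinCoeff G n)
      (Real.pi / 2 * ∫ θ in (0 : ℝ)..Real.pi, F θ * G θ) := by
  -- With σ = 1, the indices n and -(n+1) have opposite frequencies ±(2n+1) and equal contributions,
  -- hence the factor 1/2.
  have h := (hasSum_integral_mul_cos_add_sin hF hG 1).nat_add_neg_add_one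
  refine (h.mul_left (1 / 2)).of_eq (fun n => ?_) (by ring)
  have e : ∀ θ : ℝ, (2 * ((-((n : ℤ) + 1) : ℤ) : ℝ) + 1) * θ = -((2 * n + 1) * θ) := by
    intro θ; push_cast; ring
  simp only [e, Real.cos_neg, Real.sin_neg, mul_neg, intervalIntegral.integral_neg]
  simp only [oddCosCoeff, oddSinCoeff, Int.cast_natCast]
  ring

open MeasureTheory in
theorem hasSum_oddSinCoeff_mul {F G : ℝ → ℝ}
    (hF : MemLp F 2 (volume.restrict (Set.Ioc 0 Real.pi)))
    (hG : MemLp G 2 (volume.restrict (Set.Ioc 0 Real.pi)))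
    (hs : ∀ θ, F (Real.pi - θ) = F θ) :
    HasSum (fun n => oddSinCoeff F n * oddSinCoeff G n)
      (Real.pi / 2 * ∫ θ in (0 : ℝ)..Real.pi, F θ * G θ) :=
  (hasSum_oddCosCoeff_mul_add hF hG).of_eq (fun n => by rw [oddCosCoeff_eq_zero hs]; ring) rfl

open MeasureTheory in
theorem hasSum_oddCosCoeff_mul {F G : ℝ → ℝ}
    (hF : MemLp F 2 (volume.restrict (Set.Ioc 0 Real.pi)))
    (hG : MemLp G 2 (volume.restrict (Set.Ioc 0 Real.pi)))
    (hs : ∀ θ, F (Real.pi - θ) = -F θ) :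
    HasSum (fun n => oddCosCoeff F n * oddCosCoeff G n)
      (Real.pi / 2 * ∫ θ in (0 : ℝ)..Real.pi, F θ * G θ) :=
  (hasSum_oddCosCoeff_mul_add hF hG).of_eq (fun n => by rw [oddSinCoeff_eq_zero hs]; ring) rfl

open MeasureTheory in
theorem hasSum_evenCosCoeff_mul {F G : ℝ → ℝ}
    (hF : MemLp F 2 (volume.restrict (Set.Ioc 0 Real.pi)))
    (hG : MemLp G 2 (volume.restrict (Set.Ioc 0 Real.pi)))
    (hs : ∀ θ, F (Real.pi - θ) = F θ) :
    HasSum (fun n => evenCosCoeff F (n + 1) * evenCosCoeff G (n + 1))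
      (Real.pi / 2 * (∫ θ in (0 : ℝ)..Real.pi, F θ * G θ)
        - 1 / 2 * (evenCosCoeff F 0 * evenCosCoeff G 0)) := by
  have h := (hasSum_integral_mul_cos_add_sin hF hG 0).nat_add_neg
  have h2 : HasSum (fun n => evenCosCoeff F n * evenCosCoeff G n)
      (Real.pi / 2 * (∫ θ in (0 : ℝ)..Real.pi, F θ * G θ)
        + 1 / 2 * (evenCosCoeff F 0 * evenCosCoeff G 0)) := by
    refine (h.mul_left (1 / 2)).of_eq (fun n => ?_) ?_
    · have e : ∀ θ : ℝ, (2 * ((-(n : ℤ) : ℤ) : ℝ) + 0) * θ = -(2 * n * θ) := by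
        intro θ; push_cast; ring
      have hz : ∫ θ in (0 : ℝ)..Real.pi, F θ * Real.sin (2 * n * θ) = 0 :=
        intervalIntegral_zero_pi_eq_zero fun θ => by rw [hs, sin_even_mul_pi_sub]; ring
      simp only [e, Real.cos_neg, Real.sin_neg, mul_neg, intervalIntegral.integral_neg]
      simp only [evenCosCoeff, Int.cast_natCast, add_zero, hz]
      ring
    · simp [evenCosCoeff]
      ring
  have h3 := (hasSum_nat_add_iff' 1).2 h2
  refine h3.of_eq (fun n => rfl) ?_
  simp
  ring

/-! ### Integrability of powers of log and log sin. -/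

open MeasureTheory in
theorem intervalIntegrable_of_abs_le {a b : ℝ} (hab : a ≤ b) {f g : ℝ → ℝ} (hf : Measurable f)
    (hg : IntervalIntegrable g volume a b) (h : ∀ x ∈ Set.Ioo a b, |f x| ≤ g x) :
    IntervalIntegrable f volume a b := by
  rw [intervalIntegrable_iff_integrableOn_Ioo_of_le hab] at hg ⊢
  refine Integrable.mono' hg hf.aestronglyMeasurable ?_
  filter_upwards [ae_restrict_mem measurableSet_Ioo] with x hx using h x hx

theorem abs_log_pow_le (k : ℕ) {x : ℝ} (h0 : 0 < x) (h1 : x ≤ 1) :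
    |Real.log x| ^ k ≤ (2 * ((k : ℝ) + 1)) ^ k * x ^ (-(1 / 2) : ℝ) := by
  -- The exponent t satisfies t · k ≤ 1/2, so the k-th power of |log x| ≤ x^(-t)/t stays below a
  -- multiple of x^(-1/2).
  set t : ℝ := 1 / (2 * ((k : ℝ) + 1)) with ht
  have htpos : 0 < t := by positivity
  have h := (Real.abs_log_mul_self_rpow_lt x t h0 h1 htpos).le
  rw [abs_mul, abs_of_pos (Real.rpow_pos_of_pos h0 t), ht, one_div_one_div, ← ht] at h
  have hx : |Real.log x| ≤ (2 * ((k : ℝ) + 1)) * x ^ (-t) := by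
    rw [Real.rpow_neg h0.le, ← div_eq_mul_inv, le_div_iff₀ (Real.rpow_pos_of_pos h0 t)]
    exact h
  calc |Real.log x| ^ k ≤ ((2 * ((k : ℝ) + 1)) * x ^ (-t)) ^ k := by gcongr
    _ = (2 * ((k : ℝ) + 1)) ^ k * x ^ (-t * k) := by
      rw [mul_pow, ← Real.rpow_mul_natCast h0.le]
    _ ≤ (2 * ((k : ℝ) + 1)) ^ k * x ^ (-(1 / 2) : ℝ) := by
      refine mul_le_mul_of_nonneg_left ?_ (by positivity)
      refine Real.rpow_le_rpow_of_exponent_ge h0 h1 ?_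
      rw [ht, neg_mul, neg_le_neg_iff, div_mul_eq_mul_div, one_mul,
        div_le_div_iff₀ (by positivity) (by norm_num)]
      linarith

theorem intervalIntegrable_log_pow (k : ℕ) {b : ℝ} (h0 : 0 ≤ b) (h1 : b ≤ 1) :
    IntervalIntegrable (fun x => Real.log x ^ k) MeasureTheory.volume 0 b := by
  refine intervalIntegrable_of_abs_le h0 (Real.measurable_log.pow_const k)
    ((intervalIntegral.intervalIntegrable_rpow' (r := -(1 / 2)) (by norm_num)).const_mul
      ((2 * ((k : ℝ) + 1)) ^ k)) fun x hx => ?_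
  rw [abs_pow]
  exact abs_log_pow_le k hx.1 (hx.2.le.trans h1)

/-- Near each end of (0, π) the sine is at least a quarter of the distance to that end; the two
integrable singularities are added to cover both halves at once. -/
theorem sin_rpow_neg_half_le {θ : ℝ} (h0 : 0 < θ) (h1 : θ < Real.pi) :
    Real.sin θ ^ (-(1 / 2) : ℝ) ≤
      2 * (θ ^ (-(1 / 2) : ℝ) + (Real.pi - θ) ^ (-(1 / 2) : ℝ)) := by
  have key : ∀ x : ℝ, 0 < x → x ≤ Real.pi / 2 →
      Real.sin x ^ (-(1 / 2) : ℝ) ≤ 2 * x ^ (-(1 / 2) : ℝ) := by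
    intro x hx0 hx1
    have hs : x / 4 ≤ Real.sin x := by
      refine le_trans ?_ (Real.mul_le_sin hx0.le hx1)
      have : 1 / 4 ≤ 2 / Real.pi := by
        rw [div_le_div_iff₀ (by norm_num) Real.pi_pos]
        linarith [Real.pi_le_four]
      nlinarith
    calc Real.sin x ^ (-(1 / 2) : ℝ) ≤ (x / 4) ^ (-(1 / 2) : ℝ) :=
          Real.rpow_le_rpow_of_nonpos (by positivity) hs (by norm_num)
      _ = 2 * x ^ (-(1 / 2) : ℝ) := by
        have h4 : (4 : ℝ) ^ (-(1 / 2) : ℝ) = 1 / 2 := by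
          rw [show (4 : ℝ) = 2 ^ (2 : ℝ) by norm_num, ← Real.rpow_mul (by norm_num)]
          norm_num
        rw [Real.div_rpow hx0.le (by norm_num), h4]
        ring
  rcases le_total θ (Real.pi / 2) with h | h
  · have := Real.rpow_nonneg (sub_pos.2 h1).le (-(1 / 2) : ℝ)
    linarith [key θ h0 h]
  · have h2 := key (Real.pi - θ) (sub_pos.2 h1) (by linarith)
    rw [Real.sin_pi_sub] at h2
    have := Real.rpow_nonneg h0.le (-(1 / 2) : ℝ)
    linarith

theorem intervalIntegrable_log_sin_pow (k : ℕ) :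
    IntervalIntegrable (fun θ => Real.log (Real.sin θ) ^ k) MeasureTheory.volume 0 Real.pi := by
  have h1 : IntervalIntegrable (fun θ : ℝ => θ ^ (-(1 / 2) : ℝ)) MeasureTheory.volume 0
      Real.pi := intervalIntegral.intervalIntegrable_rpow' (by norm_num)
  have h2 : IntervalIntegrable (fun θ : ℝ => (Real.pi - θ) ^ (-(1 / 2) : ℝ))
      MeasureTheory.volume 0 Real.pi := by
    simpa using (h1.comp_sub_left Real.pi).symm
  refine intervalIntegrable_of_abs_le Real.pi_pos.le
    ((Real.measurable_log.comp Real.measurable_sin).pow_const k)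
    (((h1.add h2).const_mul 2).const_mul ((2 * ((k : ℝ) + 1)) ^ k)) fun x hx => ?_
  rw [abs_pow]
  exact (abs_log_pow_le k (Real.sin_pos_of_mem_Ioo hx) (Real.sin_le_one x)).trans
    (mul_le_mul_of_nonneg_left (sin_rpow_neg_half_le hx.1 hx.2) (by positivity))

open MeasureTheory in
theorem memLp_two_of_intervalIntegrable_sq {f : ℝ → ℝ} (hf : Measurable f)
    (h : IntervalIntegrable (fun θ => f θ ^ 2) volume 0 Real.pi) :
    MemLp f 2 (volume.restrict (Set.Ioc 0 Real.pi)) := by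
  rw [memLp_two_iff_integrable_sq hf.aestronglyMeasurable]
  exact (intervalIntegrable_iff_integrableOn_Ioc_of_le Real.pi_pos.le).1 h

open MeasureTheory in
theorem memLp_log_sin_pow (k : ℕ) :
    MemLp (fun θ => Real.log (Real.sin θ) ^ k) 2 (volume.restrict (Set.Ioc 0 Real.pi)) := by
  refine memLp_two_of_intervalIntegrable_sq
    ((Real.measurable_log.comp Real.measurable_sin).pow_const k) ?_
  simpa only [← pow_mul] using intervalIntegrable_log_sin_pow (k * 2)

theorem tendsto_sin_mul_log_sin_pow (k : ℕ) {l : Filter ℝ} {c : ℝ} (hl : l ≤ 𝓝 c)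
    (hc : Real.sin c = 0) (hm : ∀ᶠ θ in l, θ ∈ Set.Ioo 0 Real.pi) :
    Tendsto (fun θ => Real.sin θ * Real.log (Real.sin θ) ^ k) l (𝓝 0) := by
  have h : Tendsto (fun θ => (2 * ((k : ℝ) + 1)) ^ k * Real.sin θ ^ (1 / 2 : ℝ)) l (𝓝 0) := by
    have : ContinuousAt (fun θ => (2 * ((k : ℝ) + 1)) ^ k * Real.sin θ ^ (1 / 2 : ℝ)) c :=
      ((Real.continuous_sin.continuousAt).rpow_const (Or.inr (by norm_num))).const_mul _
    have h0 := this.tendsto.mono_left hl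
    rwa [hc, Real.zero_rpow (by norm_num), mul_zero] at h0
  refine squeeze_zero_norm' ?_ h
  filter_upwards [hm] with θ hθ
  have hs := Real.sin_pos_of_mem_Ioo hθ
  rw [norm_mul, norm_pow, Real.norm_of_nonneg hs.le, Real.norm_eq_abs]
  calc Real.sin θ * |Real.log (Real.sin θ)| ^ k
      ≤ Real.sin θ * ((2 * ((k : ℝ) + 1)) ^ k * Real.sin θ ^ (-(1 / 2) : ℝ)) :=
        mul_le_mul_of_nonneg_left (abs_log_pow_le k hs (Real.sin_le_one θ)) hs.le
    _ = (2 * ((k : ℝ) + 1)) ^ k * (Real.sin θ ^ (1 : ℝ) * Real.sin θ ^ (-(1 / 2) : ℝ)) := by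
        rw [Real.rpow_one]; ring
    _ = (2 * ((k : ℝ) + 1)) ^ k * Real.sin θ ^ (1 / 2 : ℝ) := by
        rw [← Real.rpow_add hs]; norm_num

/-! ### Sine coefficients of powers of log sin. -/

/-- The recurrence of the sine coefficients of the powers of `log sin`. -/
theorem oddSinCoeff_log_sin_pow_succ (k n : ℕ) :
    (2 * (n : ℝ) + 3) * oddSinCoeff (fun θ => Real.log (Real.sin θ) ^ (k + 1)) (n + 1)
      - (2 * n + 1) * oddSinCoeff (fun θ => Real.log (Real.sin θ) ^ (k + 1)) n =
    -((k + 1) * (oddSinCoeff (fun θ => Real.log (Real.sin θ) ^ k) (n + 1)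
      + oddSinCoeff (fun θ => Real.log (Real.sin θ) ^ k) n)) := by
  have hi : ∀ j m : ℕ, IntervalIntegrable (fun θ => Real.log (Real.sin θ) ^ j *
      Real.sin ((2 * m + 1) * θ)) MeasureTheory.volume 0 Real.pi := fun j m =>
    (intervalIntegrable_log_sin_pow j).mul_continuousOn (by fun_prop)
  have hint := ((((hi (k + 1) (n + 1)).const_mul (2 * (n : ℝ) + 3)).sub
    ((hi (k + 1) n).const_mul (2 * (n : ℝ) + 1))).add
    (((hi k (n + 1)).add (hi k n)).const_mul ((k : ℝ) + 1))).const_mul (1 / 2)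
  -- The fundamental theorem of calculus is applied to sin θ · log^(k+1)(sin θ) · sin((2n+2)θ). The
  -- factor sin θ cancels the pole of cot θ, kills the boundary values, and turns frequency 2n+2
  -- into 2n+1 and 2n+3.
  have hderiv : ∀ θ ∈ Set.Ioo 0 Real.pi,
      HasDerivAt (fun θ => Real.sin θ * Real.log (Real.sin θ) ^ (k + 1) *
        Real.sin ((2 * n + 2) * θ))
      (1 / 2 * ((2 * (n : ℝ) + 3) * (Real.log (Real.sin θ) ^ (k + 1) *
          Real.sin ((2 * (n + 1 : ℕ) + 1) * θ))
        - (2 * (n : ℝ) + 1) * (Real.log (Real.sin θ) ^ (k + 1) * Real.sin ((2 * n + 1) * θ))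
        + ((k : ℝ) + 1) * (Real.log (Real.sin θ) ^ k * Real.sin ((2 * (n + 1 : ℕ) + 1) * θ)
          + Real.log (Real.sin θ) ^ k * Real.sin ((2 * n + 1) * θ)))) θ := by
    intro θ hθ
    have hs := (Real.sin_pos_of_mem_Ioo hθ).ne'
    have h1 := Real.hasDerivAt_sin θ
    have h2 := (h1.log hs).pow (k + 1)
    have h3 := ((hasDerivAt_id θ).const_mul (2 * (n : ℝ) + 2)).sin
    refine ((h1.mul h2).mul h3).congr_deriv ?_
    have e1 : Real.sin ((2 * (n + 1 : ℕ) + 1) * θ) =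
        Real.sin ((2 * n + 2) * θ) * Real.cos θ + Real.cos ((2 * n + 2) * θ) * Real.sin θ := by
      rw [← Real.sin_add]; push_cast; ring_nf
    have e2 : Real.sin ((2 * n + 1) * θ) =
        Real.sin ((2 * n + 2) * θ) * Real.cos θ - Real.cos ((2 * n + 2) * θ) * Real.sin θ := by
      rw [← Real.sin_sub]; ring_nf
    rw [e1, e2]
    simp only [id, Nat.add_sub_cancel, Pi.pow_apply, Pi.mul_apply]
    push_cast
    field_simp
    ring
  have hbd : ∀ {l : Filter ℝ} {c : ℝ}, l ≤ 𝓝 c → Real.sin c = 0 →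
      (∀ᶠ θ in l, θ ∈ Set.Ioo 0 Real.pi) →
      Tendsto (fun θ => Real.sin θ * Real.log (Real.sin θ) ^ (k + 1) *
        Real.sin ((2 * n + 2) * θ)) l (𝓝 0) := by
    intro l c hl hc hm
    refine squeeze_zero_norm (fun θ => ?_)
      (tendsto_zero_iff_norm_tendsto_zero.1 (tendsto_sin_mul_log_sin_pow (k + 1) hl hc hm))
    rw [norm_mul]
    exact mul_le_of_le_one_right (norm_nonneg _) (Real.abs_sin_le_one _)
  have hFTC := intervalIntegral.integral_eq_sub_of_hasDerivAt_of_tendsto Real.pi_pos hderiv hint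
    (hbd nhdsWithin_le_nhds Real.sin_zero (Ioo_mem_nhdsGT Real.pi_pos))
    (hbd nhdsWithin_le_nhds Real.sin_pi (Ioo_mem_nhdsLT Real.pi_pos))
  rw [intervalIntegral.integral_const_mul, intervalIntegral.integral_add
      (((hi (k + 1) (n + 1)).const_mul _).sub ((hi (k + 1) n).const_mul _))
      (((hi k (n + 1)).add (hi k n)).const_mul _),
    intervalIntegral.integral_sub ((hi (k + 1) (n + 1)).const_mul _)
      ((hi (k + 1) n).const_mul _), intervalIntegral.integral_const_mul,
    intervalIntegral.integral_const_mul, intervalIntegral.integral_const_mul,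
    intervalIntegral.integral_add (hi k (n + 1)) (hi k n)] at hFTC
  simp only [oddSinCoeff]
  linarith

theorem integral_sin_odd_mul (n : ℕ) :
    ∫ θ in (0 : ℝ)..Real.pi, Real.sin ((2 * n + 1) * θ) = 2 * oddInv n := by
  have h : (2 * (n : ℝ) + 1) ≠ 0 := by positivity
  rw [intervalIntegral.integral_comp_mul_left (fun x => Real.sin x) h, integral_sin,
    show (2 * (n : ℝ) + 1) * Real.pi = Real.pi + n * (2 * Real.pi) by ring,
    Real.cos_add_nat_mul_two_pi, mul_zero, Real.cos_zero, Real.cos_pi, oddInv, smul_eq_mul]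
  field_simp
  norm_num

theorem oddSinCoeff_log_sin_pow_zero (n : ℕ) :
    oddSinCoeff (fun θ => Real.log (Real.sin θ) ^ 0) n = 2 * oddInv n := by
  simp only [oddSinCoeff, pow_zero, one_mul, integral_sin_odd_mul]

theorem oddSinCoeff_one (n : ℕ) : oddSinCoeff (fun _ => 1) n = 2 * oddInv n := by
  simp only [oddSinCoeff, one_mul, integral_sin_odd_mul]

theorem integral_sin_mul_log_sin :
    ∫ θ in (0 : ℝ)..Real.pi, Real.log (Real.sin θ) * Real.sin θ = 2 * Real.log 2 - 2 := by
  have hint : IntervalIntegrable (fun θ => Real.log (Real.sin θ) * Real.sin θ)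
      MeasureTheory.volume 0 Real.pi := by
    have := (intervalIntegrable_log_sin_pow 1).mul_continuousOn
      (g := fun θ => Real.sin θ) (by fun_prop)
    simpa only [pow_one] using this
  -- This is -cos θ log sin θ + cos θ + log tan(θ/2) rewritten in half angles, so that the
  -- logarithms occur only as x log x and the antiderivative is continuous at 0 and π.
  set f : ℝ → ℝ := fun θ =>
    2 * (Real.sin (θ / 2) * (Real.sin (θ / 2) * Real.log (Real.sin (θ / 2))))
    - 2 * (Real.cos (θ / 2) * (Real.cos (θ / 2) * Real.log (Real.cos (θ / 2))))
    + Real.cos θ * (1 - Real.log 2) with hf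
  have hcont : Continuous f := by
    have h1 : Continuous fun θ : ℝ => Real.sin (θ / 2) * Real.log (Real.sin (θ / 2)) :=
      Real.continuous_mul_log.comp (by fun_prop : Continuous fun θ : ℝ => Real.sin (θ / 2))
    have h2 : Continuous fun θ : ℝ => Real.cos (θ / 2) * Real.log (Real.cos (θ / 2)) :=
      Real.continuous_mul_log.comp (by fun_prop : Continuous fun θ : ℝ => Real.cos (θ / 2))
    have h3 : Continuous fun θ : ℝ => Real.sin (θ / 2) := by fun_prop
    have h4 : Continuous fun θ : ℝ => Real.cos (θ / 2) := by fun_prop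
    exact (((h3.mul h1).const_mul 2).sub ((h4.mul h2).const_mul 2)).add
      (Real.continuous_cos.mul_const _)
  have hderiv : ∀ θ ∈ Set.Ioo 0 Real.pi,
      HasDerivAt f (Real.log (Real.sin θ) * Real.sin θ) θ := by
    intro θ hθ
    have hs : 0 < Real.sin (θ / 2) :=
      Real.sin_pos_of_mem_Ioo ⟨by linarith [hθ.1], by linarith [hθ.1, hθ.2]⟩
    have hc : 0 < Real.cos (θ / 2) :=
      Real.cos_pos_of_mem_Ioo ⟨by linarith [hθ.1, Real.pi_pos], by linarith [hθ.1, hθ.2]⟩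
    have d1 : HasDerivAt (fun θ : ℝ => Real.sin (θ / 2)) (Real.cos (θ / 2) * (1 / 2)) θ :=
      ((hasDerivAt_id θ).div_const 2).sin
    have d2 : HasDerivAt (fun θ : ℝ => Real.cos (θ / 2)) (-Real.sin (θ / 2) * (1 / 2)) θ :=
      ((hasDerivAt_id θ).div_const 2).cos
    have d := (((d1.mul (d1.mul (d1.log hs.ne'))).const_mul 2).sub
      ((d2.mul (d2.mul (d2.log hc.ne'))).const_mul 2)).add
      ((Real.hasDerivAt_cos θ).mul_const (1 - Real.log 2))
    refine d.congr_deriv ?_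
    have e : Real.sin θ = 2 * Real.sin (θ / 2) * Real.cos (θ / 2) := by
      rw [← Real.sin_two_mul]; ring_nf
    rw [e, Real.log_mul (mul_pos two_pos hs).ne' hc.ne', Real.log_mul two_ne_zero hs.ne']
    simp only [Pi.mul_apply]
    field_simp
    ring
  rw [intervalIntegral.integral_eq_sub_of_hasDerivAt_of_tendsto Real.pi_pos hderiv hint
    (hcont.continuousAt.tendsto.mono_left nhdsWithin_le_nhds)
    (hcont.continuousAt.tendsto.mono_left nhdsWithin_le_nhds)]
  simp [hf]
  ring

theorem oddSinCoeff_log_sin_pow_one (n : ℕ) :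
    oddSinCoeff (fun θ => Real.log (Real.sin θ) ^ 1) n =
      2 * oddInv n * (Real.log 2 - oddHarmonicMid n) := by
  induction n with
  | zero =>
    simp only [oddSinCoeff, pow_one, Nat.cast_zero, mul_zero, zero_add, one_mul,
      integral_sin_mul_log_sin, oddInv_zero, oddHarmonicMid_zero]
    ring
  | succ n ih =>
    have h := oddSinCoeff_log_sin_pow_succ 0 n
    rw [oddSinCoeff_log_sin_pow_zero, oddSinCoeff_log_sin_pow_zero, zero_add, ih] at h
    have h3 : (2 * (n : ℝ) + 3) ≠ 0 := by positivity
    rw [← mul_right_inj' h3, oddHarmonicMid_succ]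
    rw [sub_eq_iff_eq_add] at h
    rw [h]
    simp only [oddInv]
    push_cast
    field_simp
    ring

/-- The recurrence determines the coefficients up to the value at n = 0, which is left as an unknown
constant; Parseval fixes it later, in `oddSinCoeff_log_sin_pow_two`. -/
theorem exists_oddSinCoeff_log_sin_pow_two : ∃ κ : ℝ, ∀ n,
    oddSinCoeff (fun θ => Real.log (Real.sin θ) ^ 2) n =
      2 * oddInv n * (oddHarmonicMid n ^ 2 + oddInv n ^ 2 - 2 * Real.log 2 * oddHarmonicMid n
        + κ) := by
  refine ⟨oddSinCoeff (fun θ => Real.log (Real.sin θ) ^ 2) 0 / 2 - 2 + 2 * Real.log 2,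
    fun n => ?_⟩
  induction n with
  | zero =>
    rw [oddInv_zero, oddHarmonicMid_zero]; ring
  | succ n ih =>
    have h := oddSinCoeff_log_sin_pow_succ 1 n
    rw [oddSinCoeff_log_sin_pow_one, oddSinCoeff_log_sin_pow_one] at h
    rw [show (1 : ℕ) + 1 = 2 from rfl, ih, sub_eq_iff_eq_add] at h
    have h3 : (2 * (n : ℝ) + 3) ≠ 0 := by positivity
    rw [← mul_right_inj' h3, h, oddHarmonicMid_succ]
    generalize oddSinCoeff (fun θ => Real.log (Real.sin θ) ^ 2) 0 = c
    simp only [oddInv]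
    push_cast
    field_simp
    ring

theorem log_sin_pow_pi_sub (k : ℕ) (θ : ℝ) :
    Real.log (Real.sin (Real.pi - θ)) ^ k = Real.log (Real.sin θ) ^ k := by
  rw [Real.sin_pi_sub]

/-- Parseval for the constant function 1. -/
theorem hasSum_oddInv_sq : HasSum (fun n => oddInv n ^ 2) (Real.pi ^ 2 / 8) := by
  have h := hasSum_oddSinCoeff_mul (memLp_log_sin_pow 0) (memLp_log_sin_pow 0)
    (log_sin_pow_pi_sub 0)
  simp only [pow_zero, oddSinCoeff_one, mul_one, intervalIntegral.integral_const,
    sub_zero, smul_eq_mul] at h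
  exact (h.mul_left (1 / 4)).of_eq (fun n => by ring) (by ring)

/-! ### The triangle function and classical zeta sums. -/

/-- The triangle function with peak at `π / 2`. -/
noncomputable def tent (θ : ℝ) : ℝ := min θ (Real.pi - θ)

theorem tent_pi_sub (θ : ℝ) : tent (Real.pi - θ) = tent θ := by
  rw [tent, tent, sub_sub_cancel, min_comm]

theorem continuous_tent : Continuous tent := by unfold tent; fun_prop

open MeasureTheory in
theorem memLp_of_continuous {f : ℝ → ℝ} (hf : Continuous f) :
    MemLp f 2 (volume.restrict (Set.Ioc 0 Real.pi)) :=
  memLp_two_of_intervalIntegrable_sq hf.measurable (by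
    have : Continuous fun θ => f θ ^ 2 := by fun_prop
    exact this.intervalIntegrable _ _)

theorem integral_zero_pi_eq_two_mul {f : ℝ → ℝ}
    (hi : IntervalIntegrable f MeasureTheory.volume 0 Real.pi)
    (hf : ∀ θ, f (Real.pi - θ) = f θ) :
    ∫ θ in (0 : ℝ)..Real.pi, f θ = 2 * ∫ θ in (0 : ℝ)..(Real.pi / 2), f θ := by
  have hpi := Real.pi_pos
  have hsub1 : Set.uIcc 0 (Real.pi / 2) ⊆ Set.uIcc 0 Real.pi := by
    rw [Set.uIcc_of_le (by linarith), Set.uIcc_of_le hpi.le]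
    exact Set.Icc_subset_Icc le_rfl (by linarith)
  have hsub2 : Set.uIcc (Real.pi / 2) Real.pi ⊆ Set.uIcc 0 Real.pi := by
    rw [Set.uIcc_of_le (by linarith), Set.uIcc_of_le hpi.le]
    exact Set.Icc_subset_Icc (by linarith) le_rfl
  have h := intervalIntegral.integral_comp_sub_left (a := Real.pi / 2) (b := Real.pi) f Real.pi
  rw [sub_self, show Real.pi - Real.pi / 2 = Real.pi / 2 by ring] at h
  simp only [hf] at h
  rw [← intervalIntegral.integral_add_adjacent_intervals (hi.mono_set hsub1)
    (hi.mono_set hsub2), h]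
  ring

theorem integral_id_mul_sin {c : ℝ} (hc : c ≠ 0) (b : ℝ) :
    ∫ θ in (0 : ℝ)..b, θ * Real.sin (c * θ) =
      Real.sin (c * b) / c ^ 2 - b * Real.cos (c * b) / c := by
  have hderiv : ∀ θ ∈ Set.uIcc 0 b, HasDerivAt
      (fun θ => Real.sin (c * θ) / c ^ 2 - θ * Real.cos (c * θ) / c) (θ * Real.sin (c * θ)) θ := by
    intro θ _
    have h1 := ((hasDerivAt_id θ).const_mul c)
    refine ((h1.sin.div_const (c ^ 2)).sub
      (((hasDerivAt_id θ).mul h1.cos).div_const c)).congr_deriv ?_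
    simp only [id]
    field_simp
    ring
  rw [intervalIntegral.integral_eq_sub_of_hasDerivAt hderiv
    ((by fun_prop : Continuous fun θ : ℝ => θ * Real.sin (c * θ)).intervalIntegrable _ _)]
  simp

theorem integral_id_mul_cos {c : ℝ} (hc : c ≠ 0) (b : ℝ) :
    ∫ θ in (0 : ℝ)..b, θ * Real.cos (c * θ) =
      (Real.cos (c * b) - 1) / c ^ 2 + b * Real.sin (c * b) / c := by
  have hderiv : ∀ θ ∈ Set.uIcc 0 b, HasDerivAt
      (fun θ => Real.cos (c * θ) / c ^ 2 + θ * Real.sin (c * θ) / c) (θ * Real.cos (c * θ)) θ := by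
    intro θ _
    have h1 := ((hasDerivAt_id θ).const_mul c)
    refine ((h1.cos.div_const (c ^ 2)).add
      (((hasDerivAt_id θ).mul h1.sin).div_const c)).congr_deriv ?_
    simp only [id]
    field_simp
    ring
  rw [intervalIntegral.integral_eq_sub_of_hasDerivAt hderiv
    ((by fun_prop : Continuous fun θ : ℝ => θ * Real.cos (c * θ)).intervalIntegrable _ _)]
  simp
  ring

theorem tent_of_mem {θ : ℝ} (h : θ ∈ Set.uIcc 0 (Real.pi / 2)) : tent θ = θ := by
  rw [Set.uIcc_of_le (by positivity)] at h
  exact min_eq_left (by linarith [h.2])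

theorem sin_odd_mul_pi_div_two (n : ℕ) :
    Real.sin ((2 * n + 1) * (Real.pi / 2)) = (-1) ^ n := by
  rw [show (2 * (n : ℝ) + 1) * (Real.pi / 2) = n * Real.pi + Real.pi / 2 by ring,
    Real.sin_add_pi_div_two, Real.cos_nat_mul_pi]

theorem cos_odd_mul_pi_div_two (n : ℕ) :
    Real.cos ((2 * n + 1) * (Real.pi / 2)) = 0 := by
  rw [show (2 * (n : ℝ) + 1) * (Real.pi / 2) = n * Real.pi + Real.pi / 2 by ring,
    Real.cos_add_pi_div_two, Real.sin_nat_mul_pi, neg_zero]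

theorem integral_tent_mul {g : ℝ → ℝ} (hg : Continuous g) (hs : ∀ θ, g (Real.pi - θ) = g θ) :
    ∫ θ in (0 : ℝ)..Real.pi, tent θ * g θ = 2 * ∫ θ in (0 : ℝ)..(Real.pi / 2), θ * g θ := by
  rw [integral_zero_pi_eq_two_mul (f := fun θ => tent θ * g θ)
    ((continuous_tent.mul hg).intervalIntegrable _ _)
    (fun θ => by rw [tent_pi_sub, hs])]
  congr 1
  exact intervalIntegral.integral_congr fun θ hθ => by simp only [tent_of_mem hθ]

theorem oddSinCoeff_tent (n : ℕ) : oddSinCoeff tent n = 2 * (-1) ^ n * oddInv n ^ 2 := by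
  have hc : (2 * (n : ℝ) + 1) ≠ 0 := by positivity
  rw [oddSinCoeff, integral_tent_mul (by fun_prop) (sin_odd_mul_pi_sub n),
    integral_id_mul_sin hc, sin_odd_mul_pi_div_two, cos_odd_mul_pi_div_two, oddInv]
  field_simp
  ring

theorem cos_even_mul_pi_sub (n : ℕ) (θ : ℝ) :
    Real.cos (2 * n * (Real.pi - θ)) = Real.cos (2 * n * θ) := by
  rw [show 2 * (n : ℝ) * (Real.pi - θ) = -(2 * n * θ) + n * (2 * Real.pi)
    by ring, Real.cos_add_nat_mul_two_pi, Real.cos_neg]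

theorem evenCosCoeff_tent_zero : evenCosCoeff tent 0 = Real.pi ^ 2 / 4 := by
  rw [evenCosCoeff, integral_tent_mul (by fun_prop) (cos_even_mul_pi_sub 0)]
  simp
  ring

theorem evenCosCoeff_tent_succ (n : ℕ) :
    evenCosCoeff tent (n + 1) = ((-1) ^ (n + 1) - 1) / (2 * (n + 1) ^ 2) := by
  have hc : 2 * ((n + 1 : ℕ) : ℝ) ≠ 0 := by positivity
  rw [evenCosCoeff, integral_tent_mul (by fun_prop) (cos_even_mul_pi_sub (n + 1)),
    integral_id_mul_cos hc,
    show 2 * ((n + 1 : ℕ) : ℝ) * (Real.pi / 2) = (n + 1 : ℕ) * Real.pi by ring,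
    Real.cos_nat_mul_pi, Real.sin_nat_mul_pi]
  push_cast
  field_simp
  ring

theorem hasSum_one_div_succ_pow {k : ℕ} (hk : k ≠ 0) {Z : ℝ}
    (h : HasSum (fun n : ℕ => 1 / (n : ℝ) ^ k) Z) :
    HasSum (fun n : ℕ => 1 / ((n : ℝ) + 1) ^ k) Z := by
  have h1 := (hasSum_nat_add_iff' 1).2 h
  -- The dropped term is 1 / 0 ^ k, which is zero since k ≠ 0.
  exact h1.of_eq (fun n => by push_cast; rfl) (by simp [hk])

theorem hasSum_oddInv_pow {k : ℕ} {Z : ℝ}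
    (h : HasSum (fun n : ℕ => 1 / (n : ℝ) ^ k) Z) :
    HasSum (fun n => oddInv n ^ k) ((1 - 1 / 2 ^ k) * Z) := by
  have he : HasSum (fun n : ℕ => 1 / ((2 * n : ℕ) : ℝ) ^ k) (1 / 2 ^ k * Z) :=
    (h.mul_left (1 / 2 ^ k)).of_eq (fun n => by push_cast; rw [mul_pow]; field_simp) rfl
  have hs : Summable (fun n : ℕ => 1 / ((2 * n + 1 : ℕ) : ℝ) ^ k) :=
    h.summable.comp_injective (i := fun n => 2 * n + 1) fun a b hab => by simpa using hab
  have ho := hs.hasSum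
  have h2 := (HasSum.even_add_odd (f := fun n : ℕ => 1 / (n : ℝ) ^ k) he ho).unique h
  refine ho.of_eq (fun n => ?_) (by linarith)
  rw [oddInv, div_pow, one_pow]; push_cast; rfl

theorem hasSum_alternating_pow {k : ℕ} (hk : k ≠ 0) {Z : ℝ}
    (h : HasSum (fun n : ℕ => 1 / (n : ℝ) ^ k) Z) :
    HasSum (fun n : ℕ => (-1) ^ n / ((n : ℝ) + 1) ^ k) ((1 - 2 / 2 ^ k) * Z) := by
  have h0 : HasSum (fun n : ℕ => -((-1) ^ n / (n : ℝ) ^ k)) ((1 - 2 / 2 ^ k) * Z) := by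
    have he : HasSum (fun n : ℕ => -((-1) ^ (2 * n) / ((2 * n : ℕ) : ℝ) ^ k)) (-(1 / 2 ^ k * Z)) :=
      (h.mul_left (1 / 2 ^ k)).neg.of_eq
        (fun n => by rw [pow_mul]; push_cast; rw [mul_pow]; norm_num; field_simp) rfl
    have ho : HasSum (fun n : ℕ => -((-1) ^ (2 * n + 1) / ((2 * n + 1 : ℕ) : ℝ) ^ k))
        ((1 - 1 / 2 ^ k) * Z) :=
      (hasSum_oddInv_pow h).of_eq
        (fun n => by rw [pow_succ, pow_mul, oddInv, div_pow, one_pow]; push_cast; norm_num;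
                     field_simp) rfl
    have := HasSum.even_add_odd (f := fun n : ℕ => -((-1 : ℝ) ^ n / (n : ℝ) ^ k)) he ho
    exact this.of_eq (fun n => rfl) (by ring)
  have h1 := (hasSum_nat_add_iff' 1).2 h0
  exact h1.of_eq (fun n => by push_cast; rw [pow_succ]; ring) (by simp [hk])

theorem hasSum_zeta_three : HasSum (fun n : ℕ => 1 / (n : ℝ) ^ 3) (riemannZeta 3).re := by
  have hs : Summable (fun n : ℕ => 1 / (n : ℝ) ^ 3) := Real.summable_one_div_nat_pow.2 (by norm_num)
  have h := zeta_nat_eq_tsum_of_gt_one (k := 3) (by norm_num)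
  have h2 : riemannZeta 3 = ((∑' n : ℕ, 1 / (n : ℝ) ^ 3 : ℝ) : ℂ) := by
    rw [Complex.ofReal_tsum]
    refine Eq.trans (by exact_mod_cast h) (tsum_congr fun n => by push_cast; rfl)
  rw [h2, Complex.ofReal_re]
  exact hs.hasSum

theorem hasSum_oddInv_pow_three :
    HasSum (fun n => oddInv n ^ 3) (7 / 8 * (riemannZeta 3).re) :=
  (hasSum_oddInv_pow hasSum_zeta_three).of_eq (fun _ => rfl) (by norm_num)

theorem hasSum_oddInv_pow_four : HasSum (fun n => oddInv n ^ 4) (Real.pi ^ 4 / 96) :=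
  (hasSum_oddInv_pow hasSum_zeta_four).of_eq (fun _ => rfl) (by ring)

/-! ### Cosine coefficients of log sin and the integrals they give. -/

theorem integral_cos_even_mul (n : ℕ) :
    ∫ θ in (0 : ℝ)..Real.pi, Real.cos (2 * (n + 1 : ℕ) * θ) = 0 := by
  have h : 2 * ((n + 1 : ℕ) : ℝ) ≠ 0 := by positivity
  rw [intervalIntegral.integral_comp_mul_left (fun x => Real.cos x) h, integral_cos,
    show 2 * ((n + 1 : ℕ) : ℝ) * Real.pi = (2 * (n + 1) : ℕ) * Real.pi by push_cast; ring,
    Real.sin_nat_mul_pi]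
  simp

/-- Integrates the derivative of sin θ · log sin θ · cos((2n+1)θ), whose boundary values vanish. The
integral on the right is nonzero only for n = 0, which makes n times the n-th coefficient constant
from n = 1 on. -/
theorem evenCosCoeff_log_sin_succ_sub (n : ℕ) :
    ((n : ℝ) + 1) * evenCosCoeff (fun θ => Real.log (Real.sin θ) ^ 1) (n + 1)
      - n * evenCosCoeff (fun θ => Real.log (Real.sin θ) ^ 1) n =
    -(1 / 2 * ∫ θ in (0 : ℝ)..Real.pi, Real.cos (2 * n * θ)) := by
  have hi : ∀ m : ℕ, IntervalIntegrable (fun θ => Real.log (Real.sin θ) ^ 1 *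
      Real.cos (2 * m * θ)) MeasureTheory.volume 0 Real.pi := fun m =>
    (intervalIntegrable_log_sin_pow 1).mul_continuousOn (by fun_prop)
  have hc : ∀ m : ℕ, IntervalIntegrable (fun θ => Real.cos (2 * m * θ)) MeasureTheory.volume 0
      Real.pi := fun m => Continuous.intervalIntegrable (by fun_prop) _ _
  have hint := (((hi (n + 1)).const_mul ((n : ℝ) + 1)).sub ((hi n).const_mul (n : ℝ))).add
    (((hc (n + 1)).add (hc n)).const_mul (1 / 2))
  have hderiv : ∀ θ ∈ Set.Ioo 0 Real.pi,
      HasDerivAt (fun θ => Real.sin θ * Real.log (Real.sin θ) ^ 1 *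
        Real.cos ((2 * n + 1) * θ))
      (((n : ℝ) + 1) * (Real.log (Real.sin θ) ^ 1 * Real.cos (2 * (n + 1 : ℕ) * θ))
        - n * (Real.log (Real.sin θ) ^ 1 * Real.cos (2 * n * θ))
        + 1 / 2 * (Real.cos (2 * (n + 1 : ℕ) * θ) + Real.cos (2 * n * θ))) θ := by
    intro θ hθ
    have hs := (Real.sin_pos_of_mem_Ioo hθ).ne'
    have h1 := Real.hasDerivAt_sin θ
    have h2 := (h1.log hs).pow 1
    have h3 := ((hasDerivAt_id θ).const_mul (2 * (n : ℝ) + 1)).cos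
    refine ((h1.mul h2).mul h3).congr_deriv ?_
    have e1 : Real.cos (2 * (n + 1 : ℕ) * θ) =
        Real.cos ((2 * n + 1) * θ) * Real.cos θ - Real.sin ((2 * n + 1) * θ) * Real.sin θ := by
      rw [← Real.cos_add]; push_cast; ring_nf
    have e2 : Real.cos (2 * n * θ) =
        Real.cos ((2 * n + 1) * θ) * Real.cos θ + Real.sin ((2 * n + 1) * θ) * Real.sin θ := by
      rw [← Real.cos_sub]; ring_nf
    rw [e1, e2]
    simp only [id, Pi.mul_apply, Pi.pow_apply]
    push_cast
    field_simp
    ring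
  have hbd : ∀ {l : Filter ℝ} {c : ℝ}, l ≤ 𝓝 c → Real.sin c = 0 →
      (∀ᶠ θ in l, θ ∈ Set.Ioo 0 Real.pi) →
      Tendsto (fun θ => Real.sin θ * Real.log (Real.sin θ) ^ 1 *
        Real.cos ((2 * n + 1) * θ)) l (𝓝 0) := by
    intro l c hl hc hm
    refine squeeze_zero_norm (fun θ => ?_)
      (tendsto_zero_iff_norm_tendsto_zero.1 (tendsto_sin_mul_log_sin_pow 1 hl hc hm))
    rw [norm_mul]
    exact mul_le_of_le_one_right (norm_nonneg _) (Real.abs_cos_le_one _)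
  have hFTC := intervalIntegral.integral_eq_sub_of_hasDerivAt_of_tendsto Real.pi_pos hderiv hint
    (hbd nhdsWithin_le_nhds Real.sin_zero (Ioo_mem_nhdsGT Real.pi_pos))
    (hbd nhdsWithin_le_nhds Real.sin_pi (Ioo_mem_nhdsLT Real.pi_pos))
  rw [intervalIntegral.integral_add
      (((hi (n + 1)).const_mul _).sub ((hi n).const_mul _))
      (((hc (n + 1)).add (hc n)).const_mul _),
    intervalIntegral.integral_sub ((hi (n + 1)).const_mul _)
      ((hi n).const_mul _), intervalIntegral.integral_const_mul,
    intervalIntegral.integral_const_mul, intervalIntegral.integral_const_mul,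
    intervalIntegral.integral_add (hc (n + 1)) (hc n), integral_cos_even_mul] at hFTC
  simp only [evenCosCoeff]
  linarith

theorem evenCosCoeff_log_sin_succ (n : ℕ) :
    evenCosCoeff (fun θ => Real.log (Real.sin θ) ^ 1) (n + 1) = -(Real.pi / (2 * (n + 1))) := by
  have h : ((n : ℝ) + 1) * evenCosCoeff (fun θ => Real.log (Real.sin θ) ^ 1) (n + 1) =
      -(Real.pi / 2) := by
    induction n with
    | zero =>
      have h := evenCosCoeff_log_sin_succ_sub 0
      simp only [Nat.cast_zero, mul_zero, zero_mul, Real.cos_zero, sub_zero,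
        intervalIntegral.integral_const, smul_eq_mul] at h
      simp only [Nat.cast_zero, h]
      ring
    | succ n ih =>
      have h := evenCosCoeff_log_sin_succ_sub (n + 1)
      rw [integral_cos_even_mul] at h
      push_cast at h ih ⊢
      linarith
  have h1 : (n : ℝ) + 1 ≠ 0 := by positivity
  rw [← mul_right_inj' h1, h]
  field_simp

theorem evenCosCoeff_log_sin_zero :
    evenCosCoeff (fun θ => Real.log (Real.sin θ) ^ 1) 0 = -(Real.pi * Real.log 2) := by
  simp [evenCosCoeff, integral_log_sin_zero_pi]
  ring

/-- Parseval for log sin with itself in even cosines: the n-th coefficient is -π/(2n), so the sum is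
a multiple of ζ(2). -/
theorem integral_log_sin_sq :
    ∫ θ in (0 : ℝ)..Real.pi, Real.log (Real.sin θ) ^ 2 =
      Real.pi * Real.log 2 ^ 2 + Real.pi ^ 3 / 12 := by
  have h := hasSum_evenCosCoeff_mul (memLp_log_sin_pow 1) (memLp_log_sin_pow 1)
    (log_sin_pow_pi_sub 1)
  simp only [evenCosCoeff_log_sin_succ, evenCosCoeff_log_sin_zero] at h
  have h2 := ((hasSum_one_div_succ_pow (by norm_num) hasSum_zeta_two).mul_left
    (Real.pi ^ 2 / 4)).of_eq (g := fun n : ℕ =>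
      -(Real.pi / (2 * ((n : ℝ) + 1))) * -(Real.pi / (2 * (n + 1))))
    (fun n => by field_simp; norm_num) rfl
  have h3 := h.unique h2
  have e : ∀ θ, Real.log (Real.sin θ) ^ 1 * Real.log (Real.sin θ) ^ 1
    = Real.log (Real.sin θ) ^ 2 := fun θ => by ring
  simp only [e] at h3
  have hpi := Real.pi_ne_zero
  rw [← mul_right_inj' (div_ne_zero hpi two_ne_zero)]
  linarith

theorem integral_log_sin_mul_tent :
    ∫ θ in (0 : ℝ)..Real.pi, Real.log (Real.sin θ) ^ 1 * tent θ =
      7 / 8 * (riemannZeta 3).re - Real.pi ^ 2 / 4 * Real.log 2 := by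
  have h := hasSum_evenCosCoeff_mul (memLp_log_sin_pow 1) (memLp_of_continuous continuous_tent)
    (log_sin_pow_pi_sub 1)
  simp only [evenCosCoeff_log_sin_succ, evenCosCoeff_log_sin_zero, evenCosCoeff_tent_succ,
    evenCosCoeff_tent_zero] at h
  have h2 := (((hasSum_one_div_succ_pow (by norm_num) hasSum_zeta_three).add
    (hasSum_alternating_pow (by norm_num) hasSum_zeta_three)).mul_left
    (Real.pi / 4)).of_eq (g := fun n : ℕ =>
      -(Real.pi / (2 * ((n : ℝ) + 1))) * (((-1) ^ (n + 1) - 1) / (2 * ((n : ℝ) + 1) ^ 2)))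
    (fun n => by rw [pow_succ]; field_simp; ring) rfl
  have h3 := h.unique h2
  have hpi := Real.pi_ne_zero
  rw [← mul_right_inj' (div_ne_zero hpi two_ne_zero)]
  linarith

/-! ### Quadratic sums from Parseval in odd sines. -/

theorem hasSum_oddInv_sq_mul_sub_sq :
    HasSum (fun n => oddInv n ^ 2 * (Real.log 2 - oddHarmonicMid n) ^ 2)
      (Real.pi / 8 * (Real.pi * Real.log 2 ^ 2 + Real.pi ^ 3 / 12)) := by
  have h := hasSum_oddSinCoeff_mul (memLp_log_sin_pow 1) (memLp_log_sin_pow 1)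
    (log_sin_pow_pi_sub 1)
  have e : ∀ θ, Real.log (Real.sin θ) ^ 1 * Real.log (Real.sin θ) ^ 1
    = Real.log (Real.sin θ) ^ 2 := fun θ => by ring
  simp only [e, integral_log_sin_sq, oddSinCoeff_log_sin_pow_one] at h
  exact (h.mul_left (1 / 4)).of_eq (fun n => by ring) (by ring)

theorem hasSum_oddInv_sq_mul_sub :
    HasSum (fun n => oddInv n ^ 2 * (Real.log 2 - oddHarmonicMid n))
      (-(Real.pi ^ 2 / 8 * Real.log 2)) := by
  have h := hasSum_oddSinCoeff_mul (memLp_log_sin_pow 1) (memLp_log_sin_pow 0)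
    (log_sin_pow_pi_sub 1)
  simp only [oddSinCoeff_log_sin_pow_one, pow_zero, mul_one, oddSinCoeff_one] at h
  simp only [pow_one, integral_log_sin_zero_pi] at h
  exact (h.mul_left (1 / 4)).of_eq (fun n => by ring) (by ring)

theorem hasSum_oddInv_sq_mul_oddHarmonicMid_sq :
    HasSum (fun n => oddInv n ^ 2 * oddHarmonicMid n ^ 2)
      (Real.pi ^ 2 / 2 * Real.log 2 ^ 2 + Real.pi ^ 4 / 96) :=
  ((hasSum_oddInv_sq_mul_sub_sq.sub (hasSum_oddInv_sq_mul_sub.mul_left (2 * Real.log 2))).add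
    (hasSum_oddInv_sq.mul_left (Real.log 2 ^ 2))).of_eq (fun n => by ring) (by ring)

theorem hasSum_alternating_oddInv_pow_three :
    HasSum (fun n : ℕ => (-1) ^ n * oddInv n ^ 3) (Real.pi ^ 3 / 32) := by
  have h := hasSum_oddSinCoeff_mul (memLp_log_sin_pow 0) (memLp_of_continuous continuous_tent)
    (log_sin_pow_pi_sub 0)
  have h0 := evenCosCoeff_tent_zero
  simp only [evenCosCoeff, Nat.cast_zero, mul_zero, zero_mul, Real.cos_zero, mul_one] at h0
  simp only [pow_zero, oddSinCoeff_one, oddSinCoeff_tent, one_mul, h0] at h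
  exact (h.mul_left (1 / 4)).of_eq (fun n => by ring) (by ring)

/-- The value of `∑ (-1)^n (𝓗_n + 𝓗_{n-1}) / (2n+1)^3`. -/
theorem hasSum_alternating_oddInv_pow_three_mul_oddHarmonicMid :
    HasSum (fun n : ℕ => (-1) ^ n * (oddInv n ^ 3 * oddHarmonicMid n))
      (Real.pi ^ 3 / 16 * Real.log 2 - 7 * Real.pi / 64 * (riemannZeta 3).re) := by
  have h := hasSum_oddSinCoeff_mul (memLp_log_sin_pow 1) (memLp_of_continuous continuous_tent)
    (log_sin_pow_pi_sub 1)
  simp only [oddSinCoeff_log_sin_pow_one, oddSinCoeff_tent, integral_log_sin_mul_tent] at h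
  exact ((hasSum_alternating_oddInv_pow_three.mul_left (Real.log 2)).sub
    (h.mul_left (1 / 4))).of_eq (fun n => by ring) (by ring)

theorem oddSinCoeff_log_sin_pow_two (n : ℕ) :
    oddSinCoeff (fun θ => Real.log (Real.sin θ) ^ 2) n =
      2 * oddInv n * (oddHarmonicMid n ^ 2 + oddInv n ^ 2 - 2 * Real.log 2 * oddHarmonicMid n
        + (Real.log 2 ^ 2 - Real.pi ^ 2 / 12)) := by
  obtain ⟨κ, hκ⟩ := exists_oddSinCoeff_log_sin_pow_two
  have h := hasSum_oddSinCoeff_mul (memLp_log_sin_pow 2) (memLp_log_sin_pow 0)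
    (log_sin_pow_pi_sub 2)
  simp only [hκ, pow_zero, mul_one, oddSinCoeff_one, integral_log_sin_sq] at h
  -- Parseval of log² sin against 1 gives a linear equation for κ, since the integral of log² sin is
  -- already known.
  have h2 := (((hasSum_oddInv_sq_mul_sub_sq.add hasSum_oddInv_pow_four).add
    (hasSum_oddInv_sq.mul_left (κ - Real.log 2 ^ 2))).mul_left 4).unique
    (h.of_eq (fun n => by ring) rfl)
  have hpi := Real.pi_ne_zero
  have : κ = Real.log 2 ^ 2 - Real.pi ^ 2 / 12 := by
    have h3 : Real.pi ^ 2 * κ = Real.pi ^ 2 * (Real.log 2 ^ 2 - Real.pi ^ 2 / 12) := by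
      linarith
    exact mul_left_cancel₀ (pow_ne_zero 2 hpi) h3
  rw [hκ, this]

/-! ### Moments of powers of the logarithm. -/

theorem tendsto_mul_log_pow (k : ℕ) :
    Tendsto (fun x : ℝ => x * Real.log x ^ k) (𝓝[>] 0) (𝓝 0) := by
  have h : Tendsto (fun x : ℝ => (2 * ((k : ℝ) + 1)) ^ k * x ^ (1 / 2 : ℝ)) (𝓝[>] 0) (𝓝 0) := by
    have : ContinuousAt (fun x : ℝ => (2 * ((k : ℝ) + 1)) ^ k * x ^ (1 / 2 : ℝ)) 0 :=
      (continuousAt_id.rpow_const (Or.inr (by norm_num))).const_mul _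
    have h0 := this.tendsto.mono_left (nhdsWithin_le_nhds (s := Set.Ioi 0))
    rwa [Real.zero_rpow (by norm_num), mul_zero] at h0
  refine squeeze_zero_norm' ?_ h
  filter_upwards [Ioo_mem_nhdsGT (zero_lt_one' ℝ)] with x hx
  rw [norm_mul, norm_pow, Real.norm_of_nonneg hx.1.le, Real.norm_eq_abs]
  calc x * |Real.log x| ^ k
      ≤ x * ((2 * ((k : ℝ) + 1)) ^ k * x ^ (-(1 / 2) : ℝ)) :=
        mul_le_mul_of_nonneg_left (abs_log_pow_le k hx.1 hx.2.le) hx.1.le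
    _ = (2 * ((k : ℝ) + 1)) ^ k * (x ^ (1 : ℝ) * x ^ (-(1 / 2) : ℝ)) := by
        rw [Real.rpow_one]; ring
    _ = (2 * ((k : ℝ) + 1)) ^ k * x ^ (1 / 2 : ℝ) := by
        rw [← Real.rpow_add hx.1]; norm_num

theorem intervalIntegrable_log_pow_mul_pow (k n : ℕ) :
    IntervalIntegrable (fun x => Real.log x ^ k * x ^ n) MeasureTheory.volume 0 1 :=
  (intervalIntegrable_log_pow k zero_le_one le_rfl).mul_continuousOn (by fun_prop)

theorem integral_log_pow_mul_pow (k n : ℕ) :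
    ∫ x in (0 : ℝ)..1, Real.log x ^ k * x ^ n =
      (-1) ^ k * (k.factorial : ℝ) / ((n : ℝ) + 1) ^ (k + 1) := by
  induction k with
  | zero => simp
  | succ k ih =>
    have hint := ((intervalIntegrable_log_pow_mul_pow (k + 1) n).const_mul ((n : ℝ) + 1)).add
      ((intervalIntegrable_log_pow_mul_pow k n).const_mul ((k : ℝ) + 1))
    have hderiv : ∀ x ∈ Set.Ioo (0 : ℝ) 1,
        HasDerivAt (fun x => x ^ n * (x * Real.log x ^ (k + 1)))
          (((n : ℝ) + 1) * (Real.log x ^ (k + 1) * x ^ n)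
            + ((k : ℝ) + 1) * (Real.log x ^ k * x ^ n)) x := by
      intro x hx
      have h1 := (hasDerivAt_pow (n + 1) x).mul ((Real.hasDerivAt_log hx.1.ne').pow (k + 1))
      have h2 := h1.congr_of_eventuallyEq
        (f₁ := fun x => x ^ n * (x * Real.log x ^ (k + 1)))
        (Eventually.of_forall fun y => by
          simp only [Pi.mul_apply, Pi.pow_apply]; ring)
      refine h2.congr_deriv ?_
      have hx0 := hx.1.ne'
      simp only [Nat.add_sub_cancel, Pi.pow_apply]
      push_cast
      field_simp
      ring
    have hl : Tendsto (fun x : ℝ => x ^ n * (x * Real.log x ^ (k + 1))) (𝓝[>] 0) (𝓝 0) := by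
      have h1 : Tendsto (fun x : ℝ => x ^ n) (𝓝[>] 0) (𝓝 (0 ^ n)) :=
        ((continuous_pow n).tendsto 0).mono_left nhdsWithin_le_nhds
      simpa using h1.mul (tendsto_mul_log_pow (k + 1))
    have hr : Tendsto (fun x : ℝ => x ^ n * (x * Real.log x ^ (k + 1))) (𝓝[<] 1) (𝓝 0) := by
      have h1 : ContinuousAt (fun x : ℝ => x ^ n * (x * Real.log x ^ (k + 1))) 1 := by
        have := Real.continuousAt_log (one_ne_zero (α := ℝ))
        fun_prop
      have h2 := h1.tendsto.mono_left (nhdsWithin_le_nhds (s := Set.Iio 1))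
      simpa using h2
    have hFTC := intervalIntegral.integral_eq_sub_of_hasDerivAt_of_tendsto zero_lt_one hderiv hint
      hl hr
    rw [intervalIntegral.integral_add
        ((intervalIntegrable_log_pow_mul_pow (k + 1) n).const_mul _)
        ((intervalIntegrable_log_pow_mul_pow k n).const_mul _),
      intervalIntegral.integral_const_mul, intervalIntegral.integral_const_mul, ih] at hFTC
    have hn : (n : ℝ) + 1 ≠ 0 := by positivity
    rw [← mul_right_inj' hn, eq_sub_of_add_eq hFTC, Nat.factorial_succ]
    push_cast
    field_simp
    ring

open MeasureTheory in
/-- Termwise integration of a power series against a power of the logarithm. -/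
theorem hasSum_integral_log_pow_mul {k : ℕ} {c : ℕ → ℝ} {g : ℝ → ℝ}
    (hg : ∀ x ∈ Set.Ioo (0 : ℝ) 1, HasSum (fun n => c n * x ^ n) (g x))
    (hc : Summable fun n : ℕ => |c n| / ((n : ℝ) + 1) ^ (k + 1)) :
    HasSum (fun n : ℕ => (-1) ^ k * (k.factorial : ℝ) * (c n / ((n : ℝ) + 1) ^ (k + 1)))
      (∫ x in (0 : ℝ)..1, Real.log x ^ k * g x) := by
  have hi : ∀ n, IntegrableOn (fun x => Real.log x ^ k * x ^ n) (Set.Ioo 0 1) := fun n =>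
    (intervalIntegrable_iff_integrableOn_Ioo_of_le zero_le_one).1
      (intervalIntegrable_log_pow_mul_pow k n)
  have hset : ∀ f : ℝ → ℝ, ∫ x in (0 : ℝ)..1, f x = ∫ x in Set.Ioo (0 : ℝ) 1, f x := fun f => by
    rw [intervalIntegral.integral_of_le zero_le_one, integral_Ioc_eq_integral_Ioo]
  have h := hasSum_integral_of_summable_integral_norm (μ := volume.restrict (Set.Ioo (0 : ℝ) 1))
    (F := fun n x => c n * (Real.log x ^ k * x ^ n)) (fun n => (hi n).const_mul (c n)) ?_
  · rw [hset]
    have e : ∫ x in Set.Ioo (0 : ℝ) 1, ∑' n, c n * (Real.log x ^ k * x ^ n) =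
        ∫ x in Set.Ioo (0 : ℝ) 1, Real.log x ^ k * g x := by
      refine setIntegral_congr_fun measurableSet_Ioo fun x hx => ?_
      exact (((hg x hx).mul_left (Real.log x ^ k)).of_eq (fun n => by ring) rfl).tsum_eq
    rw [← e]
    refine h.of_eq (fun n => ?_) rfl
    rw [integral_const_mul, ← hset, integral_log_pow_mul_pow]
    ring
  · refine (hc.mul_left (k.factorial : ℝ)).congr fun n => ?_
    have e : ∫ x in Set.Ioo (0 : ℝ) 1, ‖c n * (Real.log x ^ k * x ^ n)‖ =
        ∫ x in Set.Ioo (0 : ℝ) 1, |c n| * (-1) ^ k * (Real.log x ^ k * x ^ n) := by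
      refine setIntegral_congr_fun measurableSet_Ioo fun x hx => ?_
      simp only [norm_mul, norm_pow, Real.norm_eq_abs, abs_of_pos hx.1,
        abs_of_neg (Real.log_neg hx.1 hx.2)]
      rw [neg_pow]
      ring
    have h1 : (-1 : ℝ) ^ k * (-1) ^ k = 1 := by rw [← mul_pow]; norm_num
    rw [e, integral_const_mul, ← hset, integral_log_pow_mul_pow]
    linear_combination (-(|c n| * k.factorial / ((n : ℝ) + 1) ^ (k + 1))) * h1

theorem integral_log_pow_div_one_sub {k : ℕ} {Z : ℝ}
    (h : HasSum (fun n : ℕ => 1 / (n : ℝ) ^ (k + 1)) Z) :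
    ∫ x in (0 : ℝ)..1, Real.log x ^ k * (1 - x)⁻¹ = (-1) ^ k * (k.factorial : ℝ) * Z := by
  have h1 := hasSum_one_div_succ_pow (Nat.succ_ne_zero k) h
  have h2 := hasSum_integral_log_pow_mul (k := k) (c := fun _ => 1) (g := fun x => (1 - x)⁻¹)
    (fun x hx => by simpa using hasSum_geometric_of_lt_one hx.1.le hx.2)
    (by simpa using h1.summable)
  exact h2.unique (h1.mul_left _)

-- The substitution x = sin² θ turns the integral into that of log^k x / (1 - x) over (0, 1), a zeta
-- value by the geometric series.
open MeasureTheory in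
theorem integral_log_sin_pow_mul_tan {k : ℕ} {Z : ℝ}
    (h : HasSum (fun n : ℕ => 1 / (n : ℝ) ^ (k + 1)) Z) :
    ∫ θ in (0 : ℝ)..(Real.pi / 2), Real.log (Real.sin θ) ^ k * Real.tan θ =
      (-1) ^ k * (k.factorial : ℝ) / 2 ^ (k + 1) * Z := by
  have hpi : 0 < Real.pi / 2 := by positivity
  have himg : (fun θ => Real.sin θ ^ 2) '' Set.Ioo 0 (Real.pi / 2) = Set.Ioo (0 : ℝ) 1 := by
    ext y
    constructor
    · rintro ⟨θ, hθ, rfl⟩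
      have h1 : 0 < Real.sin θ := Real.sin_pos_of_mem_Ioo ⟨hθ.1, by linarith [hθ.2]⟩
      have h2 : 0 < Real.cos θ := Real.cos_pos_of_mem_Ioo ⟨by linarith [hθ.1], hθ.2⟩
      exact ⟨by positivity, by nlinarith [Real.sin_sq_add_cos_sq θ]⟩
    · intro hy
      have h0 : 0 < √y := Real.sqrt_pos.2 hy.1
      have h1 : √y < 1 := by rw [Real.sqrt_lt' one_pos]; simpa using hy.2
      refine ⟨Real.arcsin (√y), ⟨Real.arcsin_pos.2 h0, Real.arcsin_lt_pi_div_two.2 h1⟩, ?_⟩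
      simp only [Real.sin_arcsin (by linarith) h1.le, Real.sq_sqrt hy.1.le]
  have hinj : Set.InjOn (fun θ => Real.sin θ ^ 2) (Set.Ioo 0 (Real.pi / 2)) := by
    intro a ha b hb hab
    have h1 : 0 < Real.sin a := Real.sin_pos_of_mem_Ioo ⟨ha.1, by linarith [ha.2]⟩
    have h2 : 0 < Real.sin b := Real.sin_pos_of_mem_Ioo ⟨hb.1, by linarith [hb.2]⟩
    have h3 : Real.sin a = Real.sin b := by
      simpa [abs_of_pos h1, abs_of_pos h2] using sq_eq_sq_iff_abs_eq_abs _ _ |>.1 hab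
    exact Real.injOn_sin ⟨by linarith [ha.1], ha.2.le⟩ ⟨by linarith [hb.1], hb.2.le⟩ h3
  have hd : ∀ θ ∈ Set.Ioo 0 (Real.pi / 2), HasDerivWithinAt (fun θ => Real.sin θ ^ 2)
      (2 * Real.sin θ * Real.cos θ) (Set.Ioo 0 (Real.pi / 2)) θ := fun θ _ => by
    have := ((Real.hasDerivAt_sin θ).pow 2).hasDerivWithinAt (s := Set.Ioo 0 (Real.pi / 2))
    refine this.congr_deriv ?_
    norm_num
  have hcv := integral_image_eq_integral_abs_deriv_smul measurableSet_Ioo hd hinj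
    (fun x => Real.log x ^ k * (1 - x)⁻¹)
  rw [himg, ← integral_Ioc_eq_integral_Ioo, ← intervalIntegral.integral_of_le zero_le_one,
    integral_log_pow_div_one_sub h] at hcv
  rw [intervalIntegral.integral_of_le hpi.le, integral_Ioc_eq_integral_Ioo]
  have e : ∫ θ in Set.Ioo 0 (Real.pi / 2), |2 * Real.sin θ * Real.cos θ| •
      (Real.log (Real.sin θ ^ 2) ^ k * (1 - Real.sin θ ^ 2)⁻¹) =
      2 ^ (k + 1) * ∫ θ in Set.Ioo 0 (Real.pi / 2), Real.log (Real.sin θ) ^ k * Real.tan θ := by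
    rw [← integral_const_mul]
    refine setIntegral_congr_fun measurableSet_Ioo fun θ hθ => ?_
    have h1 : 0 < Real.sin θ := Real.sin_pos_of_mem_Ioo ⟨hθ.1, by linarith [hθ.2]⟩
    have h2 : 0 < Real.cos θ := Real.cos_pos_of_mem_Ioo ⟨by linarith [hθ.1], hθ.2⟩
    simp only [abs_of_pos (by positivity : 0 < 2 * Real.sin θ * Real.cos θ), ← Real.cos_sq',
      Real.log_pow, Real.tan_eq_sin_div_cos, smul_eq_mul]
    push_cast
    rw [mul_pow, pow_succ]
    field_simp
    ring
  rw [e] at hcv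
  have h2 : (2 : ℝ) ^ (k + 1) ≠ 0 := by positivity
  rw [← mul_right_inj' h2, ← hcv]
  field_simp

/-! ### Companion functions log^k sin · tan and Abel summation. -/

/-- One factor log sin tames the pole of tan at π/2. Where |tan θ| ≥ 1, the inequality log(sin² θ) ≥
1 - 1/sin² θ = -cot² θ gives 2 |log sin θ| tan² θ ≤ 1. -/
theorem abs_log_sin_mul_tan_le {θ : ℝ} (h : θ ∈ Set.Ioo 0 Real.pi) :
    |Real.log (Real.sin θ) * Real.tan θ| ≤ |Real.log (Real.sin θ)| + 1 := by
  have hs := Real.sin_pos_of_mem_Ioo h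
  have hsc := Real.sin_sq_add_cos_sq θ
  rcases eq_or_ne (Real.cos θ) 0 with hc | hc
  · rw [Real.tan_eq_sin_div_cos, hc, div_zero, mul_zero, abs_zero]; positivity
  have ht : Real.tan θ ^ 2 * Real.cos θ ^ 2 = Real.sin θ ^ 2 := by
    rw [Real.tan_eq_sin_div_cos]; field_simp
  have hc2 : 0 < Real.cos θ ^ 2 := by positivity
  rw [abs_mul]
  rcases le_total |Real.tan θ| 1 with h1 | h1
  · nlinarith [abs_nonneg (Real.log (Real.sin θ))]
  · have hl : |Real.log (Real.sin θ)| * (2 * Real.sin θ ^ 2) ≤ Real.cos θ ^ 2 := by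
      have hlog := Real.one_sub_inv_le_log_of_pos (by positivity : 0 < Real.sin θ ^ 2)
      rw [Real.log_pow] at hlog
      have hneg : Real.log (Real.sin θ) ≤ 0 := Real.log_nonpos hs.le (Real.sin_le_one θ)
      rw [abs_of_nonpos hneg]
      have : (1 - (Real.sin θ ^ 2)⁻¹) * Real.sin θ ^ 2 = Real.sin θ ^ 2 - 1 := by
        field_simp
      push_cast at hlog
      nlinarith [mul_le_mul_of_nonneg_right hlog (sq_nonneg (Real.sin θ))]
    have ht1 : Real.cos θ ^ 2 ≤ Real.sin θ ^ 2 := by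
      rw [← ht]
      have : 1 ≤ Real.tan θ ^ 2 := by rw [← sq_abs]; nlinarith
      nlinarith
    have hl2 : |Real.log (Real.sin θ)| * (2 * |Real.tan θ| ^ 2) ≤ 1 := by
      rw [sq_abs]
      have : |Real.log (Real.sin θ)| * (2 * Real.tan θ ^ 2) * Real.cos θ ^ 2
          ≤ 1 * Real.cos θ ^ 2 := by
        rw [one_mul, mul_assoc, mul_assoc, ht]; exact hl
      exact le_of_mul_le_mul_right this hc2
    have : |Real.log (Real.sin θ)| * |Real.tan θ| ≤
        |Real.log (Real.sin θ)| * (2 * |Real.tan θ| ^ 2) :=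
      mul_le_mul_of_nonneg_left (by nlinarith) (abs_nonneg _)
    linarith [abs_nonneg (Real.log (Real.sin θ))]

open MeasureTheory in
theorem memLp_log_sin_pow_mul_tan (k : ℕ) :
    MemLp (fun θ => Real.log (Real.sin θ) ^ (k + 1) * Real.tan θ) 2
      (volume.restrict (Set.Ioc 0 Real.pi)) := by
  have hm : Measurable fun θ => Real.log (Real.sin θ) ^ (k + 1) * Real.tan θ := by
    have h1 : Measurable fun θ => Real.tan θ := by
      simp only [Real.tan_eq_sin_div_cos]
      exact Real.measurable_sin.div Real.measurable_cos
    exact ((Real.measurable_log.comp Real.measurable_sin).pow_const (k + 1)).mul h1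
  refine MemLp.mono' ((memLp_log_sin_pow (k + 1)).norm.add (memLp_log_sin_pow k).norm)
    hm.aestronglyMeasurable ?_
  rw [← restrict_Ioo_eq_restrict_Ioc]
  filter_upwards [ae_restrict_mem measurableSet_Ioo] with θ hθ
  have h := abs_log_sin_mul_tan_le hθ
  simp only [Pi.add_apply, Real.norm_eq_abs]
  rw [show Real.log (Real.sin θ) ^ (k + 1) * Real.tan θ =
    Real.log (Real.sin θ) ^ k * (Real.log (Real.sin θ) * Real.tan θ) by ring, pow_succ,
    abs_mul, abs_mul (Real.log (Real.sin θ) ^ k)]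
  nlinarith [abs_nonneg (Real.log (Real.sin θ) ^ k)]

/-- By sum-to-product, the cosines of frequencies 2n+3 and 2n+1 add to 2 cos((2n+2)θ) cos θ, and the
sines subtract to 2 cos((2n+2)θ) sin θ, so the hypothesis matches the integrands pointwise. -/
theorem oddCosCoeff_succ_add {F G : ℝ → ℝ}
    (hF : IntervalIntegrable F MeasureTheory.volume 0 Real.pi)
    (hG : IntervalIntegrable G MeasureTheory.volume 0 Real.pi)
    (h : ∀ θ, G θ * Real.cos θ = F θ * Real.sin θ) (n : ℕ) :
    oddCosCoeff G (n + 1) + oddCosCoeff G n = oddSinCoeff F (n + 1) - oddSinCoeff F n := by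
  simp only [oddCosCoeff, oddSinCoeff]
  rw [← intervalIntegral.integral_add (hG.mul_continuousOn (by fun_prop))
      (hG.mul_continuousOn (by fun_prop)),
    ← intervalIntegral.integral_sub (hF.mul_continuousOn (by fun_prop))
      (hF.mul_continuousOn (by fun_prop))]
  congr 1
  funext θ
  have e1 : (2 * ((n + 1 : ℕ) : ℝ) + 1) * θ = (2 * n + 2) * θ + θ := by push_cast; ring
  have e2 : (2 * (n : ℝ) + 1) * θ = (2 * n + 2) * θ - θ := by ring
  rw [e1, e2, Real.cos_add, Real.cos_sub, Real.sin_add, Real.sin_sub]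
  linear_combination 2 * Real.cos ((2 * n + 2) * θ) * h θ

theorem oddCosCoeff_zero_eq {F G : ℝ → ℝ}
    (h : ∀ θ, G θ * Real.cos θ = F θ * Real.sin θ) : oddCosCoeff G 0 = oddSinCoeff F 0 := by
  simp [oddCosCoeff, oddSinCoeff, h]

theorem sum_alternating_of_recurrence {c e : ℕ → ℝ} (h0 : e 0 = c 0)
    (h : ∀ n, e (n + 1) + e n = c (n + 1) - c n) (N : ℕ) :
    ∑ n ∈ Finset.range N, (-1) ^ n * c n = -((-1) ^ N * (c N - e N) / 2) := by
  induction N with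
  | zero => simp [h0]
  | succ N ih =>
    rw [Finset.sum_range_succ, ih, pow_succ]
    linear_combination (-1) ^ N / 2 * h N

/-- Abel summation: the partial sums of (-1)^n c_n are known in terms of c and e, and
`oddHarmonicMid` has increments a_n + a_{n+1} with a = `oddInv`. The cubic sum is thereby traded for
the sum of (-1)^n a_n e_n, to which Parseval applies. -/
theorem sum_alternating_mul_oddHarmonicMid {c e : ℕ → ℝ} (h0 : e 0 = c 0)
    (h : ∀ n, e (n + 1) + e n = c (n + 1) - c n) (N : ℕ) :
    ∑ n ∈ Finset.range N, (-1) ^ n * (oddHarmonicMid n * c n) =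
      -(∑ n ∈ Finset.range N, (-1) ^ n * (oddInv n * e n)) +
        (oddHarmonicMid N - oddInv N) * ∑ n ∈ Finset.range N, (-1) ^ n * c n := by
  induction N with
  | zero => simp
  | succ N ih =>
    have h1 := sum_alternating_of_recurrence h0 h N
    rw [Finset.sum_range_succ, Finset.sum_range_succ, Finset.sum_range_succ, ih,
      oddHarmonicMid_succ, h1]
    ring

theorem Summable.tendsto_zero_of_mul_self {c : ℕ → ℝ} (h : Summable fun n => c n * c n) :
    Tendsto c atTop (𝓝 0) := by
  have h1 := h.tendsto_atTop_zero.sqrt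
  rw [Real.sqrt_zero] at h1
  refine tendsto_zero_iff_abs_tendsto_zero _ |>.2 (h1.congr fun n => ?_)
  exact Real.sqrt_mul_self_eq_abs (c n)

theorem tendsto_sum_alternating_of_recurrence {c e : ℕ → ℝ} (h0 : e 0 = c 0)
    (h : ∀ n, e (n + 1) + e n = c (n + 1) - c n) (hc : Tendsto c atTop (𝓝 0))
    (he : Tendsto e atTop (𝓝 0)) :
    Tendsto (fun N => ∑ n ∈ Finset.range N, (-1) ^ n * c n) atTop (𝓝 0) := by
  simp only [sum_alternating_of_recurrence h0 h]
  have h1 := (hc.sub he).norm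
  rw [sub_zero, norm_zero] at h1
  refine squeeze_zero_norm (fun N => ?_) h1
  rw [norm_neg, norm_div, norm_mul, norm_pow, norm_neg, norm_one, one_pow, one_mul]
  norm_num

/-! ### Alternating tails and growth of odd harmonic numbers. -/

/-- Leibniz's test with its error bound: even partial sums lie below the limit and odd ones above,
and consecutive ones differ by `f N`. -/
theorem Antitone.exists_alternating_tail {f : ℕ → ℝ} (hf : Antitone f)
    (h0 : Tendsto f atTop (𝓝 0)) :
    ∃ l, Tendsto (fun N => ∑ n ∈ Finset.range N, (-1) ^ n * f n) atTop (𝓝 l) ∧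
      ∀ N, |∑ n ∈ Finset.range N, (-1) ^ n * f n - l| ≤ f N := by
  obtain ⟨l, hl⟩ := hf.tendsto_alternating_series_of_tendsto_zero h0
  refine ⟨l, hl, fun N => ?_⟩
  have hpos : 0 ≤ f N := hf.le_of_tendsto h0 N
  rcases Nat.even_or_odd' N with ⟨k, rfl | rfl⟩
  · have h1 := hf.alternating_series_le_tendsto hl k
    have h2 := hf.tendsto_le_alternating_series hl k
    rw [Finset.sum_range_succ, pow_mul] at h2
    norm_num at h2
    rw [abs_le]
    constructor <;> linarith
  · have h1 := hf.tendsto_le_alternating_series hl k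
    have h2 := hf.alternating_series_le_tendsto hl (k + 1)
    rw [show 2 * (k + 1) = 2 * k + 1 + 1 by ring, Finset.sum_range_succ, pow_succ _ (2 * k),
      pow_mul] at h2
    norm_num at h2
    rw [abs_le]
    constructor <;> linarith

theorem oddHarmonic_le_log (n : ℕ) : oddHarmonic n ≤ 2 * Real.log (n + 3) := by
  have h1 : oddHarmonic n ≤ (harmonic (n + 1) : ℝ) := by
    rw [oddHarmonic, harmonic]
    push_cast
    refine Finset.sum_le_sum fun k _ => ?_
    rw [one_div]
    have : (0 : ℝ) ≤ k := k.cast_nonneg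
    exact inv_anti₀ (by positivity) (by linarith)
  have h2 := harmonic_le_one_add_log (n + 1)
  have h3 : 1 ≤ Real.log (n + 3) := by
    rw [Real.le_log_iff_exp_le (by positivity)]
    have : (0 : ℝ) ≤ n := n.cast_nonneg
    linarith [Real.exp_one_lt_d9]
  have h4 : Real.log ((n + 1 : ℕ) : ℝ) ≤ Real.log (n + 3) :=
    Real.log_le_log (by positivity) (by push_cast; linarith)
  linarith

theorem tendsto_oddHarmonic_pow_three_mul_oddInv :
    Tendsto (fun n => oddHarmonic n ^ 3 * oddInv n) atTop (𝓝 0) := by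
  have h1 : Tendsto (fun x : ℝ => Real.log x ^ 3 / x) atTop (𝓝 0) :=
    (Real.isLittleO_pow_log_id_atTop (n := 3)).tendsto_div_nhds_zero
  have h2 : Tendsto (fun n : ℕ => (n : ℝ) + 3) atTop atTop :=
    tendsto_atTop_add_const_right _ _ tendsto_natCast_atTop_atTop
  have h3 := (h1.comp h2).const_mul 24
  rw [mul_zero] at h3
  refine squeeze_zero (fun n => mul_nonneg (pow_nonneg (by linarith [one_le_oddHarmonic n]) 3)
    (oddInv_pos n).le) (fun n => ?_) h3
  have hl := oddHarmonic_le_log n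
  have h0 : 0 ≤ oddHarmonic n := by linarith [one_le_oddHarmonic n]
  have ha : oddInv n ≤ 3 / ((n : ℝ) + 3) := by
    rw [oddInv, div_le_div_iff₀ (by positivity) (by positivity)]
    have : (0 : ℝ) ≤ n := n.cast_nonneg
    linarith
  calc oddHarmonic n ^ 3 * oddInv n
      ≤ (2 * Real.log (n + 3)) ^ 3 * (3 / ((n : ℝ) + 3)) :=
        mul_le_mul (pow_le_pow_left₀ h0 hl 3) ha (oddInv_pos n).le
          (pow_nonneg (h0.trans hl) 3)
    _ = 24 * ((fun x : ℝ => Real.log x ^ 3 / x) ∘ fun n : ℕ => (n : ℝ) + 3) n := by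
        simp only [Function.comp]; ring

theorem oddInv_succ_le (n : ℕ) : oddInv (n + 1) ≤ oddInv n := by
  unfold oddInv
  push_cast
  exact one_div_le_one_div_of_le (by positivity) (by linarith)

theorem antitone_oddInv : Antitone oddInv := antitone_nat_of_succ_le oddInv_succ_le

theorem oddInv_eq_of_succ (n : ℕ) :
    oddInv (n + 1) = oddInv n * (1 - 2 * oddInv (n + 1)) := by
  unfold oddInv
  push_cast
  field_simp
  ring

theorem antitone_oddHarmonic_mul_oddInv : Antitone fun n => oddHarmonic n * oddInv n := by
  refine antitone_nat_of_succ_le fun n => ?_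
  have e : (oddHarmonic n + oddInv (n + 1)) * oddInv (n + 1) =
      (oddHarmonic n + oddInv (n + 1)) * (1 - 2 * oddInv (n + 1)) * oddInv n := by
    linear_combination (oddHarmonic n + oddInv (n + 1)) * oddInv_eq_of_succ n
  rw [oddHarmonic_succ, e]
  refine mul_le_mul_of_nonneg_right ?_ (oddInv_pos n).le
  nlinarith [one_le_oddHarmonic n, oddInv_pos (n + 1),
    mul_nonneg (oddInv_pos (n + 1)).le (sub_nonneg.2 (one_le_oddHarmonic n))]

theorem antitone_oddHarmonic_sq_mul_oddInv :
    Antitone fun n => oddHarmonic n ^ 2 * oddInv n := by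
  refine antitone_nat_of_succ_le fun n => ?_
  have e : (oddHarmonic n + oddInv (n + 1)) ^ 2 * oddInv (n + 1) =
      (oddHarmonic n + oddInv (n + 1)) ^ 2 * (1 - 2 * oddInv (n + 1)) * oddInv n := by
    linear_combination (oddHarmonic n + oddInv (n + 1)) ^ 2 * oddInv_eq_of_succ n
  rw [oddHarmonic_succ, e]
  refine mul_le_mul_of_nonneg_right ?_ (oddInv_pos n).le
  have hb := oddInv_pos (n + 1)
  have hh := one_le_oddHarmonic n
  generalize oddInv (n + 1) = b at *
  generalize oddHarmonic n = x at *
  -- After expansion, the right side minus the left is 2bx(x-1) + b²(4x-1) + 2b³, nonnegative for x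
  -- ≥ 1.
  nlinarith [mul_nonneg hb.le (mul_nonneg (by linarith : (0 : ℝ) ≤ x) (sub_nonneg.2 hh)),
    mul_nonneg (sq_nonneg b) (sub_nonneg.2 hh), pow_pos hb 3, pow_pos hb 2]

/-! ### The bilateral cubic alternating sum. -/

/-- Holds at every θ: where cos θ = 0 the sine is ±1, so `Real.log` of it is zero and both sides
vanish. -/
theorem log_sin_mul_tan_mul_cos (θ : ℝ) :
    Real.log (Real.sin θ) * Real.tan θ * Real.cos θ = Real.log (Real.sin θ) * Real.sin θ := by
  rcases eq_or_ne (Real.cos θ) 0 with h | h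
  · have h1 : Real.sin θ ^ 2 = 1 := by rw [Real.sin_sq, h]; norm_num
    rcases sq_eq_one_iff.1 h1 with h2 | h2 <;> simp [h, h2]
  · rw [mul_assoc, Real.tan_mul_cos h]

open MeasureTheory in
theorem MeasureTheory.MemLp.intervalIntegrable_zero_pi {H : ℝ → ℝ}
    (h : MemLp H 2 (volume.restrict (Set.Ioc 0 Real.pi))) :
    IntervalIntegrable H volume 0 Real.pi := by
  rw [intervalIntegrable_iff_integrableOn_Ioc_of_le Real.pi_pos.le]
  exact h.integrable (by norm_num)

open MeasureTheory in
theorem tendsto_oddSinCoeff {F : ℝ → ℝ} (hF : MemLp F 2 (volume.restrict (Set.Ioc 0 Real.pi)))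
    (hs : ∀ θ, F (Real.pi - θ) = F θ) : Tendsto (oddSinCoeff F) atTop (𝓝 0) :=
  (hasSum_oddSinCoeff_mul hF hF hs).summable.tendsto_zero_of_mul_self

open MeasureTheory in
theorem tendsto_oddCosCoeff {F : ℝ → ℝ} (hF : MemLp F 2 (volume.restrict (Set.Ioc 0 Real.pi)))
    (hs : ∀ θ, F (Real.pi - θ) = -F θ) : Tendsto (oddCosCoeff F) atTop (𝓝 0) :=
  (hasSum_oddCosCoeff_mul hF hF hs).summable.tendsto_zero_of_mul_self

/-- `∑ (-1)^n (𝓗_n + 𝓗_{n-1}) / (2n+1) = π log 2 / 4`. -/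
theorem tendsto_sum_alternating_oddInv_mul_oddHarmonicMid :
    Tendsto (fun N => ∑ n ∈ Finset.range N, (-1 : ℝ) ^ n * (oddInv n * oddHarmonicMid n)) atTop
      (𝓝 (Real.pi / 4 * Real.log 2)) := by
  have hF := memLp_log_sin_pow 1
  have hG := memLp_log_sin_pow_mul_tan 0
  have hFG : ∀ θ, Real.log (Real.sin θ) ^ (0 + 1) * Real.tan θ * Real.cos θ =
      Real.log (Real.sin θ) ^ 1 * Real.sin θ := by
    intro θ
    simpa using log_sin_mul_tan_mul_cos θ
  have h := tendsto_sum_alternating_of_recurrence (oddCosCoeff_zero_eq hFG)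
    (oddCosCoeff_succ_add hF.intervalIntegrable_zero_pi hG.intervalIntegrable_zero_pi hFG)
    (tendsto_oddSinCoeff hF (log_sin_pow_pi_sub 1))
    (tendsto_oddCosCoeff hG fun θ => by rw [Real.sin_pi_sub, Real.tan_pi_sub]; ring)
  simp only [oddSinCoeff_log_sin_pow_one] at h
  have h2 := (Real.tendsto_sum_pi_div_four.mul_const (Real.log 2)).sub (h.div_const 2)
  rw [zero_div, sub_zero] at h2
  refine h2.congr fun N => ?_
  rw [Finset.sum_mul, Finset.sum_div, ← Finset.sum_sub_distrib]
  refine Finset.sum_congr rfl fun n _ => ?_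
  rw [oddInv]
  ring

/-- The function equal to `1` on `(-∞, π/2]` and to `-1` beyond. -/
noncomputable def halfSign (θ : ℝ) : ℝ := if θ ≤ Real.pi / 2 then 1 else -1

open MeasureTheory in
theorem memLp_halfSign : MemLp halfSign 2 (volume.restrict (Set.Ioc 0 Real.pi)) := by
  have hm : Measurable halfSign :=
    Measurable.ite measurableSet_Iic measurable_const measurable_const
  refine MemLp.of_bound hm.aestronglyMeasurable 1 (Eventually.of_forall fun θ => ?_)
  unfold halfSign
  split_ifs <;> simp

theorem integral_mul_halfSign {f : ℝ → ℝ}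
    (hi : IntervalIntegrable f MeasureTheory.volume 0 Real.pi)
    (hf : ∀ θ, f (Real.pi - θ) = -f θ) :
    ∫ θ in (0 : ℝ)..Real.pi, f θ * halfSign θ = 2 * ∫ θ in (0 : ℝ)..(Real.pi / 2), f θ := by
  have hint : IntervalIntegrable (fun θ => f θ * halfSign θ) MeasureTheory.volume 0 Real.pi := by
    have hm : Measurable halfSign :=
      Measurable.ite measurableSet_Iic measurable_const measurable_const
    have : ∀ θ, ‖halfSign θ‖ ≤ 1 := fun θ => by unfold halfSign; split_ifs <;> simp
    exact ⟨hi.1.mul_bdd hm.aestronglyMeasurable (Eventually.of_forall this),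
      hi.2.mul_bdd hm.aestronglyMeasurable (Eventually.of_forall this)⟩
  rw [integral_zero_pi_eq_two_mul hint]
  · congr 1
    refine intervalIntegral.integral_congr fun θ hθ => ?_
    rw [Set.uIcc_of_le (by positivity)] at hθ
    simp [halfSign, hθ.2]
  · intro θ
    rw [hf]
    rcases lt_trichotomy θ (Real.pi / 2) with h | h | h
    · rw [halfSign, halfSign, if_neg (by linarith), if_pos h.le]; ring
    -- At the centre `halfSign` is not antisymmetric, but f is antisymmetric and so vanishes there.
    · have h0 : f θ = 0 := by
        have := hf θ
        rw [show Real.pi - θ = θ by linarith] at this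
        linarith
      rw [h0]; ring
    · rw [halfSign, halfSign, if_pos (by linarith), if_neg (by linarith)]; ring

theorem oddCosCoeff_halfSign (n : ℕ) : oddCosCoeff halfSign n = 2 * ((-1) ^ n * oddInv n) := by
  have hc : (2 * (n : ℝ) + 1) ≠ 0 := by positivity
  rw [oddCosCoeff]
  simp only [mul_comm (halfSign _)]
  rw [integral_mul_halfSign (Continuous.intervalIntegrable (by fun_prop) _ _)
    (cos_odd_mul_pi_sub n),
    intervalIntegral.integral_comp_mul_left (fun x => Real.cos x) hc, integral_cos,
    sin_odd_mul_pi_div_two, oddInv]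
  simp
  ring

open MeasureTheory in
/-- The limit of `∑ (-1)^n (𝓗_n + 𝓗_{n-1})^3 / (2n+1)`, up to lower order sums. -/
theorem tendsto_sum_alternating_oddHarmonicMid_mul_oddSinCoeff :
    Tendsto (fun N => ∑ n ∈ Finset.range N, (-1 : ℝ) ^ n * (oddHarmonicMid n *
      (2 * oddInv n * (oddHarmonicMid n ^ 2 + oddInv n ^ 2
        - (Real.log 2 ^ 2 + Real.pi ^ 2 / 12))))) atTop
      (𝓝 (-(Real.pi / 2 * (1 / 4 * (riemannZeta 3).re + Real.pi ^ 2 / 12 * Real.log 2)))) := by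
  set q : ℝ := Real.log 2 ^ 2 + Real.pi ^ 2 / 12 with hq
  -- Subtracting 2 log 2 · log sin removes the term linear in `oddHarmonicMid` from the coefficients
  -- of log² sin, leaving the constant -q.
  set F : ℝ → ℝ := fun θ => Real.log (Real.sin θ) ^ 2
    - 2 * Real.log 2 * Real.log (Real.sin θ) ^ 1 with hFdef
  set G : ℝ → ℝ := fun θ => Real.log (Real.sin θ) ^ (1 + 1) * Real.tan θ
    - 2 * Real.log 2 * (Real.log (Real.sin θ) ^ (0 + 1) * Real.tan θ) with hGdef
  have hF : MemLp F 2 (volume.restrict (Set.Ioc 0 Real.pi)) :=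
    (memLp_log_sin_pow 2).sub ((memLp_log_sin_pow 1).const_mul _)
  have hG : MemLp G 2 (volume.restrict (Set.Ioc 0 Real.pi)) :=
    (memLp_log_sin_pow_mul_tan 1).sub ((memLp_log_sin_pow_mul_tan 0).const_mul _)
  have hFG : ∀ θ, G θ * Real.cos θ = F θ * Real.sin θ := by
    intro θ
    simp only [hFdef, hGdef]
    linear_combination (Real.log (Real.sin θ) - 2 * Real.log 2) * log_sin_mul_tan_mul_cos θ
  have hFs : ∀ θ, F (Real.pi - θ) = F θ := fun θ => by simp only [hFdef, Real.sin_pi_sub]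
  have hGs : ∀ θ, G (Real.pi - θ) = -G θ := fun θ => by
    simp only [hGdef, Real.sin_pi_sub, Real.tan_pi_sub]; ring
  set c := oddSinCoeff F with hcdef
  set e := oddCosCoeff G with hedef
  have h0 : e 0 = c 0 := oddCosCoeff_zero_eq hFG
  have hrec : ∀ n, e (n + 1) + e n = c (n + 1) - c n :=
    oddCosCoeff_succ_add hF.intervalIntegrable_zero_pi hG.intervalIntegrable_zero_pi hFG
  have hc : ∀ n, c n = 2 * oddInv n * (oddHarmonicMid n ^ 2 + oddInv n ^ 2 - q) := by
    intro n
    have h1 : c n = oddSinCoeff (fun θ => Real.log (Real.sin θ) ^ 2) n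
        - 2 * Real.log 2 * oddSinCoeff (fun θ => Real.log (Real.sin θ) ^ 1) n := by
      simp only [hcdef, oddSinCoeff, hFdef]
      rw [← intervalIntegral.integral_const_mul, ← intervalIntegral.integral_sub
        ((intervalIntegrable_log_sin_pow 2).mul_continuousOn (by fun_prop))
        (((intervalIntegrable_log_sin_pow 1).mul_continuousOn (by fun_prop)).const_mul _)]
      congr 1; funext θ; ring
    rw [h1, oddSinCoeff_log_sin_pow_two, oddSinCoeff_log_sin_pow_one, hq]
    ring
  have hu := tendsto_sum_alternating_of_recurrence h0 hrec (tendsto_oddSinCoeff hF hFs)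
    (tendsto_oddCosCoeff hG hGs)
  -- Convergence of ∑ (-1)^n c_n to zero is not enough, because Abel summation multiplies its
  -- partial sums by a logarithmically growing factor. The rate comes from writing c as a
  -- combination of four decreasing sequences.
  have hbound : ∀ N, |∑ n ∈ Finset.range N, (-1) ^ n * c n| ≤
      (20 + 2 * q) * (oddHarmonic N ^ 2 * oddInv N) := by
    have hle : ∀ n, oddInv n ≤ oddHarmonic n ^ 3 * oddInv n := fun n =>
      le_mul_of_one_le_left (oddInv_pos n).le (one_le_pow₀ (one_le_oddHarmonic n))
    have hlim : ∀ f : ℕ → ℝ, (∀ n, 0 ≤ f n) → (∀ n, f n ≤ oddHarmonic n ^ 3 * oddInv n) →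
        Tendsto f atTop (𝓝 0) := fun f h1 h2 =>
      squeeze_zero h1 h2 tendsto_oddHarmonic_pow_three_mul_oddInv
    have hp := fun n => (oddInv_pos n).le
    have hh := fun n => zero_le_one.trans (one_le_oddHarmonic n)
    have ha1 := oddInv_le_one
    have hh1 := one_le_oddHarmonic
    obtain ⟨l1, t1, b1⟩ := antitone_oddHarmonic_sq_mul_oddInv.exists_alternating_tail
      (hlim _ (fun n => by have := hp n; positivity) fun n =>
        mul_le_mul_of_nonneg_right (pow_le_pow_right₀ (hh1 n) (by norm_num)) (hp n))
    obtain ⟨l2, t2, b2⟩ := (show Antitone fun n => oddHarmonic n * oddInv n * oddInv n from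
      fun m n h =>
      mul_le_mul (antitone_oddHarmonic_mul_oddInv h) (antitone_oddInv h) (hp _)
        (mul_nonneg (hh _) (hp _))).exists_alternating_tail
      (hlim _ (fun n => mul_nonneg (mul_nonneg (hh n) (hp n)) (hp n)) fun n => by
        refine (mul_le_of_le_one_right (mul_nonneg (hh n) (hp n)) (ha1 n)).trans ?_
        exact mul_le_mul_of_nonneg_right (le_self_pow₀ (hh1 n) (by norm_num)) (hp n))
    obtain ⟨l3, t3, b3⟩ := (show Antitone fun n => oddInv n ^ 3 from fun m n h =>
      pow_le_pow_left₀ (hp _) (antitone_oddInv h) 3).exists_alternating_tail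
      (hlim _ (fun n => pow_nonneg (hp n) 3) fun n =>
        (pow_le_of_le_one (hp n) (ha1 n) (by norm_num)).trans (hle n))
    obtain ⟨l4, t4, b4⟩ := antitone_oddInv.exists_alternating_tail (hlim _ hp hle)
    have hsum : ∀ N, ∑ n ∈ Finset.range N, (-1) ^ n * c n =
        8 * ∑ n ∈ Finset.range N, (-1) ^ n * (oddHarmonic n ^ 2 * oddInv n)
        - 8 * ∑ n ∈ Finset.range N, (-1) ^ n * (oddHarmonic n * oddInv n * oddInv n)
        + 4 * ∑ n ∈ Finset.range N, (-1) ^ n * oddInv n ^ 3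
        - 2 * q * ∑ n ∈ Finset.range N, (-1) ^ n * oddInv n := by
      intro N
      simp only [Finset.mul_sum]
      rw [← Finset.sum_sub_distrib, ← Finset.sum_add_distrib, ← Finset.sum_sub_distrib]
      refine Finset.sum_congr rfl fun n _ => ?_
      rw [hc, oddHarmonicMid]
      ring
    -- The four limits are unknown separately, but their combination is the limit zero of ∑ (-1)^n
    -- c_n, so each partial sum is a combination of tails; 8 + 8 + 4 + 2q gives the constant of the
    -- bound.
    have hl : 8 * l1 - 8 * l2 + 4 * l3 - 2 * q * l4 = 0 :=
      tendsto_nhds_unique ((((t1.const_mul 8).sub (t2.const_mul 8)).add (t3.const_mul 4)).sub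
        (t4.const_mul (2 * q))) (hu.congr hsum)
    intro N
    have hq0 : 0 ≤ q := by positivity
    have B1 := b1 N
    have B2 := b2 N
    have B3 := b3 N
    have B4 := b4 N
    have hA := hp N
    have C1 : oddInv N ≤ oddHarmonic N ^ 2 * oddInv N :=
      le_mul_of_one_le_left hA (one_le_pow₀ (hh1 N))
    have C2 : oddHarmonic N * oddInv N * oddInv N ≤ oddHarmonic N ^ 2 * oddInv N :=
      (mul_le_of_le_one_right (mul_nonneg (hh N) hA) (ha1 N)).trans
        (mul_le_mul_of_nonneg_right (le_self_pow₀ (hh1 N) (by norm_num)) hA)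
    have C3 : oddInv N ^ 3 ≤ oddHarmonic N ^ 2 * oddInv N :=
      (pow_le_of_le_one hA (ha1 N) (by norm_num)).trans C1
    have e : ∑ n ∈ Finset.range N, (-1) ^ n * c n =
        8 * (∑ n ∈ Finset.range N, (-1) ^ n * (oddHarmonic n ^ 2 * oddInv n) - l1)
        - 8 * (∑ n ∈ Finset.range N, (-1) ^ n * (oddHarmonic n * oddInv n * oddInv n) - l2)
        + 4 * (∑ n ∈ Finset.range N, (-1) ^ n * oddInv n ^ 3 - l3)
        - 2 * q * (∑ n ∈ Finset.range N, (-1) ^ n * oddInv n - l4) := by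
      rw [hsum]; linear_combination hl
    rw [e]
    refine (abs_sub _ _).trans ?_
    refine (add_le_add_left ((abs_add_le _ _).trans (add_le_add_left (abs_sub _ _) _)) _).trans ?_
    simp only [abs_mul]
    rw [abs_of_nonneg hq0]
    norm_num
    nlinarith [mul_le_mul_of_nonneg_left (B4.trans C1) hq0, B1, B2.trans C2, B3.trans C3]
  have hbd : Tendsto (fun N => (oddHarmonicMid N - oddInv N) *
      ∑ n ∈ Finset.range N, (-1) ^ n * c n) atTop (𝓝 0) := by
    have h1 := tendsto_oddHarmonic_pow_three_mul_oddInv.const_mul (2 * (20 + 2 * q))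
    rw [mul_zero] at h1
    refine squeeze_zero_norm (fun N => ?_) h1
    have h2 : 0 ≤ oddHarmonicMid N - oddInv N := by
      linarith [one_le_oddHarmonicMid N, oddInv_le_one N]
    have h3 : oddHarmonicMid N - oddInv N ≤ 2 * oddHarmonic N := by
      linarith [oddHarmonicMid_le N, oddInv_pos N]
    rw [norm_mul, Real.norm_of_nonneg h2, Real.norm_eq_abs]
    refine (mul_le_mul h3 (hbound N) (abs_nonneg _) (h2.trans h3)).trans (le_of_eq ?_)
    ring
  -- The coefficients of `halfSign` are 2(-1)^n a_n with a = `oddInv`, which produces the sum of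
  -- (-1)^n a_n e_n left by Abel summation.
  have hP := hasSum_oddCosCoeff_mul hG memLp_halfSign hGs
  rw [integral_mul_halfSign hG.intervalIntegrable_zero_pi hGs] at hP
  have hI : ∫ θ in (0 : ℝ)..(Real.pi / 2), G θ =
      1 / 4 * (riemannZeta 3).re + Real.pi ^ 2 / 12 * Real.log 2 := by
    have hsub : Set.uIcc 0 (Real.pi / 2) ⊆ Set.uIcc 0 Real.pi := by
      rw [Set.uIcc_of_le (by positivity), Set.uIcc_of_le Real.pi_pos.le]
      exact Set.Icc_subset_Icc le_rfl (by linarith [Real.pi_pos])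
    have hi := fun k => (memLp_log_sin_pow_mul_tan k).intervalIntegrable_zero_pi.mono_set hsub
    rw [hGdef, intervalIntegral.integral_sub (hi 1) ((hi 0).const_mul _),
      intervalIntegral.integral_const_mul, integral_log_sin_pow_mul_tan (k := 1 + 1)
        hasSum_zeta_three, integral_log_sin_pow_mul_tan (k := 0 + 1) hasSum_zeta_two]
    simp [Nat.factorial]
    ring
  rw [hI] at hP
  simp only [oddCosCoeff_halfSign] at hP
  have hE : HasSum (fun n : ℕ => (-1) ^ n * (oddInv n * e n))
      (Real.pi / 2 * (1 / 4 * (riemannZeta 3).re + Real.pi ^ 2 / 12 * Real.log 2)) :=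
    (hP.mul_left (1 / 2)).of_eq (fun n => by ring) (by ring)
  have hfin := hE.tendsto_sum_nat.neg.add hbd
  rw [add_zero] at hfin
  refine hfin.congr fun N => ?_
  rw [← sum_alternating_mul_oddHarmonicMid h0 hrec]
  exact Finset.sum_congr rfl fun n _ => by rw [hc]

/-- The bilateral cubic sum, folded to nonnegative indices. -/
theorem tendsto_sum_alternating_oddHarmonic_pow_three_fold :
    Tendsto (fun N => ∑ n ∈ Finset.range N, (-1 : ℝ) ^ n * (oddInv n *
      (oddHarmonic n ^ 3 + (oddHarmonic n - oddInv n) ^ 3))) atTop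
      (𝓝 (Real.pi / 16 * Real.log 2 ^ 3 + Real.pi ^ 3 / 32 * Real.log 2
        - 9 * Real.pi / 128 * (riemannZeta 3).re)) := by
  have h1 := tendsto_sum_alternating_oddHarmonicMid_mul_oddSinCoeff
  have h2 := tendsto_sum_alternating_oddInv_mul_oddHarmonicMid
  have h3 := hasSum_alternating_oddInv_pow_three_mul_oddHarmonicMid.tendsto_sum_nat
  -- With M = `oddHarmonicMid n` and a = `oddInv n`, H³ + (H - a)³ = (M³ + 3Ma²)/4. The second sum
  -- cancels the q-term of the first, the third supplies the missing Ma²/2.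
  have h := ((h1.const_mul (1 / 8)).add (h2.const_mul
    ((Real.log 2 ^ 2 + Real.pi ^ 2 / 12) / 4))).add (h3.const_mul (1 / 2))
  convert h using 2
  · simp only [Finset.mul_sum]
    rw [← Finset.sum_add_distrib, ← Finset.sum_add_distrib]
    refine Finset.sum_congr rfl fun n _ => ?_
    rw [oddHarmonicMid]
    ring
  · ring

/-! ### Linear Euler sums by partial fractions. -/

/-- The indices below n contribute the first harmonic number, those above n minus the second, and m
= n contributes 0⁻¹ = 0. -/
theorem sum_range_inv_sub (n k : ℕ) :
    ∑ m ∈ Finset.range (n + 1 + k), ((n : ℝ) - m)⁻¹ = (harmonic n : ℝ) - harmonic k := by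
  induction k with
  | zero =>
    rw [add_zero, ← Finset.sum_range_reflect, Finset.sum_range_succ']
    rw [harmonic_zero, Rat.cast_zero, sub_zero, harmonic, Rat.cast_sum]
    have h : ((n : ℝ) - ((n + 1 - 1 - 0 : ℕ) : ℝ))⁻¹ = 0 := by simp
    rw [h, add_zero]
    refine Finset.sum_congr rfl fun j hj => ?_
    rw [Finset.mem_range] at hj
    have : n + 1 - 1 - (j + 1) = n - (j + 1) := by omega
    rw [this, Nat.cast_sub (by omega)]
    push_cast
    congr 1; ring
  | succ k ih =>
    rw [← add_assoc, Finset.sum_range_succ, ih, harmonic_succ]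
    push_cast
    have : (n : ℝ) - (n + 1 + k) = -(k + 1) := by ring
    rw [this, inv_neg]
    ring

/-- The finite form of Euler's evaluation of `∑ H_n / (n + z)^3`, by partial fractions. -/
theorem sum_inv_add_pow_three_mul_harmonic {z : ℝ} (hz : 0 < z) (N : ℕ) :
    ∑ n ∈ Finset.range N, ((n : ℝ) + z)⁻¹ ^ 3 *
        ((harmonic n : ℝ) - harmonic (N - 1 - n) + ∑ m ∈ Finset.range N, ((m : ℝ) + z)⁻¹) =
      3 / 2 * ∑ n ∈ Finset.range N, ((n : ℝ) + z)⁻¹ ^ 4 -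
        1 / 2 * (∑ n ∈ Finset.range N, ((n : ℝ) + z)⁻¹ ^ 2) ^ 2 := by
  set c : ℕ → ℝ := fun n => ((n : ℝ) + z)⁻¹ with hc
  have h1 : ∑ n ∈ Finset.range N, c n ^ 3 * ((harmonic n : ℝ) - harmonic (N - 1 - n)) =
      ∑ n ∈ Finset.range N, ∑ m ∈ Finset.range N, c n ^ 3 * ((n : ℝ) - m)⁻¹ := by
    refine Finset.sum_congr rfl fun n hn => ?_
    rw [Finset.mem_range] at hn
    rw [← Finset.mul_sum, ← sum_range_inv_sub]
    congr 3; omega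
  have h2 : ∑ n ∈ Finset.range N, ∑ m ∈ Finset.range N, c n ^ 3 * ((n : ℝ) - m)⁻¹ =
      ∑ n ∈ Finset.range N, ∑ m ∈ Finset.range N, -(c m ^ 3 * ((n : ℝ) - m)⁻¹) := by
    rw [Finset.sum_comm]
    refine Finset.sum_congr rfl fun n _ => Finset.sum_congr rfl fun m _ => ?_
    rw [← neg_sub (n : ℝ) m, inv_neg]; ring
  -- Symmetrising in n and m makes the difference of cubes divisible by n - m. On the diagonal the
  -- left side is zero by 0⁻¹ = 0, which the term 3 c⁴ compensates.
  have h3 : ∀ n m : ℕ, c n ^ 3 * ((n : ℝ) - m)⁻¹ + -(c m ^ 3 * ((n : ℝ) - m)⁻¹) =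
      (if n = m then 3 * c n ^ 4 else 0) -
        (c n ^ 3 * c m + c n ^ 2 * c m ^ 2 + c n * c m ^ 3) := by
    intro n m
    split_ifs with h
    · subst h; ring
    · have h4 : (n : ℝ) - m ≠ 0 := sub_ne_zero.2 (Nat.cast_injective.ne h)
      have h5 : (n : ℝ) + z ≠ 0 := by positivity
      have h6 : (m : ℝ) + z ≠ 0 := by positivity
      simp only [hc]
      field_simp
      ring
  have h4 : 2 * ∑ n ∈ Finset.range N, c n ^ 3 * ((harmonic n : ℝ) - harmonic (N - 1 - n)) =
      3 * ∑ n ∈ Finset.range N, c n ^ 4 -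
        (2 * ((∑ n ∈ Finset.range N, c n ^ 3) * ∑ n ∈ Finset.range N, c n) +
          (∑ n ∈ Finset.range N, c n ^ 2) ^ 2) := by
    rw [two_mul, h1]
    nth_rewrite 2 [h2]
    simp only [← Finset.sum_add_distrib, h3, Finset.sum_sub_distrib, Finset.sum_ite_eq]
    have e1 : ∑ n ∈ Finset.range N, (if n ∈ Finset.range N then 3 * c n ^ 4 else 0) =
        3 * ∑ n ∈ Finset.range N, c n ^ 4 := by
      rw [Finset.mul_sum]
      exact Finset.sum_congr rfl fun n hn => if_pos hn
    rw [e1]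
    simp only [Finset.sum_add_distrib, ← Finset.sum_mul_sum]
    ring
  simp only [mul_add, Finset.sum_add_distrib, ← Finset.sum_mul]
  linarith

theorem harmonic_add_sub_le (k j : ℕ) : (harmonic (k + j) : ℝ) - harmonic k ≤ j := by
  induction j with
  | zero => simp
  | succ j ih =>
    rw [← add_assoc, harmonic_succ]
    push_cast
    have : ((k : ℝ) + j + 1)⁻¹ ≤ 1 :=
      inv_le_one_of_one_le₀ (by linarith [k.cast_nonneg (α := ℝ), j.cast_nonneg (α := ℝ)])
    linarith

theorem harmonic_add_sub_nonneg (k j : ℕ) : 0 ≤ (harmonic (k + j) : ℝ) - harmonic k := by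
  induction j with
  | zero => simp
  | succ j ih =>
    rw [← add_assoc, harmonic_succ]
    push_cast
    have : 0 ≤ ((k : ℝ) + j + 1)⁻¹ := by positivity
    linarith

theorem tendsto_harmonic_add_sub (j : ℕ) :
    Tendsto (fun k => (harmonic (k + j) : ℝ) - harmonic k) atTop (𝓝 0) := by
  induction j with
  | zero => simp
  | succ j ih =>
    have h := (tendsto_one_div_add_atTop_nhds_zero_nat (𝕜 := ℝ)).comp (tendsto_add_atTop_nat j)
    have := ih.add h
    rw [add_zero] at this
    refine this.congr fun k => ?_
    rw [← add_assoc, harmonic_succ]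
    simp
    ring

/-- Dominated passage to the limit in `sum_inv_add_pow_three_mul_harmonic`: for fixed n, the
harmonic number at N - 1 - n and the sum of 1/(m+z) each diverge, but their difference tends to γ.
-/
theorem hasSum_harmonic_add_mul_inv_add_pow_three {z Q R γ : ℝ} (hz : 0 < z) (hz1 : z ≤ 1)
    (hQ : HasSum (fun n : ℕ => ((n : ℝ) + z)⁻¹ ^ 2) Q)
    (hR : HasSum (fun n : ℕ => ((n : ℝ) + z)⁻¹ ^ 4) R)
    (hγ : Tendsto (fun N : ℕ => ∑ m ∈ Finset.range N, ((m : ℝ) + z)⁻¹ - harmonic N)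
      atTop (𝓝 γ)) :
    HasSum (fun n : ℕ => ((n : ℝ) + z)⁻¹ ^ 3 * (harmonic n + γ)) (3 / 2 * R - 1 / 2 * Q ^ 2) := by
  obtain ⟨K, hK⟩ := (Metric.isBounded_range_of_tendsto _ hγ).exists_norm_le
  have hK' : ∀ N : ℕ, |∑ m ∈ Finset.range N, ((m : ℝ) + z)⁻¹ - harmonic N| ≤ K :=
    fun N => hK _ ⟨N, rfl⟩
  have hK0 : 0 ≤ K := (abs_nonneg _).trans (hK' 0)
  set f : ℕ → ℕ → ℝ := fun N n => if n < N then ((n : ℝ) + z)⁻¹ ^ 3 *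
    ((harmonic n : ℝ) - harmonic (N - 1 - n) + ∑ m ∈ Finset.range N, ((m : ℝ) + z)⁻¹) else 0
    with hf
  have hfsum : ∀ N, ∑' n, f N n = 3 / 2 * ∑ n ∈ Finset.range N, ((n : ℝ) + z)⁻¹ ^ 4 -
        1 / 2 * (∑ n ∈ Finset.range N, ((n : ℝ) + z)⁻¹ ^ 2) ^ 2 := by
    intro N
    rw [← sum_inv_add_pow_three_mul_harmonic hz, tsum_eq_sum (s := Finset.range N)]
    · exact Finset.sum_congr rfl fun n hn => if_pos (Finset.mem_range.1 hn)
    · exact fun n hn => if_neg (by simpa using hn)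
  -- The bracket in the finite identity is at most n + (n+1) + K in absolute value, so one power of
  -- 1/(n+z) is spent and the summable majorant is quadratic.
  have hlin : ∀ n : ℕ, ((n : ℝ) + z)⁻¹ ^ 3 * (2 * (n + 1) + K) ≤
      (2 + K) / z * ((n : ℝ) + z)⁻¹ ^ 2 := by
    intro n
    have h1 : 0 < (n : ℝ) + z := by positivity
    have h2 : 2 * ((n : ℝ) + 1) + K ≤ (2 + K) / z * (n + z) := by
      rw [div_mul_eq_mul_div, le_div_iff₀ hz]
      nlinarith [mul_nonneg (n.cast_nonneg (α := ℝ)) (sub_nonneg.2 hz1),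
        mul_nonneg hK0 (n.cast_nonneg (α := ℝ))]
    calc ((n : ℝ) + z)⁻¹ ^ 3 * (2 * (n + 1) + K)
        ≤ ((n : ℝ) + z)⁻¹ ^ 3 * ((2 + K) / z * (n + z)) := by gcongr
      _ = (2 + K) / z * ((n : ℝ) + z)⁻¹ ^ 2 := by field_simp
  have hn0 : ∀ n : ℕ, 0 ≤ (harmonic n : ℝ) := fun n => by
    simpa using harmonic_add_sub_nonneg 0 n
  have hnle : ∀ n : ℕ, (harmonic n : ℝ) ≤ n := fun n => by simpa using harmonic_add_sub_le 0 n
  have hbd : ∀ N n, ‖f N n‖ ≤ (2 + K) / z * ((n : ℝ) + z)⁻¹ ^ 2 := by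
    intro N n
    refine le_trans ?_ (hlin n)
    have h1 : 0 < (n : ℝ) + z := by positivity
    simp only [hf]
    split_ifs with h
    · rw [norm_mul, norm_pow, norm_inv, Real.norm_of_nonneg h1.le]
      refine mul_le_mul_of_nonneg_left ?_ (by positivity)
      obtain ⟨k, rfl⟩ : ∃ k, N = k + (n + 1) := ⟨N - (n + 1), by omega⟩
      have e : k + (n + 1) - 1 - n = k := by omega
      have h2 := harmonic_add_sub_le k (n + 1)
      have h3 := harmonic_add_sub_nonneg k (n + 1)
      have h4 := abs_le.1 (hK' (k + (n + 1)))
      push_cast at h2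
      rw [e, Real.norm_eq_abs, abs_le]
      constructor <;> linarith [h4.1, h4.2, hn0 n, hnle n]
    · rw [norm_zero]; positivity
  have hlim : ∀ n, Tendsto (fun N => f N n) atTop
      (𝓝 (((n : ℝ) + z)⁻¹ ^ 3 * (harmonic n + γ))) := by
    intro n
    rw [← tendsto_add_atTop_iff_nat (n + 1)]
    have h1 := ((tendsto_harmonic_add_sub (n + 1)).add
      ((tendsto_add_atTop_iff_nat (n + 1)).2 hγ)).const_add (harmonic n : ℝ)
    rw [zero_add] at h1
    refine (h1.const_mul (((n : ℝ) + z)⁻¹ ^ 3)).congr fun k => ?_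
    have e : k + (n + 1) - 1 - n = k := by omega
    simp only [hf]
    rw [if_pos (by omega), e]
    ring
  have hsum : Summable fun n : ℕ => (2 + K) / z * ((n : ℝ) + z)⁻¹ ^ 2 := hQ.summable.mul_left _
  have hT := tendsto_tsum_of_dominated_convergence hsum hlim (Eventually.of_forall hbd)
  simp only [hfsum] at hT
  have hT' := tendsto_nhds_unique hT ((hR.tendsto_sum_nat.const_mul (3 / 2)).sub
    ((hQ.tendsto_sum_nat.pow 2).const_mul (1 / 2)))
  rw [← hT']
  refine (Summable.of_norm_bounded hsum fun n => ?_).hasSum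
  exact le_of_tendsto (hlim n).norm (Eventually.of_forall fun N => hbd N n)

theorem hasSum_harmonic_div_succ_pow_three :
    HasSum (fun n : ℕ => (harmonic n : ℝ) / ((n : ℝ) + 1) ^ 3) (Real.pi ^ 4 / 360) := by
  have h := hasSum_harmonic_add_mul_inv_add_pow_three (γ := 0) zero_lt_one le_rfl
    ((hasSum_one_div_succ_pow two_ne_zero hasSum_zeta_two).of_eq (fun n => by simp) rfl)
    ((hasSum_one_div_succ_pow four_ne_zero hasSum_zeta_four).of_eq (fun n => by simp) rfl)
    (by simp [harmonic])
  refine h.of_eq (fun n => ?_) (by ring)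
  rw [add_zero, inv_pow]; ring

theorem inv_add_half (n : ℕ) : ((n : ℝ) + 1 / 2)⁻¹ = 2 * oddInv n := by
  rw [oddInv]; field_simp

theorem oddHarmonic_eq_harmonic (n : ℕ) :
    oddHarmonic n = harmonic (2 * n + 1) - harmonic n / 2 := by
  induction n with
  | zero => simp [oddHarmonic_zero, harmonic]
  | succ n ih =>
    rw [oddHarmonic_succ, ih, show 2 * (n + 1) + 1 = 2 * n + 1 + 1 + 1 by ring,
      harmonic_succ (2 * n + 1 + 1), harmonic_succ (2 * n + 1), harmonic_succ n, oddInv]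
    push_cast
    field_simp
    ring

/-- The difference equals 2(H_{2N} - H_N) in ordinary harmonic numbers, so Euler's constant cancels.
-/
theorem tendsto_sum_inv_add_half_sub_harmonic :
    Tendsto (fun N : ℕ => ∑ m ∈ Finset.range N, ((m : ℝ) + 1 / 2)⁻¹ - harmonic N)
      atTop (𝓝 (2 * Real.log 2)) := by
  have h := Real.tendsto_harmonic_sub_log
  have h2 : Tendsto (fun n : ℕ => 2 * n) atTop atTop :=
    tendsto_id.const_mul_atTop' two_pos
  have h3 := (((h.comp h2).sub h).const_mul 2).add_const (2 * Real.log 2)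
  rw [sub_self, mul_zero, zero_add] at h3
  refine h3.congr' ?_
  filter_upwards [eventually_ge_atTop 1] with N hN
  obtain ⟨n, rfl⟩ : ∃ n, N = n + 1 := ⟨N - 1, by omega⟩
  have h4 : ∑ m ∈ Finset.range (n + 1), ((m : ℝ) + 1 / 2)⁻¹ = 2 * oddHarmonic n := by
    simp only [inv_add_half, ← Finset.mul_sum, oddHarmonic, oddInv]
  have h5 : Real.log ((2 * (n + 1) : ℕ) : ℝ) = Real.log 2 + Real.log ((n + 1 : ℕ) : ℝ) := by
    push_cast
    rw [Real.log_mul two_ne_zero (by positivity)]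
  rw [h4, oddHarmonic_eq_harmonic]
  simp only [Function.comp_apply]
  rw [h5, show 2 * (n + 1) = 2 * n + 1 + 1 by ring, harmonic_succ (2 * n + 1), harmonic_succ n]
  push_cast
  field_simp
  ring

/-- The value of `∑ H_n / (2n+1)^3`. -/
theorem hasSum_oddInv_pow_three_mul_harmonic :
    HasSum (fun n : ℕ => oddInv n ^ 3 * (harmonic n : ℝ))
      (Real.pi ^ 4 / 64 - 7 / 4 * Real.log 2 * (riemannZeta 3).re) := by
  have h := hasSum_harmonic_add_mul_inv_add_pow_three (z := 1 / 2) (by norm_num) (by norm_num)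
    ((hasSum_oddInv_sq.mul_left 4).of_eq (fun n => by rw [inv_add_half]; ring) rfl)
    ((hasSum_oddInv_pow_four.mul_left 16).of_eq (fun n => by rw [inv_add_half]; ring) rfl)
    tendsto_sum_inv_add_half_sub_harmonic
  refine ((h.mul_left (1 / 8)).sub (hasSum_oddInv_pow_three.mul_left (2 * Real.log 2))).of_eq
    (fun n => ?_) ?_
  · rw [inv_add_half]; ring
  · ring

/-! ### Logarithmic integrals on (0, 1/2) and Li_4(1/2). -/

section

open MeasureTheory

/-- The integral `∫_0^{1/2} log(v)^j log(1-v)^k dv / v`. -/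
noncomputable def logIntegralZero (j k : ℕ) : ℝ :=
  ∫ v in (0 : ℝ)..(1 / 2), Real.log v ^ j * Real.log (1 - v) ^ k * v⁻¹

/-- The integral `∫_0^{1/2} log(v)^j log(1-v)^k dv / (1-v)`. -/
noncomputable def logIntegralOne (j k : ℕ) : ℝ :=
  ∫ v in (0 : ℝ)..(1 / 2), Real.log v ^ j * Real.log (1 - v) ^ k * (1 - v)⁻¹

theorem abs_log_one_sub_le {v : ℝ} (h : v ∈ Set.Ioo (0 : ℝ) (1 / 2)) :
    |Real.log (1 - v)| ≤ 2 * v := by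
  have h1 : 0 < 1 - v := by linarith [h.2]
  rw [abs_of_nonpos (Real.log_nonpos h1.le (by linarith [h.1]))]
  have h2 := Real.one_sub_inv_le_log_of_pos h1
  have h3 : (1 - v)⁻¹ ≤ 1 + 2 * v := by
    rw [inv_le_iff_one_le_mul₀ h1]
    nlinarith [h.1, h.2]
  linarith

theorem abs_log_one_sub_pow_le_one {v : ℝ} (h : v ∈ Set.Ioo (0 : ℝ) (1 / 2)) (k : ℕ) :
    |Real.log (1 - v)| ^ k ≤ 1 :=
  pow_le_one₀ (abs_nonneg _) ((abs_log_one_sub_le h).trans (by linarith [h.2]))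

theorem intervalIntegrable_logIntegralZero (j k : ℕ) :
    IntervalIntegrable (fun v => Real.log v ^ j * Real.log (1 - v) ^ (k + 1) * v⁻¹)
      volume 0 (1 / 2) := by
  refine intervalIntegrable_of_abs_le (by norm_num) (by fun_prop)
    (((intervalIntegrable_log_pow j (by norm_num) (by norm_num)).abs).const_mul 2) fun v hv => ?_
  have h1 := abs_log_one_sub_pow_le_one hv k
  have h2 := abs_log_one_sub_le hv
  have hv0 := hv.1
  rw [abs_mul, abs_mul, abs_pow, abs_pow, abs_inv, abs_of_pos hv0, pow_succ]
  calc |Real.log v| ^ j * (|Real.log (1 - v)| ^ k * |Real.log (1 - v)|) * v⁻¹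
      ≤ |Real.log v| ^ j * (1 * (2 * v)) * v⁻¹ := by gcongr
    _ = 2 * |Real.log v| ^ j := by field_simp

theorem intervalIntegrable_logIntegralOne (j k : ℕ) :
    IntervalIntegrable (fun v => Real.log v ^ j * Real.log (1 - v) ^ k * (1 - v)⁻¹)
      volume 0 (1 / 2) := by
  refine intervalIntegrable_of_abs_le (by norm_num) (by fun_prop)
    (((intervalIntegrable_log_pow j (by norm_num) (by norm_num)).abs).const_mul 2) fun v hv => ?_
  have h1 := abs_log_one_sub_pow_le_one hv k
  have hv0 : 0 < 1 - v := by linarith [hv.2]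
  have h3 : (1 - v)⁻¹ ≤ 2 := by
    rw [inv_le_comm₀ hv0 two_pos]; linarith [hv.2]
  rw [abs_mul, abs_mul, abs_pow, abs_pow, abs_inv, abs_of_pos hv0]
  calc |Real.log v| ^ j * |Real.log (1 - v)| ^ k * (1 - v)⁻¹
      ≤ |Real.log v| ^ j * 1 * 2 := by gcongr
    _ = 2 * |Real.log v| ^ j := by ring

/-- Integrates the derivative of log^j v · log^(k+1)(1-v). At v = 1/2 both logarithms equal -log 2.
For j = 0 the truncated `j - 1` is harmless, since its coefficient is zero. -/
theorem logIntegral_by_parts (j k : ℕ) :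
    j * logIntegralZero (j - 1) (k + 1) - (k + 1) * logIntegralOne j k =
      (-Real.log 2) ^ (j + k + 1) := by
  have hi1 := (intervalIntegrable_logIntegralZero (j - 1) k).const_mul (j : ℝ)
  have hi2 := (intervalIntegrable_logIntegralOne j k).const_mul ((k : ℝ) + 1)
  have hderiv : ∀ v ∈ Set.Ioo (0 : ℝ) (1 / 2),
      HasDerivAt (fun v => Real.log v ^ j * Real.log (1 - v) ^ (k + 1))
        ((j : ℝ) * (Real.log v ^ (j - 1) * Real.log (1 - v) ^ (k + 1) * v⁻¹)
          - ((k : ℝ) + 1) * (Real.log v ^ j * Real.log (1 - v) ^ k * (1 - v)⁻¹)) v := by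
    intro v hv
    have h0 : 1 - v ≠ 0 := by linarith [hv.2]
    have h1 := (Real.hasDerivAt_log hv.1.ne').fun_pow j
    have h2 := (((hasDerivAt_id v).const_sub 1).log h0).fun_pow (k + 1)
    refine (h1.fun_mul h2).congr_deriv ?_
    simp only [id, Nat.add_sub_cancel]
    push_cast
    ring
  have hl : Tendsto (fun v => Real.log v ^ j * Real.log (1 - v) ^ (k + 1)) (𝓝[>] 0) (𝓝 0) := by
    have h := ((tendsto_mul_log_pow j).abs.const_mul 2)
    rw [abs_zero, mul_zero] at h
    refine squeeze_zero_norm' ?_ h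
    filter_upwards [Ioo_mem_nhdsGT (show (0 : ℝ) < 1 / 2 by norm_num)] with v hv
    have h1 := abs_log_one_sub_pow_le_one hv k
    have h2 := abs_log_one_sub_le hv
    rw [Real.norm_eq_abs, abs_mul, abs_mul, abs_pow, abs_pow, abs_of_pos hv.1, pow_succ]
    calc |Real.log v| ^ j * (|Real.log (1 - v)| ^ k * |Real.log (1 - v)|)
        ≤ |Real.log v| ^ j * (1 * (2 * v)) := by gcongr
      _ = 2 * (v * |Real.log v| ^ j) := by ring
  have hr : Tendsto (fun v => Real.log v ^ j * Real.log (1 - v) ^ (k + 1)) (𝓝[<] (1 / 2))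
      (𝓝 ((-Real.log 2) ^ (j + k + 1))) := by
    have h1 : ContinuousAt (fun v => Real.log v ^ j * Real.log (1 - v) ^ (k + 1))
        ((1 : ℝ) / 2) := by
      have h2 : ContinuousAt (fun v : ℝ => Real.log (1 - v)) (1 / 2) :=
        (by fun_prop : ContinuousAt (fun v : ℝ => 1 - v) (1 / 2)).log (by norm_num)
      exact ((Real.continuousAt_log (by norm_num)).pow j).mul (h2.pow (k + 1))
    have h2 := h1.tendsto.mono_left (nhdsWithin_le_nhds (s := Set.Iio (1 / 2)))
    have e : Real.log (1 / 2) = -Real.log 2 := by rw [one_div, Real.log_inv]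
    have e2 : (1 : ℝ) - 1 / 2 = 1 / 2 := by norm_num
    simp only [e2, e] at h2
    rwa [← pow_add, ← add_assoc] at h2
  have hFTC := intervalIntegral.integral_eq_sub_of_hasDerivAt_of_tendsto (by norm_num) hderiv
    (hi1.sub hi2) hl hr
  rw [intervalIntegral.integral_sub hi1 hi2, intervalIntegral.integral_const_mul,
    intervalIntegral.integral_const_mul, sub_zero] at hFTC
  exact hFTC

/-- The reflection v ↦ 1 - v carries the part over (1/2, 1) to an integral against dv / v. -/
theorem integral_log_pow_mul_log_one_sub_pow (j k : ℕ) :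
    ∫ v in (0 : ℝ)..1, Real.log v ^ (j + 1) * Real.log (1 - v) ^ k * (1 - v)⁻¹ =
      logIntegralOne (j + 1) k + logIntegralZero k (j + 1) := by
  have h2 := (intervalIntegrable_logIntegralZero k j).comp_sub_left 1
  have h3 : ∫ v in (1 / 2 : ℝ)..1,
      Real.log v ^ (j + 1) * Real.log (1 - v) ^ k * (1 - v)⁻¹ = logIntegralZero k (j + 1) := by
    have := intervalIntegral.integral_comp_sub_left (a := 0) (b := 1 / 2)
      (fun v : ℝ => Real.log v ^ (j + 1) * Real.log (1 - v) ^ k * (1 - v)⁻¹) 1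
    rw [show (1 : ℝ) - 1 / 2 = 1 / 2 by norm_num, sub_zero] at this
    rw [← this, logIntegralZero]
    simp only [sub_sub_cancel]
    exact intervalIntegral.integral_congr fun v _ => by ring
  rw [← h3, logIntegralOne]
  refine (intervalIntegral.integral_add_adjacent_intervals
    (intervalIntegrable_logIntegralOne _ _) ?_).symm
  simp only [sub_sub_cancel, sub_zero] at h2
  rw [show (1 : ℝ) - 1 / 2 = 1 / 2 by norm_num] at h2
  exact h2.symm.congr fun v _ => by ring

theorem integral_zero_one_eq_integral_div_one_sub (g : ℝ → ℝ) :
    ∫ x in (0 : ℝ)..1, g x =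
      ∫ v in (0 : ℝ)..(1 / 2), (1 - v)⁻¹ ^ 2 * g (v * (1 - v)⁻¹) := by
  have himg : (fun v : ℝ => v * (1 - v)⁻¹) '' Set.Ioo 0 (1 / 2) = Set.Ioo (0 : ℝ) 1 := by
    ext y
    constructor
    · rintro ⟨v, hv, rfl⟩
      have h1 : 0 < 1 - v := by linarith [hv.2]
      refine ⟨mul_pos hv.1 (inv_pos.2 h1), ?_⟩
      simp only [← div_eq_mul_inv]
      rw [div_lt_one h1]; linarith [hv.2]
    · intro hy
      have h1 : 0 < 1 + y := by linarith [hy.1]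
      refine ⟨y / (1 + y), ⟨div_pos hy.1 h1, ?_⟩, ?_⟩
      · rw [div_lt_div_iff₀ h1 two_pos]; linarith [hy.2]
      · have : 1 - y / (1 + y) = (1 + y)⁻¹ := by field_simp; ring
        simp only [this, inv_inv]
        field_simp
  have hd : ∀ v ∈ Set.Ioo (0 : ℝ) (1 / 2), HasDerivWithinAt (fun v : ℝ => v * (1 - v)⁻¹)
      ((1 - v)⁻¹ ^ 2) (Set.Ioo 0 (1 / 2)) v := fun v hv => by
    have h1 : 1 - v ≠ 0 := by linarith [hv.2]
    have := ((hasDerivAt_id v).fun_mul (((hasDerivAt_id v).const_sub 1).fun_inv h1))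
    refine (this.congr_deriv ?_).hasDerivWithinAt
    simp only [id]
    field_simp
    ring
  have hinj : Set.InjOn (fun v : ℝ => v * (1 - v)⁻¹) (Set.Ioo 0 (1 / 2)) := by
    intro a ha b hb hab
    have h1 : 1 - a ≠ 0 := by linarith [ha.2]
    have h2 : 1 - b ≠ 0 := by linarith [hb.2]
    simp only [← div_eq_mul_inv] at hab
    rw [div_eq_div_iff h1 h2] at hab
    linarith
  have hcv := integral_image_eq_integral_abs_deriv_smul measurableSet_Ioo hd hinj g
  rw [himg, ← integral_Ioc_eq_integral_Ioo, ← intervalIntegral.integral_of_le zero_le_one,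
    ← integral_Ioc_eq_integral_Ioo, ← intervalIntegral.integral_of_le (by norm_num)] at hcv
  rw [hcv]
  refine intervalIntegral.integral_congr fun v _ => ?_
  simp only [smul_eq_mul, abs_of_nonneg (sq_nonneg (1 - v)⁻¹)]

/-- Under x = v/(1-v) one has log x = log v - log(1-v) and 1 + x = 1/(1-v); the three terms are the
expanded square. -/
theorem integral_log_sq_mul_log_one_add_pow (k : ℕ) :
    ∫ x in (0 : ℝ)..1, Real.log x ^ 2 * (Real.log (1 + x) ^ k * (1 + x)⁻¹) =
      (-1) ^ k *
        (logIntegralOne 2 k - 2 * logIntegralOne 1 (k + 1) + logIntegralOne 0 (k + 2)) := by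
  have hi := intervalIntegrable_logIntegralOne
  rw [integral_zero_one_eq_integral_div_one_sub, logIntegralOne, logIntegralOne, logIntegralOne,
    ← intervalIntegral.integral_const_mul,
    ← intervalIntegral.integral_sub (hi _ _) ((hi _ _).const_mul _),
    ← intervalIntegral.integral_add ((hi _ _).sub ((hi _ _).const_mul _)) (hi _ _),
    ← intervalIntegral.integral_const_mul, intervalIntegral.integral_of_le (by norm_num),
    intervalIntegral.integral_of_le (by norm_num), integral_Ioc_eq_integral_Ioo,
    integral_Ioc_eq_integral_Ioo]
  refine setIntegral_congr_fun measurableSet_Ioo fun v hv => ?_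
  have h1 : 1 - v ≠ 0 := by linarith [hv.2]
  have h2 : 1 + v * (1 - v)⁻¹ = (1 - v)⁻¹ := by field_simp; ring
  have h3 : Real.log (1 - v)⁻¹ ^ k = (-1) ^ k * Real.log (1 - v) ^ k := by
    rw [Real.log_inv, neg_pow]
  simp only [h2, inv_inv, Real.log_mul hv.1.ne' (inv_ne_zero h1), h3]
  rw [Real.log_inv]
  field_simp
  ring

end

theorem harmonic_nonneg (n : ℕ) : 0 ≤ (harmonic n : ℝ) := by
  simpa using harmonic_add_sub_nonneg 0 n

theorem harmonic_le (n : ℕ) : (harmonic n : ℝ) ≤ n := by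
  simpa using harmonic_add_sub_le 0 n

theorem hasSum_harmonic_mul_pow {x : ℝ} (hx : |x| < 1) :
    HasSum (fun n : ℕ => (harmonic n : ℝ) * x ^ n) (-(Real.log (1 - x) * (1 - x)⁻¹)) := by
  have hs : Summable fun n : ℕ => (harmonic n : ℝ) * x ^ n := by
    refine Summable.of_norm_bounded
      (g := fun n : ℕ => ‖(n : ℝ) ^ 1 * x ^ n‖)
      (summable_norm_pow_mul_geometric_of_norm_lt_one 1 (by simpa using hx)) fun n => ?_
    rw [norm_mul, norm_mul, pow_one, Real.norm_of_nonneg (harmonic_nonneg n),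
      Real.norm_of_nonneg n.cast_nonneg]
    exact mul_le_mul_of_nonneg_right (harmonic_le n) (norm_nonneg _)
  obtain ⟨F, hF⟩ := hs
  have h1 := (hasSum_nat_add_iff' 1).2 hF
  have h2 := (hF.mul_left x).add (Real.hasSum_pow_div_log_of_abs_lt_one hx)
  -- The recurrence of the harmonic numbers is the functional equation F = xF - log(1-x) of their
  -- generating function.
  have h3 : F = x * F + -Real.log (1 - x) := by
    have := h1.unique (h2.of_eq (fun n => by rw [harmonic_succ]; push_cast; field_simp; ring) rfl)
    simpa [harmonic] using this
  have h4 : 1 - x ≠ 0 := by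
    have := (abs_lt.1 hx).2
    linarith
  have h5 : F = -(Real.log (1 - x) * (1 - x)⁻¹) := by
    field_simp
    linear_combination h3
  rwa [← h5]

theorem integral_log_sq_mul_log_one_sub_mul_inv :
    logIntegralOne 2 1 + logIntegralZero 1 2 = -(Real.pi ^ 4 / 180) := by
  rw [← integral_log_pow_mul_log_one_sub_pow 1 1]
  have h := hasSum_integral_log_pow_mul (k := 2) (c := fun n => -(harmonic n : ℝ))
    (g := fun x => Real.log (1 - x) * (1 - x)⁻¹)
    (fun x hx => ((hasSum_harmonic_mul_pow (abs_lt.2 ⟨by linarith [hx.1], hx.2⟩)).neg).of_eq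
      (fun n => by ring) (by ring))
    (by simpa only [abs_neg, abs_of_nonneg (harmonic_nonneg _)] using
      hasSum_harmonic_div_succ_pow_three.summable)
  have h2 := h.unique ((hasSum_harmonic_div_succ_pow_three.mul_left (-2)).of_eq
    (fun n => by norm_num [Nat.factorial]; ring) rfl)
  simp only [pow_one, mul_assoc] at h2 ⊢
  rw [h2]; ring

theorem integral_log_sq_mul_inv_one_add :
    logIntegralOne 2 0 - 2 * logIntegralOne 1 1 + logIntegralOne 0 2 =
      3 / 2 * (riemannZeta 3).re := by
  have h0 := integral_log_sq_mul_log_one_add_pow 0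
  have h3 := hasSum_alternating_pow three_ne_zero hasSum_zeta_three
  have h := hasSum_integral_log_pow_mul (k := 2) (c := fun n => (-1) ^ n)
    (g := fun x => Real.log (1 + x) ^ 0 * (1 + x)⁻¹)
    (fun x hx => (hasSum_geometric_of_abs_lt_one (r := -x)
        (abs_lt.2 ⟨by linarith [hx.2], by linarith [hx.1]⟩)).of_eq
      (fun n => (neg_pow _ _).symm) (by simp))
    (by simpa using (hasSum_one_div_succ_pow three_ne_zero hasSum_zeta_three).summable)
  have h2 := h.unique ((h3.mul_left 2).of_eq (fun n => by norm_num [Nat.factorial]) rfl)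
  rw [h2] at h0
  linarith

theorem hasSum_alternating_harmonic_div_succ_pow_three_integral :
    HasSum (fun n : ℕ => (-1) ^ n * ((harmonic n : ℝ) / ((n : ℝ) + 1) ^ 3))
      (1 / 2 * (logIntegralOne 2 1 - 2 * logIntegralOne 1 2 + logIntegralOne 0 3)) := by
  have h0 := integral_log_sq_mul_log_one_add_pow 1
  have h := hasSum_integral_log_pow_mul (k := 2) (c := fun n => -((-1) ^ n * (harmonic n : ℝ)))
    (g := fun x => Real.log (1 + x) ^ 1 * (1 + x)⁻¹)
    (fun x hx => ((hasSum_harmonic_mul_pow (x := -x)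
        (abs_lt.2 ⟨by linarith [hx.2], by linarith [hx.1]⟩)).neg).of_eq
      (fun n => by rw [neg_pow x]; ring) (by rw [pow_one, sub_neg_eq_add]; ring))
    (by simpa only [abs_neg, abs_mul, abs_pow, abs_one, one_pow, one_mul,
        abs_of_nonneg (harmonic_nonneg _)] using hasSum_harmonic_div_succ_pow_three.summable)
  rw [h0] at h
  refine (h.mul_left (-1 / 2)).of_eq (fun n => ?_) (by ring)
  norm_num [Nat.factorial]
  ring

open MeasureTheory in
theorem logIntegralZero_polylog :
    logIntegralZero 2 1 + 2 * Real.log 2 * logIntegralZero 1 1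
      + Real.log 2 ^ 2 * logIntegralZero 0 1 = -(2 * polylogNat 4 (1 / 2)) := by
  have hi := intervalIntegrable_logIntegralZero
  have hsum : Summable fun n : ℕ => (1 / 2 : ℝ) ^ (n + 1) / ((n : ℝ) + 1) ^ 4 := by
    refine Summable.of_nonneg_of_le (fun n => by positivity) (fun n => ?_)
      (hasSum_one_div_succ_pow four_ne_zero hasSum_zeta_four).summable
    gcongr
    exact pow_le_one₀ (by norm_num) (by norm_num)
  have h := hasSum_integral_log_pow_mul (k := 2)
    (c := fun n => -((1 / 2 : ℝ) ^ (n + 1) / ((n : ℝ) + 1)))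
    (g := fun x => Real.log (1 - x / 2) * x⁻¹)
    (fun x hx => by
      have hx0 := hx.1.ne'
      refine ((Real.hasSum_pow_div_log_of_abs_lt_one (x := x / 2)
        (abs_lt.2 ⟨by linarith [hx.1], by linarith [hx.2]⟩)).mul_left (-x⁻¹)).of_eq
        (fun n => ?_) (by ring)
      rw [div_pow, div_pow, one_pow]
      field_simp
      ring)
    (by
      refine hsum.congr fun n => ?_
      rw [abs_neg, abs_of_nonneg (by positivity)]
      field_simp)
  have h2 := h.unique ((hsum.hasSum.mul_left (-2)).of_eq
    (fun n => by norm_num [Nat.factorial]; field_simp) rfl)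
  -- Scaling by 1/2 replaces log x by log v + log 2; expanding its square yields the three integrals
  -- of the statement.
  have hsub := intervalIntegral.integral_comp_mul_left (a := 0) (b := 1)
    (fun v : ℝ => (Real.log v + Real.log 2) ^ 2 * Real.log (1 - v) * v⁻¹)
    (one_div_ne_zero (two_ne_zero (α := ℝ)))
  have e1 : ∫ x in (0 : ℝ)..1, (Real.log (1 / 2 * x) + Real.log 2) ^ 2 *
      Real.log (1 - 1 / 2 * x) * (1 / 2 * x)⁻¹ =
      2 * ∫ x in (0 : ℝ)..1, Real.log x ^ 2 * (Real.log (1 - x / 2) * x⁻¹) := by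
    rw [← intervalIntegral.integral_const_mul, intervalIntegral.integral_of_le (by norm_num),
      intervalIntegral.integral_of_le (by norm_num), integral_Ioc_eq_integral_Ioo,
      integral_Ioc_eq_integral_Ioo]
    refine setIntegral_congr_fun measurableSet_Ioo fun x hx => ?_
    have hlog : Real.log (1 / 2 * x) = Real.log x - Real.log 2 := by
      rw [Real.log_mul (by norm_num) hx.1.ne', one_div, Real.log_inv]; ring
    simp only [hlog]
    simp only [mul_inv, one_div, inv_inv]
    rw [show 1 - 2⁻¹ * x = 1 - x / 2 by ring]
    ring
  have e2 : ∫ v in (0 : ℝ)..(1 / 2),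
      (Real.log v + Real.log 2) ^ 2 * Real.log (1 - v) * v⁻¹ =
      logIntegralZero 2 1 + 2 * Real.log 2 * logIntegralZero 1 1
      + Real.log 2 ^ 2 * logIntegralZero 0 1 := by
    rw [logIntegralZero, logIntegralZero, logIntegralZero,
      ← intervalIntegral.integral_const_mul, ← intervalIntegral.integral_const_mul,
      ← intervalIntegral.integral_add (hi _ _) ((hi _ _).const_mul _),
      ← intervalIntegral.integral_add ((hi _ _).add ((hi _ _).const_mul _)) ((hi _ _).const_mul _)]
    exact intervalIntegral.integral_congr fun v _ => by ring
  rw [e1, mul_zero, mul_one, e2, h2, smul_eq_mul] at hsub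
  rw [polylogNat]
  linarith

/-- Linear algebra: reflection, integration by parts and the special evaluations form a linear
system for the logarithmic integrals of weights two to four, which determines the combination
representing the series. -/
theorem hasSum_alternating_harmonic_div_succ_pow_three :
    HasSum (fun n : ℕ => (-1) ^ n * ((harmonic n : ℝ) / ((n : ℝ) + 1) ^ 3))
      (Real.pi ^ 4 / 48 + Real.pi ^ 2 * Real.log 2 ^ 2 / 12 - Real.log 2 ^ 4 / 12
        - 7 / 4 * Real.log 2 * (riemannZeta 3).re - 2 * polylogNat 4 (1 / 2)) := by
  refine hasSum_alternating_harmonic_div_succ_pow_three_integral.of_eq (fun n => rfl) ?_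
  have hz := fun k : ℕ => integral_log_pow_mul_log_one_sub_pow k 0
  simp only [pow_zero, mul_one] at hz
  have f1 := hz 0
  have f2 := hz 1
  have f3 := hz 2
  rw [integral_log_pow_div_one_sub hasSum_zeta_two] at f1
  rw [integral_log_pow_div_one_sub hasSum_zeta_three] at f2
  rw [integral_log_pow_div_one_sub hasSum_zeta_four] at f3
  have p10 := logIntegral_by_parts 1 0
  have p20 := logIntegral_by_parts 2 0
  have p11 := logIntegral_by_parts 1 1
  have p02 := logIntegral_by_parts 0 2
  have p30 := logIntegral_by_parts 3 0
  have p21 := logIntegral_by_parts 2 1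
  have p12 := logIntegral_by_parts 1 2
  have p03 := logIntegral_by_parts 0 3
  have z := integral_log_sq_mul_log_one_sub_mul_inv
  have et := integral_log_sq_mul_inv_one_add
  have li := logIntegralZero_polylog
  norm_num [Nat.factorial] at f1 f2 f3 p10 p20 p11 p02 p30 p21 p12 p03
  generalize logIntegralZero 0 1 = P01 at *
  generalize logIntegralZero 0 2 = P02 at *
  generalize logIntegralZero 0 3 = P03 at *
  generalize logIntegralZero 1 1 = P11 at *
  generalize logIntegralZero 1 2 = P12 at *
  generalize logIntegralZero 2 1 = P21 at *
  generalize logIntegralOne 1 0 = Q10 at *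
  generalize logIntegralOne 2 0 = Q20 at *
  generalize logIntegralOne 3 0 = Q30 at *
  generalize logIntegralOne 1 1 = Q11 at *
  generalize logIntegralOne 1 2 = Q12 at *
  generalize logIntegralOne 2 1 = Q21 at *
  generalize logIntegralOne 0 2 = Q02 at *
  generalize logIntegralOne 0 3 = Q03 at *
  generalize Real.log 2 = L at *
  generalize (riemannZeta 3).re = Z at *
  -- These two integrals occur in `li` multiplied by powers of log 2, so they are solved for first
  -- to keep the last step linear.
  have hP11 : P11 = 7 / 8 * Z - L ^ 3 / 3 := by linarith
  have hP01 : P01 = (L ^ 2 - Real.pi ^ 2 / 6) / 2 := by linarith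
  rw [hP11, hP01] at li
  linarith

/-! ### The linear and quadratic odd Euler sums. -/

theorem HasSum.even_of_alternating {f : ℕ → ℝ} {A B : ℝ} (hA : HasSum f A)
    (hB : HasSum (fun n => (-1) ^ n * f n) B) : HasSum (fun n => f (2 * n)) ((A + B) / 2) := by
  have h := (hA.add hB).div_const 2
  rw [← (mul_right_injective₀ (two_ne_zero (α := ℕ))).hasSum_iff] at h
  · refine h.of_eq (fun n => ?_) rfl
    simp only [Function.comp_apply, pow_mul]
    norm_num
  · intro n hn
    have hodd : Odd n := by
      by_contra hn'
      obtain ⟨k, hk⟩ := Nat.not_odd_iff_even.1 hn'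
      exact hn ⟨k, by simp only; omega⟩
    rw [hodd.neg_one_pow]; ring

/-- The value of `∑ 𝓗_n / (2n+1)^3`. -/
theorem hasSum_oddHarmonic_mul_oddInv_pow_three :
    HasSum (fun n => oddHarmonic n * oddInv n ^ 3)
      (83 * Real.pi ^ 4 / 5760 + Real.pi ^ 2 / 24 * Real.log 2 ^ 2 - Real.log 2 ^ 4 / 24
        - polylogNat 4 (1 / 2)) := by
  have h1 := hasSum_harmonic_div_succ_pow_three.add
    (hasSum_one_div_succ_pow four_ne_zero hasSum_zeta_four)
  have h2 := hasSum_alternating_harmonic_div_succ_pow_three.add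
    (hasSum_alternating_pow four_ne_zero hasSum_zeta_four)
  -- The even indices 2n of ∑ H_{k+1}/(k+1)^3, H now the ordinary harmonic number, are the terms
  -- with odd denominators 2n + 1.
  have h3 := h1.even_of_alternating (h2.of_eq (fun n => by ring) rfl)
  refine (h3.sub (hasSum_oddInv_pow_three_mul_harmonic.mul_left (1 / 2))).of_eq (fun n => ?_) ?_
  · rw [oddHarmonic_eq_harmonic, harmonic_succ, oddInv]
    push_cast
    field_simp
  · ring

theorem hasSum_oddHarmonic_sq_mul_oddInv_sq :
    HasSum (fun n => oddHarmonic n ^ 2 * oddInv n ^ 2)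
      (83 * Real.pi ^ 4 / 5760 + Real.pi ^ 2 / 6 * Real.log 2 ^ 2 - Real.log 2 ^ 4 / 24
        - polylogNat 4 (1 / 2)) := by
  refine (((hasSum_oddInv_sq_mul_oddHarmonicMid_sq.mul_left (1 / 4)).sub
    (hasSum_oddInv_pow_four.mul_left (1 / 4))).add
    hasSum_oddHarmonic_mul_oddInv_pow_three).of_eq (fun n => ?_) ?_
  · rw [oddHarmonicMid]; ring
  · ring

/-! ### The hypergeometric series and the bilateral sums. -/

/-- Both sides have the same ratio of consecutive terms; no lower parameter is a nonpositive
integer, as the recurrence of the coefficients requires. -/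
theorem regularizedHGFunCoeff_eq_wallisSq (n : ℕ) :
    (({1, 3 / 2, 3 / 2, 3 / 2} : Multiset ℂ).map Complex.Gamma).prod *
      Complex.regularizedHGFunCoeff {1 / 2, 1 / 2, 1 / 2, 1 / 2, 1 / 2} {1, 3 / 2, 3 / 2, 3 / 2} n =
      ((wallisSq n * oddInv n ^ 3 : ℝ) : ℂ) := by
  induction n with
  | zero =>
    have h : Complex.Gamma (3 / 2) ≠ 0 := Complex.Gamma_ne_zero_of_re_pos (by norm_num)
    simp [Complex.regularizedHGFunCoeff, wallisSq, oddInv_zero]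
    field_simp
  | succ n ih =>
    have h1 : ((n : ℝ) + 1) ≠ 0 := by positivity
    have h3 : (2 * (n : ℝ) + 3) ≠ 0 := by positivity
    have h1' : ((n : ℂ) + 1) ≠ 0 := by exact_mod_cast h1
    have h3' : (2 * (n : ℂ) + 3) ≠ 0 := by exact_mod_cast h3
    have hn : ∀ r : ℝ, 0 < r → ((r : ℝ) : ℂ) ≠ -(n : ℂ) := fun r hr h => by
      have : r = -(n : ℝ) := by exact_mod_cast h
      linarith [n.cast_nonneg (α := ℝ)]
    rw [Complex.regularizedHGFunCoeff_add_one, ← mul_assoc, ih, wallisSq_succ]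
    · have e : oddInv (n + 1) ^ 3 = oddInv n ^ 3 * ((2 * n + 1) / (2 * n + 3)) ^ 3 := by
        simp only [oddInv]
        push_cast
        field_simp
        ring
      rw [e]
      simp only [Multiset.insert_eq_cons, Multiset.map_cons, Multiset.map_singleton,
        Multiset.prod_cons, Multiset.prod_singleton]
      push_cast
      have e2 : (3 / 2 + (n : ℂ)) = (2 * n + 3) / 2 := by ring
      rw [e2, add_comm (1 : ℂ) n]
      field_simp
      ring
    · intro k hk
      simp only [Multiset.insert_eq_cons, Multiset.mem_cons, Multiset.mem_singleton] at hk
      rcases hk with rfl | rfl | rfl | rfl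
      · simpa using hn 1 one_pos
      all_goals simpa using hn (3 / 2) (by norm_num)

/-- The hypergeometric value as the sum of its defining series. -/
theorem hypergeometricPFQ_eq_of_hasSum {S : ℝ}
    (h : HasSum (fun n => wallisSq n * oddInv n ^ 3) S) :
    hypergeometricPFQ {1 / 2, 1 / 2, 1 / 2, 1 / 2, 1 / 2} {1, 3 / 2, 3 / 2, 3 / 2} 1 =
      (S : ℂ) := by
  rw [hypergeometricPFQ, Complex.regularizedHGFun, Complex.regularizedHGFunSeries,
    ← FormalMultilinearSeries.ofScalarsSum, FormalMultilinearSeries.ofScalarsSum_eq_tsum]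
  simp only [one_pow, smul_eq_mul, mul_one]
  rw [← tsum_mul_left]
  simp only [regularizedHGFunCoeff_eq_wallisSq]
  exact (Complex.hasSum_ofReal.2 h).tsum_eq

theorem oddHarmonicInt_neg_succ (n : ℕ) :
    oddHarmonicInt (-((n : ℤ) + 1)) = oddHarmonic n - oddInv n := by
  cases n with
  | zero => simpa [oddHarmonic_zero, oddInv_zero] using oddHarmonicInt_neg_one
  | succ n =>
    have : (-(((n + 1 : ℕ) : ℤ) + 1)) = -((n : ℤ) + 2) := by push_cast; ring
    rw [this, oddHarmonicInt_neg_add_two, oddHarmonic_succ]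
    ring

theorem neg_one_zpow_neg_succ (n : ℕ) : (-1 : ℝ) ^ (-((n : ℤ) + 1)) = -(-1) ^ n := by
  rw [zpow_neg, ← Nat.cast_succ, zpow_natCast, ← inv_pow, inv_neg_one, pow_succ]
  ring

theorem inv_two_mul_neg_succ_add_one (n : ℕ) :
    (2 * ((-((n : ℤ) + 1) : ℤ) : ℝ) + 1)⁻¹ = -oddInv n := by
  rw [oddInv, one_div, ← inv_neg]
  push_cast
  congr 1; ring

theorem sum_Icc_neg_eq (f : ℤ → ℝ) (M N : ℕ) :
    ∑ n ∈ Finset.Icc (-(M : ℤ)) N, f n =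
      ∑ n ∈ Finset.range (N + 1), f n + ∑ m ∈ Finset.range M, f (-((m : ℤ) + 1)) := by
  induction M with
  | zero =>
    rw [Finset.sum_range_zero, add_zero]
    induction N with
    | zero => simp
    | succ N ih =>
      rw [Finset.sum_range_succ, ← ih, Nat.cast_succ,
        add_comm (Finset.sum _ _),
        ← Finset.insert_Icc_right_eq_Icc_add_one (by omega), Finset.sum_insert (by simp)]
  | succ M ih =>
    rw [Finset.sum_range_succ _ M, ← add_assoc, ← ih, Nat.cast_succ,
      add_comm (Finset.sum _ _),
      ← Finset.insert_Icc_add_one_left_eq_Icc (a := -((M : ℤ) + 1)) (by omega),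
      Finset.sum_insert (by simp)]
    congr 3
    ring

theorem hasSum_alternating_oddInv_pow_four :
    HasSum (fun n => (-1) ^ n * oddInv n ^ 4) (dirichletBetaNat 4) := by
  refine hasSum_oddInv_pow_four.summable.alternating.hasSum.of_eq (fun n => rfl) ?_
  rw [dirichletBetaNat]
  exact tsum_congr fun n => by rw [oddInv, div_pow, one_pow, mul_one_div]

theorem tendsto_sum_alternating_oddHarmonic_pow_three {A₁ C₂ : ℝ}
    (hA : HasSum (fun n => (-1) ^ n * (oddHarmonic n * oddInv n ^ 3)) A₁)
    (hC : HasSum (fun n => (-1) ^ n * (oddHarmonic n ^ 2 * oddInv n ^ 2)) C₂) :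
    Tendsto (fun N : ℕ => ∑ n ∈ Finset.range N, (-1 : ℝ) ^ n * (oddInv n * oddHarmonic n ^ 3))
      atTop (𝓝 (1 / 2 * ((Real.pi / 16 * Real.log 2 ^ 3 + Real.pi ^ 3 / 32 * Real.log 2
        - 9 * Real.pi / 128 * (riemannZeta 3).re) + 3 * C₂ - 3 * A₁ + dirichletBetaNat 4))) := by
  refine ((((tendsto_sum_alternating_oddHarmonic_pow_three_fold.add
    (hC.tendsto_sum_nat.const_mul 3)).sub (hA.tendsto_sum_nat.const_mul 3)).add
    hasSum_alternating_oddInv_pow_four.tendsto_sum_nat).const_mul (1 / 2)).congr fun N => ?_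
  simp only [Finset.mul_sum, ← Finset.sum_add_distrib, ← Finset.sum_sub_distrib]
  exact Finset.sum_congr rfl fun n _ => by ring

theorem mainTheorem6 :
    -- the evaluation of the hypergeometric value by the cubic alternating sum
    (∃ S C : ℝ,
      HasSum (fun n : ℕ =>
        ((Nat.centralBinom n : ℝ) / 4 ^ n) ^ 2 / (2 * (n : ℝ) + 1) ^ 3) S ∧
      hypergeometricPFQ {1 / 2, 1 / 2, 1 / 2, 1 / 2, 1 / 2} {1, 3 / 2, 3 / 2, 3 / 2} 1 = (S : ℂ) ∧
      Tendsto (fun N : ℕ => ∑ n ∈ Finset.range N,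
        (-1 : ℝ) ^ n * oddHarmonic n ^ 3 / (2 * (n : ℝ) + 1)) atTop (𝓝 C) ∧
      S = 16 / (3 * Real.pi) * C - Real.log 2 ^ 3 / 6 - Real.pi ^ 2 / 12 * Real.log 2
        + 3 / 16 * (riemannZeta 3).re + 4 / (3 * Real.pi) * dirichletBetaNat 4) ∧
    -- the bilateral cubic alternating sum; both ends tend to infinity independently
    Tendsto (fun p : ℕ × ℕ => ∑ n ∈ Finset.Icc (-(p.1 : ℤ)) (p.2 : ℤ),
        (-1 : ℝ) ^ n * oddHarmonicInt n ^ 3 / (2 * (n : ℝ) + 1)) atTop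
      (𝓝 (Real.pi / 16 * Real.log 2 ^ 3 + Real.pi ^ 3 / 32 * Real.log 2
        - 9 * Real.pi / 128 * (riemannZeta 3).re)) ∧
    -- the bilateral quadratic sum
    HasSum (fun n : ℤ => oddHarmonicInt n ^ 2 / (2 * (n : ℝ) + 1) ^ 2)
      (Real.pi ^ 2 / 4 * Real.log 2 ^ 2 + Real.pi ^ 4 / 96) ∧
    -- the bilateral quadratic alternating sum
    HasSum (fun n : ℤ => (-1 : ℝ) ^ n * oddHarmonicInt n ^ 2 / (2 * (n : ℝ) + 1) ^ 2)
      (Real.pi ^ 3 / 16 * Real.log 2 - 7 * Real.pi / 64 * (riemannZeta 3).re) ∧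
    -- the unilateral quadratic sum
    HasSum (fun n : ℕ => oddHarmonic n ^ 2 / (2 * (n : ℝ) + 1) ^ 2)
      (83 * Real.pi ^ 4 / 5760 + Real.pi ^ 2 / 6 * Real.log 2 ^ 2 - Real.log 2 ^ 4 / 24
        - polylogNat 4 (1 / 2)) := by
  have hpi := Real.pi_ne_zero
  have hinv : ∀ n : ℕ, (2 * (n : ℝ) + 1)⁻¹ = oddInv n := fun n => by rw [oddInv, one_div]
  -- Only the existence of these two alternating sums is used; their values cancel in every identity
  -- below.
  obtain ⟨A₁, hA⟩ := hasSum_oddHarmonic_mul_oddInv_pow_three.summable.alternating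
  obtain ⟨C₂, hC⟩ := hasSum_oddHarmonic_sq_mul_oddInv_sq.summable.alternating
  have hC3 := tendsto_sum_alternating_oddHarmonic_pow_three hA hC
  have hβ := hasSum_alternating_oddInv_pow_four
  have hS : HasSum (fun n => wallisSq n * oddInv n ^ 3)
      (2 / Real.pi * (4 * C₂ - 4 * A₁ + 2 * dirichletBetaNat 4)) := by
    refine hasSum_wallisSq_mul_oddInv_pow_three ?_ ?_
    · exact (hasSum_oddInv_sq_mul_oddHarmonicMid_sq.summable.add
        hasSum_oddInv_pow_four.summable).congr fun n => by ring
    · exact (((hC.mul_left 4).sub (hA.mul_left 4)).add (hβ.mul_left 2)).of_eq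
        (fun n => by rw [oddHarmonicMid]; ring) rfl
  refine ⟨⟨_, _, hS.of_eq (fun n => ?_) rfl, hypergeometricPFQ_eq_of_hasSum hS,
    hC3.congr fun N => Finset.sum_congr rfl fun n _ => ?_, ?_⟩, ?_, ?_, ?_, ?_⟩
  · rw [div_eq_mul_inv, ← inv_pow, hinv, wallisSq]
  · rw [div_eq_mul_inv, hinv]; ring
  · field_simp
    ring
  -- The folded sum minus the unilateral one is the sum over negative indices: at -(n+1) both (-1)^n
  -- and 2n+1 change sign, so the product does not. The two ends then converge independently.
  · have hneg := tendsto_sum_alternating_oddHarmonic_pow_three_fold.sub hC3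
    have hadd := ((hC3.comp (tendsto_add_atTop_nat 1)).comp tendsto_snd).add
      (hneg.comp (tendsto_fst (f := atTop) (g := (atTop : Filter ℕ))))
    rw [prod_atTop_atTop_eq, add_sub_cancel] at hadd
    refine hadd.congr fun p => ?_
    rw [sum_Icc_neg_eq]
    simp only [Function.comp_apply, ← Finset.sum_sub_distrib]
    congr 1 <;> refine Finset.sum_congr rfl fun n _ => ?_
    · rw [oddHarmonicInt_natCast, div_eq_mul_inv, Int.cast_natCast, hinv, zpow_natCast]
      ring
    · rw [div_eq_mul_inv, oddHarmonicInt_neg_succ, neg_one_zpow_neg_succ,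
        inv_two_mul_neg_succ_add_one]
      ring
  · have hpos := hasSum_oddHarmonic_sq_mul_oddInv_sq
    have hneg := ((hasSum_oddInv_sq_mul_oddHarmonicMid_sq.add hasSum_oddInv_pow_four).mul_left
      (1 / 2)).sub hpos
    refine (HasSum.of_nat_of_neg_add_one (hpos.of_eq (fun n => ?_) rfl)
      (hneg.of_eq (fun n => ?_) rfl)).of_eq (fun n => rfl) (by ring)
    · rw [oddHarmonicInt_natCast, div_eq_mul_inv, ← inv_pow, Int.cast_natCast, hinv]
    · rw [div_eq_mul_inv, ← inv_pow, oddHarmonicInt_neg_succ, inv_two_mul_neg_succ_add_one,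
        oddHarmonicMid]
      ring
  -- Here 2n+1 is squared, so the sign change of (-1)^n at -(n+1) survives and the folded term is H²
  -- - (H - a)² = aM, with a = `oddInv n` and M = `oddHarmonicMid n`.
  · have hneg := hasSum_alternating_oddInv_pow_three_mul_oddHarmonicMid.sub hC
    refine (HasSum.of_nat_of_neg_add_one (hC.of_eq (fun n => ?_) rfl)
      (hneg.of_eq (fun n => ?_) rfl)).of_eq (fun n => rfl) (by ring)
    · rw [oddHarmonicInt_natCast, div_eq_mul_inv, ← inv_pow, Int.cast_natCast, hinv,
        zpow_natCast]
      ring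
    · rw [div_eq_mul_inv, ← inv_pow, oddHarmonicInt_neg_succ, inv_two_mul_neg_succ_add_one,
        neg_one_zpow_neg_succ, oddHarmonicMid]
      ring
  · refine hasSum_oddHarmonic_sq_mul_oddInv_sq.of_eq (fun n => ?_) rfl
    rw [div_eq_mul_inv, ← inv_pow, hinv]
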